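/- Let $\boldsymbol{X},\boldsymbol{X}_1,\boldsymbol{X}_2,\ldots$ be i.i.d. random vectors in $\mathbb{R}^d_+$, $d\ge 1$, and let $\boldsymbol{M}_n$ be the componentwise maximum of $\boldsymbol{X}_1,\ldots,\boldsymbol{X}_n$. Assume that there are vectors $\boldsymbol{a}_n\in(0,\infty)^d$ such that $\boldsymbol{a}_n/\|\boldsymbol{a}_n\|_\infty$ converges and $\boldsymbol{M}_n/\boldsymbol{a}_n$ (componentwise quotient) converges in distribution to a law with nondegenerate one-dimensional marginals. Let $\ell:\mathbb{R}\to[0,\infty)$ be measurable with at most polynomial growth (there are $K\ge 0$ and $p\in\mathbb{N}$ with $\ell(u)\le K(1+u^p)$ for all $u\ge 0$), differentiable on $(u_0,\infty)$ for some $u_0>0$, with $\ell'(u)=c_1u^{\rho}(1+o(1))$ as $u\to\infty$ for some $\rho\ge 0$, $c_1>0$. Let $\boldsymbol{\theta}\in(0,\infty)^d$, $L=\ell(\boldsymbol{\theta}^\intercal\boldsymbol{X})$, $L_i=\ell(\boldsymbol{\theta}^\intercal\boldsymbol{X}_i)$, and assume $E[L]<\infty$. For $\beta\in(0,1)$ put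 $$v_\beta=\inf\{u: P(L\le u)\ge 1-\beta\},\qquad C_\beta=E[L\mid L\ge v_\beta].$$ Let $L_{1,n}\le\cdots\le L_{n,n}$ be the order statistics of $L_1,\ldots,L_n$, and for $\beta_0\in(0,1)$ put $$\hat v_{\beta_0,n}=L_{\lceil n(1-\beta_0)\rceil,n},\qquad \hat C_{\beta_0,n}=\hat v_{\beta_0,n}+\frac1{n\beta_0}\sum_{i=1}^n\left[L_i-\hat v_{\beta_0,n}\right]^+,$$ $$\hat\xi_n=\frac1{n\beta_0}\sum_{i=0}^{\lfloor n\beta_0\rfloor-1}\left(\log L_{n-i,n}-\log L_{n-\lfloor n\beta_0\rfloor,n}\right)\ \text{(the Hill estimator)},\qquad \tilde C_{\beta,n}=\hat C_{\beta_0,n}\left(\beta_0/\beta\right)^{\hat\xi_n}.$$ For random variables $Y_n$ and numbers $r_n$, write $Y_n=o_P(r_n)$ if $P(|Y_n|>\varepsilon|r_n|)\to0$ for every $\varepsilon>0$. Suppose that, as $n\to\infty$, $\beta(n)\to 0$ through positive values and $\beta_0(n)/\beta(n)\to c\in(1,\infty)$, and that the sample-average estimators at the levels $\beta_0(n)$ have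 vanishing relative error: $\hat C_{\beta_0(n),n}-C_{\beta_0(n)}=o_P(C_{\beta_0(n)})$. Then the extrapolated estimators, computed with $\beta=\beta(n)$ and $\beta_0=\beta_0(n)$, also have vanishing relative error: $$\tilde C_{\beta(n),n}-C_{\beta(n)}=o_P(C_{\beta(n)})\qquad\text{as } n\to\infty.$$ -/

import Mathlib

open MeasureTheory ProbabilityTheory Filter Topology

noncomputable section

namespace TailCVaR

/-- `Y n = o_P(r n)`: for every `ε > 0`, `P(|Y n| > ε |r n|) → 0`. -/
def IsLittleOP {Ω : Type*} [MeasurableSpace Ω] (μ : Measure Ω) (Y : ℕ → Ω → ℝ) (r : ℕ → ℝ) :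
    Prop :=
  ∀ ε : ℝ, 0 < ε → Tendsto (fun n => μ {ω | ε * |r n| < |Y n ω|}) atTop (𝓝 0)

/-- The value at risk: the `(1 - β)`-quantile `inf {u : P(L ≤ u) ≥ 1 - β}`. -/
def VaR {Ω : Type*} [MeasurableSpace Ω] (μ : Measure Ω) (L : Ω → ℝ) (β : ℝ) : ℝ :=
  sInf {u : ℝ | 1 - β ≤ μ.real {ω | L ω ≤ u}}

/-- The conditional value at risk `E[L | L ≥ v_β]`. -/
def CVaR {Ω : Type*} [MeasurableSpace Ω] (μ : Measure Ω) (L : Ω → ℝ) (β : ℝ) : ℝ :=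
  ∫ ω, L ω ∂(cond μ {ω | VaR μ L β ≤ L ω})

/-- The `j`-th smallest (`1 ≤ j ≤ n`) of the observations `x`, i.e. the order statistic
`x_{j,n}`; the value is `0` for `j` out of range. -/
def orderStat {n : ℕ} (x : Fin n → ℝ) (j : ℕ) : ℝ :=
  if h : 1 ≤ j ∧ j ≤ n then x (Tuple.sort x ⟨j - 1, by omega⟩) else 0

/-- The empirical value at risk: the `⌈n (1 - β)⌉`-th order statistic. -/
def sampleVaR {n : ℕ} (x : Fin n → ℝ) (β : ℝ) : ℝ :=
  orderStat x ⌈(n : ℝ) * (1 - β)⌉₊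

/-- The sample-average estimator of the conditional value at risk. -/
def sampleCVaR {n : ℕ} (x : Fin n → ℝ) (β : ℝ) : ℝ :=
  sampleVaR x β + 1 / ((n : ℝ) * β) * ∑ i, max (x i - sampleVaR x β) 0

/-- The Hill estimator based on the top `⌊n β⌋` order statistics. -/
def hill {n : ℕ} (x : Fin n → ℝ) (β : ℝ) : ℝ :=
  1 / ((n : ℝ) * β) * ∑ i ∈ Finset.range ⌊(n : ℝ) * β⌋₊,
    (Real.log (orderStat x (n - i)) - Real.log (orderStat x (n - ⌊(n : ℝ) * β⌋₊)))

/-- The extrapolated estimator of the conditional value at risk at level `β`, computed from the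
sample-average estimator and the Hill estimator at level `β₀`. -/
def extrapolatedCVaR {n : ℕ} (x : Fin n → ℝ) (β β₀ : ℝ) : ℝ :=
  sampleCVaR x β₀ * (β₀ / β) ^ hill x β₀

/-- The standing assumptions on the loss function: measurable, nonnegative, of at most polynomial
growth, differentiable beyond some `u₀ > 0`, and `ℓ'(u) = c₁ u ^ ρ (1 + o(1))` as `u → ∞` for some
`ρ ≥ 0` and `c₁ > 0`. -/
structure RegularLoss (ℓ : ℝ → ℝ) : Prop where
  measurable : Measurable ℓ
  nonneg : ∀ u, 0 ≤ ℓ u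
  growth : ∃ K : ℝ, ∃ p : ℕ, ∀ u, 0 ≤ u → ℓ u ≤ K * (1 + u ^ p)
  differentiable : ∃ u₀ : ℝ, 0 < u₀ ∧ ∀ u, u₀ < u → DifferentiableAt ℝ ℓ u
  deriv_asymp : ∃ ρ c₁ : ℝ, 0 ≤ ρ ∧ 0 < c₁ ∧
    Tendsto (fun u => deriv ℓ u / u ^ ρ) atTop (𝓝 c₁)

/-- The multivariate heavy-tail assumption on a sequence of i.i.d. random vectors `X`: there are
scaling vectors `a n` with positive entries such that `a n / ‖a n‖_∞` converges and the
componentwise maxima `M_n` of the first `n` vectors, divided componentwise by `a n`, converge in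
distribution to a law all of whose one-dimensional marginals are nondegenerate. -/
def HeavyTailed {Ω : Type*} [MeasurableSpace Ω] (μ : Measure Ω) [IsProbabilityMeasure μ] {d : ℕ}
    (X : ℕ → Ω → Fin d → ℝ) : Prop :=
  ∃ a : ℕ → Fin d → ℝ, (∀ n k, 0 < a n k) ∧
    (∃ b : Fin d → ℝ, Tendsto (fun n => ‖a n‖⁻¹ • a n) atTop (𝓝 b)) ∧
    ∃ G : ProbabilityMeasure (Fin d → ℝ),
      (∀ k, ¬ ∃ z₀ : ℝ, ∀ᵐ z ∂(G : Measure (Fin d → ℝ)), z k = z₀) ∧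
      TendstoInDistribution (fun n ω k => (⨆ i : Fin n, X i ω k) / a n k) atTop id
        (fun _ => μ) (G : Measure (Fin d → ℝ))

end TailCVaR

end

/-! The whole argument rests on one fact: the tail `P(L > t)` varies regularly with some index `-α`,
`α > 0`. It follows that `C_{β₀} / C_β → c ^ (-1/α)` (`tendsto_CVaR_div`) and that the Hill
estimator tends to `1/α` in probability (`tendsto_measure_hill`). In the factorization of the
extrapolated estimator over `C_β` as `(Ĉ_{β₀} / C_{β₀}) * (C_{β₀} / C_β) * (β₀ / β) ^ ξ̂`, the first
factor tends to `1` in probability by hypothesis, and the other two have limits `c ^ (-1/α)` and `c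
^ (1/α)`, which cancel.

Regular variation of `L`. Since the maxima are rescaled but not centered, each marginal limit is
max-stable under pure scaling, hence a Fréchet law (`MaxConverges.frechet`). Convergence of `a_n /
‖a_n‖` permits one common scale `A_n = ‖a_n‖` for all coordinates, and then `n P(X_k ≥ A_n s for
some listed pair (k, s))` converges. By inclusion-exclusion and rounding to a finite grid, `n P(θᵀX
> A_n y)` is squeezed between convergent sequences (`exists_sandwich_linear_combination`). This
suffices to make the maxima of `θᵀX` converge to a Fréchet law too, so its tail varies regularly
(`regVar_of_sandwich`). The loss is asymptotic to a power and preserves this property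
(`RegularLoss.regVar`).

Consistency of the Hill estimator needs `n β₀ → ∞`, which is not assumed but forced by consistency
of the sample averages (`tendsto_sample_level`). If `n β₀` stayed bounded along a subsequence, the
sample average would be comparable to the sample maximum, and this maximum would have to concentrate
within constant factors of `C_{β₀}`. Maxima of regularly varying variables cannot do so. The Hill
estimator itself is handled by Chebyshev's inequality at the deterministic threshold `v_β`, after
which the random threshold is compared with `v_β`. -/

namespace TailCVaR

/-! ### Limits of rescaled maxima are Fréchet laws. -/

/-- A monotone additive function on the reals is linear. -/
lemma additive_monotone_linear (f : ℝ → ℝ) (hadd : ∀ s t, f (s + t) = f s + f t)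
    (hmono : Monotone f) (s : ℝ) : f s = s * f 1 := by
  let φ : ℝ →+ ℝ := AddMonoidHom.mk' f hadd
  have hcont : Continuous φ := by
    apply continuous_of_continuousAt_zero
    obtain ⟨p, hp⟩ : ∃ p, ContinuousAt f p := by
      obtain ⟨p, hp, -⟩ := (hmono.countable_not_continuousAt.dense_compl ℝ).exists_between
        (zero_lt_one' ℝ)
      exact ⟨p, by simpa using hp⟩
    have h1 : ContinuousAt (fun x => f (x + p) - f p) 0 := by
      apply ContinuousAt.sub _ continuousAt_const
      apply ContinuousAt.comp (f := fun x : ℝ => x + p) (g := f)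
      · simpa using hp
      · fun_prop
    convert h1 using 1
    ext x
    simp [φ, hadd]
  have := (φ.toRealLinearMap hcont).map_smul s 1
  simpa [φ] using this

/-- The laws of maxima with distribution function `F ^ n`, rescaled by `a n`, converge to `G`. -/
structure MaxConverges (F G : ℝ → ℝ) (a : ℕ → ℝ) : Prop where
  monoF : Monotone F
  F_nonneg : ∀ x, 0 ≤ F x
  F_le_one : ∀ x, F x ≤ 1
  a_pos : ∀ n, 0 < a n
  monoG : Monotone G
  G_nonneg : ∀ x, 0 ≤ G x
  G_le_one : ∀ x, G x ≤ 1
  G_top : Tendsto G atTop (𝓝 1)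
  conv : ∀ x, 0 < x → ContinuousAt G x → Tendsto (fun n => F (a n * x) ^ n) atTop (𝓝 (G x))

/-- `G ^ t` is the rescaling of `G` by the factor `r`, up to discontinuities. -/
def ScaleRel (G : ℝ → ℝ) (t r : ℝ) : Prop :=
  ∀ x y, 0 < x → 0 < y → (r * x < y → G x ≤ G y ^ t) ∧ (y < r * x → G y ^ t ≤ G x)

lemma exists_continuousAt_between {G : ℝ → ℝ} (hG : Monotone G) {p q : ℝ} (h : p < q) :
    ∃ x, p < x ∧ x < q ∧ ContinuousAt G x := by
  obtain ⟨x, hx, h1, h2⟩ := (hG.countable_not_continuousAt.dense_compl ℝ).exists_between h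
  exact ⟨x, h1, h2, by simpa using hx⟩

namespace ScaleRel

variable {G : ℝ → ℝ} {t t' r r' : ℝ}

/-- Scaling relations are closed under inverses and, by `mul`, under products. This makes the
scaling factor a homomorphism in the exponent. -/
lemma inv (h0 : ∀ x, 0 ≤ G x) (ht : 0 < t) (hr : 0 < r) (h : ScaleRel G t r) :
    ScaleRel G t⁻¹ r⁻¹ := by
  intro x y hx hy
  refine ⟨fun hxy => ?_, fun hxy => ?_⟩
  · have := (h y x hy hx).2 (by rwa [inv_mul_lt_iff₀ hr] at hxy)
    calc G x = (G x ^ t) ^ t⁻¹ := (Real.rpow_rpow_inv (h0 x) ht.ne').symm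
      _ ≤ _ := Real.rpow_le_rpow (Real.rpow_nonneg (h0 x) _) this (by positivity)
  · have := (h y x hy hx).1 (by rwa [lt_inv_mul_iff₀ hr] at hxy)
    calc G y ^ t⁻¹ ≤ (G x ^ t) ^ t⁻¹ := Real.rpow_le_rpow (h0 y) this (by positivity)
      _ = G x := Real.rpow_rpow_inv (h0 x) ht.ne'

lemma mul (h0 : ∀ x, 0 ≤ G x) (ht' : 0 < t') (hr : 0 < r) (hr' : 0 < r')
    (h : ScaleRel G t r) (h' : ScaleRel G t' r') : ScaleRel G (t * t') (r * r') := by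
  intro x y hx hy
  refine ⟨fun hxy => ?_, fun hxy => ?_⟩
  · obtain ⟨z, hz1, hz2⟩ := exists_between (show r' * x < y / r by
      rw [lt_div_iff₀ hr]; linarith)
    have hz : 0 < z := lt_trans (by positivity) hz1
    have e1 := (h' x z hx hz).1 hz1
    have e2 := (h z y hz hy).1 (by rwa [lt_div_iff₀ hr, mul_comm] at hz2)
    calc G x ≤ G z ^ t' := e1
      _ ≤ (G y ^ t) ^ t' := Real.rpow_le_rpow (h0 z) e2 ht'.le
      _ = G y ^ (t * t') := (Real.rpow_mul (h0 y) _ _).symm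
  · obtain ⟨z, hz1, hz2⟩ := exists_between (show y / r < r' * x by
      rw [div_lt_iff₀ hr]; linarith)
    have hz : 0 < z := lt_trans (by positivity) hz1
    have e1 := (h' x z hx hz).2 hz2
    have e2 := (h z y hz hy).2 (by rwa [div_lt_iff₀ hr, mul_comm] at hz1)
    calc G y ^ (t * t') = (G y ^ t) ^ t' := Real.rpow_mul (h0 y) _ _
      _ ≤ G z ^ t' := Real.rpow_le_rpow (Real.rpow_nonneg (h0 y) _) e2 ht'.le
      _ ≤ G x := e1

end ScaleRel

namespace MaxConverges

variable {F G : ℝ → ℝ} {a : ℕ → ℝ}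

/-- Convergence of types: with `N = ⌊t n⌋`, `F (a_n y) ^ N` tends to `G y ^ t` while `F (a_N x) ^ N`
tends to `G x`, so any limit `R` of `a_N / a_n` is a scaling factor. Such an `R` exists in `[0, ∞]`
along an ultrafilter. The values `0` and `∞` are excluded by `G x₁ < 1` and `G → 1`. -/
lemma exists_scaleRel (h : MaxConverges F G a) {x₁ : ℝ} (hx₁ : 0 < x₁) (h1 : G x₁ < 1)
    {t : ℝ} (ht : 0 < t) : ∃ r, 0 < r ∧ ScaleRel G t r := by
  set N : ℕ → ℕ := fun n => ⌊t * (n : ℝ)⌋₊ with hN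
  have hNdiv : Tendsto (fun n : ℕ => (N n : ℝ) / n) atTop (𝓝 t) :=
    (tendsto_nat_floor_mul_div_atTop (R := ℝ) ht.le).comp tendsto_natCast_atTop_atTop
  have hNtop : Tendsto N atTop atTop :=
    tendsto_nat_floor_atTop.comp (tendsto_natCast_atTop_atTop.const_mul_atTop ht)
  have lim1 : ∀ y, 0 < y → ContinuousAt G y →
      Tendsto (fun n => F (a n * y) ^ N n) atTop (𝓝 (G y ^ t)) := by
    intro y hy hc
    have := (h.conv y hy hc).rpow hNdiv (Or.inr ht)
    refine this.congr' ?_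
    filter_upwards [eventually_gt_atTop 0] with n hn
    have hn' : (n : ℝ) ≠ 0 := by positivity
    rw [← Real.rpow_natCast, ← Real.rpow_mul (h.F_nonneg _), mul_div_cancel₀ _ hn',
      Real.rpow_natCast]
  have lim2 : ∀ x, 0 < x → ContinuousAt G x →
      Tendsto (fun n => F (a (N n) * x) ^ N n) atTop (𝓝 (G x)) := fun x hx hc =>
    (h.conv x hx hc).comp hNtop
  set u : Ultrafilter ℕ := Ultrafilter.of atTop
  have hu : (u : Filter ℕ) ≤ atTop := Ultrafilter.of_le _
  set ρ : ℕ → ℝ := fun n => a (N n) / a n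
  have hρ : ∀ n, 0 < ρ n := fun n => div_pos (h.a_pos _) (h.a_pos _)
  have hρa : ∀ n, a (N n) = ρ n * a n := fun n => (div_mul_cancel₀ _ (h.a_pos n).ne').symm
  set R : ENNReal := (u.map (fun n => ENNReal.ofReal (ρ n))).lim
  have hR : Tendsto (fun n => ENNReal.ofReal (ρ n)) u (𝓝 R) :=
    (u.map (fun n => ENNReal.ofReal (ρ n))).le_nhds_lim
  have key1 : ∀ s, 0 < s → R < ENNReal.ofReal s → ∀ x y, 0 < x → 0 < y → s * x < y →
      G x ≤ G y ^ t := by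
    intro s hs hRs x y hx hy hxy
    obtain ⟨y', hy1, hy2, hyc⟩ := exists_continuousAt_between h.monoG hxy
    obtain ⟨x', hx1, hx2, hxc⟩ := exists_continuousAt_between h.monoG
      (show x < y' / s by rw [lt_div_iff₀ hs]; linarith)
    rw [lt_div_iff₀ hs] at hx2
    have hy' : 0 < y' := lt_trans (by positivity) hy1
    have : G x' ≤ G y' ^ t := by
      refine le_of_tendsto_of_tendsto ((lim2 x' (hx.trans hx1) hxc).mono_left hu)
        ((lim1 y' hy' hyc).mono_left hu) ?_
      filter_upwards [hR.eventually_lt_const hRs] with n hn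
      rw [ENNReal.ofReal_lt_ofReal_iff hs] at hn
      apply pow_le_pow_left₀ (h.F_nonneg _)
      apply h.monoF
      have := h.a_pos n
      rw [hρa]
      have h2 : ρ n * x' ≤ y' := by nlinarith
      nlinarith
    calc G x ≤ G x' := h.monoG hx1.le
      _ ≤ G y' ^ t := this
      _ ≤ G y ^ t := Real.rpow_le_rpow (h.G_nonneg _) (h.monoG hy2.le) ht.le
  have key2 : ∀ s, 0 < s → ENNReal.ofReal s < R → ∀ x y, 0 < x → 0 < y → y < s * x →
      G y ^ t ≤ G x := by
    intro s hs hRs x y hx hy hxy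
    obtain ⟨y', hy1, hy2, hyc⟩ := exists_continuousAt_between h.monoG hxy
    obtain ⟨x', hx1, hx2, hxc⟩ := exists_continuousAt_between h.monoG
      (show y' / s < x by rw [div_lt_iff₀ hs]; linarith)
    rw [div_lt_iff₀ hs] at hx1
    have hy' : 0 < y' := hy.trans hy1
    have hx' : 0 < x' := by
      by_contra hcon
      nlinarith
    have : G y' ^ t ≤ G x' := by
      refine le_of_tendsto_of_tendsto ((lim1 y' hy' hyc).mono_left hu)
        ((lim2 x' hx' hxc).mono_left hu) ?_
      filter_upwards [hR.eventually_const_lt hRs] with n hn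
      rw [ENNReal.ofReal_lt_ofReal_iff (hρ n)] at hn
      apply pow_le_pow_left₀ (h.F_nonneg _)
      apply h.monoF
      have := h.a_pos n
      rw [hρa]
      have h2 : y' ≤ ρ n * x' := by nlinarith
      nlinarith
    calc G y ^ t ≤ G y' ^ t := Real.rpow_le_rpow (h.G_nonneg _) (h.monoG hy1.le) ht.le
      _ ≤ G x' := this
      _ ≤ G x := h.monoG hx2.le
  have hR0 : R ≠ 0 := by
    intro hR0
    have h2 : ∀ x, 0 < x → G x ≤ G x₁ ^ t := by
      intro x hx
      have hs : 0 < x₁ / (2 * x) := by positivity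
      refine key1 (x₁ / (2 * x)) hs (by rw [hR0]; simpa using hs) x x₁ hx hx₁ ?_
      field_simp
      norm_num
    have h3 : 1 ≤ G x₁ ^ t := le_of_tendsto h.G_top (by
      filter_upwards [eventually_gt_atTop 0] with x hx using h2 x hx)
    exact absurd h3 (not_le.mpr (Real.rpow_lt_one (h.G_nonneg _) h1 ht))
  have hRtop : R ≠ ⊤ := by
    intro hRt
    have h2 : ∀ y, 0 < y → G y ^ t ≤ G x₁ := by
      intro y hy
      have hs : 0 < 2 * y / x₁ := by positivity
      refine key2 (2 * y / x₁) hs (by rw [hRt]; exact ENNReal.ofReal_lt_top) x₁ y hx₁ hy ?_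
      field_simp
      norm_num
    have h3 : Tendsto (fun y => G y ^ t) atTop (𝓝 (1 ^ t)) :=
      h.G_top.rpow_const (Or.inr ht.le)
    rw [Real.one_rpow] at h3
    have h4 : 1 ≤ G x₁ := le_of_tendsto h3 (by
      filter_upwards [eventually_gt_atTop 0] with x hx using h2 x hx)
    linarith
  refine ⟨R.toReal, ENNReal.toReal_pos hR0 hRtop, fun x y hx hy => ⟨fun hxy => ?_, fun hxy => ?_⟩⟩
  · obtain ⟨s, hs1, hs2⟩ := exists_between (show R.toReal < y / x by rwa [lt_div_iff₀ hx])
    have hs : 0 < s := lt_of_le_of_lt ENNReal.toReal_nonneg hs1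
    exact key1 s hs ((ENNReal.lt_ofReal_iff_toReal_lt hRtop).mpr hs1) x y hx hy
      (by rwa [lt_div_iff₀ hx] at hs2)
  · obtain ⟨s, hs1, hs2⟩ := exists_between (show y / x < R.toReal by rwa [div_lt_iff₀ hx])
    have hs : 0 < s := lt_trans (by positivity) hs1
    exact key2 s hs ((ENNReal.ofReal_lt_iff_lt_toReal hs.le hRtop).mpr hs2) x y hx hy
      (by rwa [div_lt_iff₀ hx] at hs1)

/-- For `1 < q < r` the relation gives `G (q x) ≤ G (q x) ^ t ≤ G x`. Iterating, `G (q ^ k x₁) ≤ G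
x₁ < 1` for all `k`, against `G → 1`. -/
lemma scale_le_one (h : MaxConverges F G a) {x₁ : ℝ} (hx₁ : 0 < x₁) (h1 : G x₁ < 1)
    {t r : ℝ} (ht1 : t ≤ 1) (hr : ScaleRel G t r) : r ≤ 1 := by
  by_contra! hr1
  obtain ⟨q, hq1, hq2⟩ := exists_between hr1
  have hstep : ∀ k : ℕ, G (q ^ k * x₁) ≤ G x₁ := by
    intro k
    induction k with
    | zero => simp
    | succ k ih =>
      have hp : 0 < q ^ k * x₁ := by positivity
      have e := (hr (q ^ k * x₁) (q ^ (k + 1) * x₁) hp (by positivity)).2 (by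
        rw [pow_succ]; nlinarith)
      refine le_trans ?_ (e.trans ih)
      rcases (h.G_nonneg (q ^ (k + 1) * x₁)).eq_or_lt with h0 | h0
      · rw [← h0]; positivity
      · calc G (q ^ (k + 1) * x₁) = G (q ^ (k + 1) * x₁) ^ (1 : ℝ) := (Real.rpow_one _).symm
          _ ≤ _ := Real.rpow_le_rpow_of_exponent_ge h0 (h.G_le_one _) ht1
  have hlim : Tendsto (fun k : ℕ => G (q ^ k * x₁)) atTop (𝓝 1) :=
    h.G_top.comp ((tendsto_pow_atTop_atTop_of_one_lt hq1).atTop_mul_const hx₁)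
  have := le_of_tendsto' hlim hstep
  linarith

/-- A factor `r ≤ 1` would give `G x₁ ≤ G y ^ t` for `y > x₁`, and continuity would yield `G x₁ ≤ G
x₁ ^ t < G x₁`. -/
lemma one_lt_scale {x₁ : ℝ} (hx₁ : 0 < x₁) (h1 : G x₁ < 1)
    (h0 : 0 < G x₁) (hc : ContinuousAt G x₁)
    {t r : ℝ} (ht1 : 1 < t) (hr : ScaleRel G t r) : 1 < r := by
  by_contra! hr1
  have h2 : ∀ y, x₁ < y → G x₁ ≤ G y ^ t := fun y hy =>
    (hr x₁ y hx₁ (hx₁.trans hy)).1 (by nlinarith)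
  have h3 : Tendsto (fun y => G y ^ t) (𝓝[>] x₁) (𝓝 (G x₁ ^ t)) :=
    (hc.tendsto.mono_left nhdsWithin_le_nhds).rpow_const (Or.inr (by linarith))
  have h4 : G x₁ ≤ G x₁ ^ t := ge_of_tendsto h3 (by
    filter_upwards [self_mem_nhdsWithin] with y hy using h2 y hy)
  have h5 : G x₁ ^ t < G x₁ ^ (1 : ℝ) := Real.rpow_lt_rpow_of_exponent_gt h0 h1 ht1
  rw [Real.rpow_one] at h5
  linarith

/-- A zero at `x` would propagate, by the relation for `t = 2` whose factor exceeds `1`, to a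
sequence tending to infinity. -/
lemma G_pos (h : MaxConverges F G a) {x₁ : ℝ} (hx₁ : 0 < x₁) (h1 : G x₁ < 1)
    (h0 : 0 < G x₁) (hc : ContinuousAt G x₁) {x : ℝ} (hx : 0 < x) : 0 < G x := by
  by_contra hcon
  have hx0 : G x = 0 := le_antisymm (not_lt.mp hcon) (h.G_nonneg x)
  obtain ⟨r, hr, hrel⟩ := h.exists_scaleRel hx₁ h1 (t := 2) (by norm_num)
  have hr1 : 1 < r := one_lt_scale hx₁ h1 h0 hc (by norm_num) hrel
  obtain ⟨q, hq1, hq2⟩ := exists_between hr1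
  have hstep : ∀ k : ℕ, G (q ^ k * x) = 0 := by
    intro k
    induction k with
    | zero => simpa using hx0
    | succ k ih =>
      have hp : 0 < q ^ k * x := by positivity
      have e := (hrel (q ^ k * x) (q ^ (k + 1) * x) hp (by positivity)).2 (by
        rw [pow_succ]; nlinarith)
      rw [ih] at e
      have e2 := le_antisymm e (Real.rpow_nonneg (h.G_nonneg _) _)
      exact (Real.rpow_eq_zero (h.G_nonneg _) (by norm_num)).mp e2
  have hlim : Tendsto (fun k : ℕ => G (q ^ k * x)) atTop (𝓝 1) :=
    h.G_top.comp ((tendsto_pow_atTop_atTop_of_one_lt hq1).atTop_mul_const hx)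
  simp only [hstep] at hlim
  exact zero_ne_one (tendsto_nhds_unique tendsto_const_nhds hlim)

/-- Limits of maxima rescaled without centering are Fréchet laws. -/
theorem frechet (h : MaxConverges F G a) {x₁ : ℝ} (hx₁ : 0 < x₁) (h1 : G x₁ < 1)
    (h0 : 0 < G x₁) (hc : ContinuousAt G x₁) :
    ∃ α v : ℝ, 0 < α ∧ 0 < v ∧ ∀ x, 0 < x → G x = Real.exp (-(v * x ^ (-α))) := by
  have hex : ∀ s : ℝ, ∃ r, 0 < r ∧ ScaleRel G (Real.exp s) r := fun s =>
    h.exists_scaleRel hx₁ h1 (Real.exp_pos s)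
  choose r hr hrel using hex
  set f : ℝ → ℝ := fun s => Real.log (r s)
  -- The factor is monotone in `t`, by `scale_le_one` applied to the quotient relation. With equal
  -- exponents, used in both directions, this also says that the factor is unique, whence additivity
  -- below.
  have hle : ∀ {t r r'}, 0 < r → 0 < r' → ∀ {t'}, 0 < t' → t ≤ t' → ScaleRel G t r →
      ScaleRel G t' r' → r ≤ r' := by
    intro t r r' hr hr' t' ht' htt h1' h2'
    have h3 := h1'.mul h.G_nonneg (inv_pos.mpr ht') hr (inv_pos.mpr hr')
      (h2'.inv h.G_nonneg ht' hr')
    have h4 := h.scale_le_one hx₁ h1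
      (by rw [← div_eq_mul_inv]; exact (div_le_one ht').mpr htt) h3
    rw [← div_eq_mul_inv] at h4
    exact (div_le_one hr').mp h4
  have hmono : Monotone f := fun s s' hs => Real.log_le_log (hr s)
    (hle (hr s) (hr s') (Real.exp_pos s') (Real.exp_le_exp.mpr hs)
      (hrel s) (hrel s'))
  have hadd : ∀ s s', f (s + s') = f s + f s' := by
    intro s s'
    have h3 := (hrel s).mul h.G_nonneg (Real.exp_pos s') (hr s) (hr s') (hrel s')
    have h4 := hrel (s + s')
    rw [← Real.exp_add] at h3
    have hp := mul_pos (hr s) (hr s')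
    have h5 : r (s + s') = r s * r s' := le_antisymm
      (hle (hr _) hp (Real.exp_pos _) le_rfl h4 h3)
      (hle hp (hr _) (Real.exp_pos _) le_rfl h3 h4)
    simp only [f, h5, Real.log_mul (hr s).ne' (hr s').ne']
  have hlin := additive_monotone_linear f hadd hmono
  set γ := f 1
  have hγ : 0 < γ := Real.log_pos (one_lt_scale hx₁ h1 h0 hc (by simp) (hrel 1))
  have hrel' : ∀ t, 0 < t → ScaleRel G t (t ^ γ) := by
    intro t ht
    have h3 := hrel (Real.log t)
    rw [Real.exp_log ht] at h3
    have h4 : r (Real.log t) = t ^ γ := by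
      rw [Real.rpow_def_of_pos ht, ← hlin, Real.exp_log (hr _)]
    rwa [h4] at h3
  have hpos : ∀ {x}, 0 < x → 0 < G x := fun hx => h.G_pos hx₁ h1 h0 hc hx
  -- The exponent `T = y ^ γ⁻¹` has scaling factor exactly `y`. Scaling relations speak only of
  -- strict inequalities, so `T` is approached from both sides, using continuity in the exponent.
  have key : ∀ y, 0 < y → G y ^ (y ^ γ⁻¹) = G 1 := by
    intro y hy
    set T := y ^ γ⁻¹
    have hT : 0 < T := by positivity
    have hTγ : T ^ γ = y := Real.rpow_inv_rpow hy.le hγ.ne'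
    have hcont : Continuous (fun t : ℝ => G y ^ t) := Real.continuous_const_rpow (hpos hy).ne'
    apply le_antisymm
    · refine le_of_tendsto ((hcont.tendsto T).mono_left (nhdsWithin_le_nhds (s := Set.Ioi T))) ?_
      filter_upwards [self_mem_nhdsWithin] with t ht
      refine (hrel' t (hT.trans ht) 1 y one_pos hy).2 ?_
      rw [mul_one, ← hTγ]
      exact Real.rpow_lt_rpow hT.le ht hγ
    · refine ge_of_tendsto ((hcont.tendsto T).mono_left (nhdsWithin_le_nhds (s := Set.Iio T))) ?_
      filter_upwards [Ioo_mem_nhdsLT hT] with t ht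
      refine (hrel' t ht.1 1 y one_pos hy).1 ?_
      rw [mul_one, ← hTγ]
      exact Real.rpow_lt_rpow ht.1.le ht.2 hγ
  have hform : ∀ x, 0 < x → G x = Real.exp (-(-Real.log (G 1) * x ^ (-γ⁻¹))) := by
    intro x hx
    have h3 := key x hx
    have hT : 0 < x ^ γ⁻¹ := by positivity
    rw [← h3, Real.log_rpow (hpos hx), Real.rpow_neg hx.le]
    rw [neg_mul, neg_neg, mul_right_comm, mul_inv_cancel₀ hT.ne', one_mul, Real.exp_log (hpos hx)]
  refine ⟨γ⁻¹, -Real.log (G 1), inv_pos.mpr hγ, ?_, hform⟩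
  have h3 := hform x₁ hx₁
  rw [h3, Real.exp_lt_one_iff, neg_lt_zero] at h1
  exact pos_of_mul_pos_left h1 (by positivity)

end MaxConverges

/-! ### Regularly varying tails. -/

/-- A positive antitone function that varies regularly at infinity with index `b`. -/
structure RegVar (U : ℝ → ℝ) (b : ℝ) : Prop where
  anti : Antitone U
  pos : ∀ x, 0 < U x
  ratio : ∀ x, 0 < x → Tendsto (fun t => U (t * x) / U t) atTop (𝓝 (x ^ b))

namespace RegVar

variable {U : ℝ → ℝ} {b : ℝ} {ι : Type*} {l : Filter ι} {s t : ι → ℝ}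

/-- Monotonicity replaces uniform convergence: `s` eventually lies on the right side of `t * y` for
each fixed `y` on either side of `x`. -/
lemma tendsto_comp (h : RegVar U b) (ht : Tendsto t l atTop) {x : ℝ} (hx : 0 < x)
    (hst : Tendsto (fun i => s i / t i) l (𝓝 x)) :
    Tendsto (fun i => U (s i) / U (t i)) l (𝓝 (x ^ b)) := by
  have hcont : ContinuousAt (fun y : ℝ => y ^ b) x := Real.continuousAt_rpow_const _ _ (Or.inl hx.ne')
  rw [tendsto_order]
  constructor
  · intro c hc
    obtain ⟨y, hy1, hy2⟩ : ∃ y, c < y ^ b ∧ x < y := by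
      have := (hcont.eventually_const_lt hc).filter_mono (nhdsWithin_le_nhds (s := Set.Ioi x))
      exact (this.and self_mem_nhdsWithin).exists
    have hy : 0 < y := hx.trans hy2
    filter_upwards [((h.ratio y hy).comp ht).eventually_const_lt hy1,
      hst.eventually_lt_const hy2, ht.eventually_gt_atTop 0] with i h1 h2 h3
    refine h1.trans_le ?_
    have : U (t i * y) ≤ U (s i) := h.anti (by
      rw [div_lt_iff₀ h3] at h2; linarith)
    exact div_le_div_of_nonneg_right this (h.pos _).le
  · intro c hc
    obtain ⟨y, ⟨hy1, hy⟩, hy2⟩ : ∃ y, (y ^ b < c ∧ 0 < y) ∧ y < x := by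
      have := ((hcont.eventually_lt_const hc).and (eventually_gt_nhds hx)).filter_mono
        (nhdsWithin_le_nhds (s := Set.Iio x))
      exact (this.and self_mem_nhdsWithin).exists
    filter_upwards [((h.ratio y hy).comp ht).eventually_lt_const hy1,
      hst.eventually_const_lt hy2, ht.eventually_gt_atTop 0] with i h1 h2 h3
    refine lt_of_le_of_lt ?_ h1
    have : U (s i) ≤ U (t i * y) := h.anti (by
      rw [lt_div_iff₀ h3] at h2; linarith)
    exact div_le_div_of_nonneg_right this (h.pos _).le

/-- Converse of `tendsto_comp`, which turns ratios of levels into ratios of quantiles. The index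
must be negative, so that distinct ratios of arguments give distinct limits. -/
lemma tendsto_div_of_ratio (h : RegVar U b) (hb : b < 0) (ht : Tendsto t l atTop) {x : ℝ}
    (hx : 0 < x) (hst : Tendsto (fun i => U (s i) / U (t i)) l (𝓝 (x ^ b))) :
    Tendsto (fun i => s i / t i) l (𝓝 x) := by
  rw [tendsto_order]
  constructor
  · intro c hc
    obtain ⟨y, hy1, hy2⟩ := exists_between (max_lt hc hx)
    have hy : 0 < y := (le_max_right _ _).trans_lt hy1
    have hlt : x ^ b < y ^ b := Real.rpow_lt_rpow_of_neg hy hy2 hb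
    obtain ⟨m, hm1, hm2⟩ := exists_between hlt
    filter_upwards [((h.ratio y hy).comp ht).eventually_const_lt hm2,
      hst.eventually_lt_const hm1, ht.eventually_gt_atTop 0] with i h1 h2 h3
    have h4 : U (s i) < U (t i * y) := (div_lt_div_iff_of_pos_right (h.pos _)).mp (h2.trans h1)
    have h5 : t i * y < s i := by
      by_contra! hcon
      exact absurd (h.anti hcon) (not_le.mpr h4)
    rw [lt_div_iff₀ h3]
    have := (le_max_left c 0).trans_lt hy1
    nlinarith
  · intro c hc
    obtain ⟨y, hy1, hy2⟩ := exists_between hc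
    have hy : 0 < y := hx.trans hy1
    have hlt : y ^ b < x ^ b := Real.rpow_lt_rpow_of_neg hx hy1 hb
    obtain ⟨m, hm1, hm2⟩ := exists_between hlt
    filter_upwards [((h.ratio y hy).comp ht).eventually_lt_const hm1,
      hst.eventually_const_lt hm2, ht.eventually_gt_atTop 0] with i h1 h2 h3
    have h4 : U (t i * y) < U (s i) := (div_lt_div_iff_of_pos_right (h.pos _)).mp (h1.trans h2)
    have h5 : s i < t i * y := by
      by_contra! hcon
      exact absurd (h.anti hcon) (not_le.mpr h4)
    rw [div_lt_iff₀ h3]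
    nlinarith

end RegVar

/-- From `1 - 1/q ≤ log q ≤ q - 1` with `q = 1 - p`, the quantities `n p` and `-log ((1 - p) ^ n)`
agree up to a factor between `1 - p` and `1`. Moreover `p → 0`, because the logarithms converge. -/
lemma tendsto_mul_of_tendsto_one_sub_pow {p : ℕ → ℝ} (h0 : ∀ n, 0 ≤ p n) (h1 : ∀ n, p n ≤ 1)
    {g : ℝ} (hg : 0 < g) (h : Tendsto (fun n : ℕ => (1 - p n) ^ n) atTop (𝓝 g)) :
    Tendsto (fun n : ℕ => (n : ℝ) * p n) atTop (𝓝 (-Real.log g)) := by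
  have hlog : Tendsto (fun n : ℕ => -Real.log ((1 - p n) ^ n)) atTop (𝓝 (-Real.log g)) :=
    (h.log hg.ne').neg
  have hub : ∀ᶠ n : ℕ in atTop, (n : ℝ) * p n ≤ -Real.log ((1 - p n) ^ n) ∧
      (1 - p n) * -Real.log ((1 - p n) ^ n) ≤ n * p n := by
    filter_upwards [h.eventually_const_lt hg, eventually_gt_atTop 0] with n hn hn0
    have hq : 0 < 1 - p n := by
      rcases (sub_nonneg.mpr (h1 n)).eq_or_lt with h' | h'
      · rw [← h', zero_pow hn0.ne'] at hn
        exact absurd hn (lt_irrefl _)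
      · exact h'
    have hn1 : (0 : ℝ) < n := by exact_mod_cast hn0
    rw [Real.log_pow]
    have e1 := Real.log_le_sub_one_of_pos hq
    have e2 := Real.one_sub_inv_le_log_of_pos hq
    have e3 : (1 - p n) * -Real.log (1 - p n) ≤ p n := by
      have := mul_le_mul_of_nonneg_left e2 hq.le
      rw [mul_sub, mul_inv_cancel₀ hq.ne'] at this
      linarith
    constructor <;> nlinarith
  have hp : Tendsto p atTop (𝓝 0) := by
    have h2 : Tendsto (fun n : ℕ => -Real.log ((1 - p n) ^ n) / n) atTop (𝓝 0) :=
      hlog.div_atTop tendsto_natCast_atTop_atTop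
    refine squeeze_zero' (Eventually.of_forall h0) ?_ h2
    filter_upwards [hub, eventually_gt_atTop 0] with n hn hn0
    have hn1 : (0 : ℝ) < n := by exact_mod_cast hn0
    rw [le_div_iff₀ hn1]
    linarith [hn.1]
  have hlow : Tendsto (fun n : ℕ => (1 - p n) * -Real.log ((1 - p n) ^ n)) atTop
      (𝓝 (-Real.log g)) := by
    simpa using (tendsto_const_nhds (x := (1 : ℝ))).sub hp |>.mul hlog
  exact tendsto_of_tendsto_of_tendsto_of_le_of_le' hlow hlog (hub.mono fun n hn => hn.2)
    (hub.mono fun n hn => hn.1)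

lemma tendsto_one_sub_pow {p : ℕ → ℝ} {c : ℝ}
    (h : Tendsto (fun n : ℕ => (n : ℝ) * p n) atTop (𝓝 c)) :
    Tendsto (fun n : ℕ => (1 - p n) ^ n) atTop (𝓝 (Real.exp (-c))) := by
  have := Real.tendsto_one_add_pow_exp_of_tendsto (g := fun n => -p n) (t := -c)
    (by simpa using h.neg)
  simpa [sub_eq_add_neg] using this

/-- If `n U(a_n x)` converges to a power of `x`, then `U` varies regularly. -/
theorem regVar_of_tendsto {U : ℝ → ℝ} {a : ℕ → ℝ} (ha : ∀ n, 0 < a n) (hU : Antitone U)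
    (hU0 : ∀ x, 0 ≤ U x) (hlim : Tendsto U atTop (𝓝 0)) {α v : ℝ} (hα : 0 < α) (hv : 0 < v)
    (h : ∀ x, 0 < x → Tendsto (fun n : ℕ => (n : ℝ) * U (a n * x)) atTop (𝓝 (v * x ^ (-α)))) :
    RegVar U (-α) := by
  -- A zero of `U` would force every `a_n x` below it eventually. Then `U (a_n) → 0` would make `U`
  -- vanish on the whole positive axis, against the limit `v > 0`.
  have hpos : ∀ y, 0 < U y := by
    intro y
    by_contra hcon
    have hy : ∀ z, y ≤ z → U z = 0 := fun z hz =>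
      le_antisymm ((hU hz).trans (not_lt.mp hcon)) (hU0 z)
    have hpos' : ∀ x, 0 < x → ∀ᶠ n in atTop, a n * x < y := by
      intro x hx
      have hvx : 0 < v * x ^ (-α) := by positivity
      filter_upwards [(h x hx).eventually_const_lt hvx] with n hn
      by_contra! hle
      rw [hy _ hle] at hn
      simp at hn
    have hz : ∀ z, 0 < z → U z = 0 := by
      intro z hz
      have h1 : Tendsto (fun n => U (a n * 1)) atTop (𝓝 0) := by
        have := (h 1 one_pos).div_atTop tendsto_natCast_atTop_atTop
        refine this.congr' ?_
        filter_upwards [eventually_gt_atTop 0] with n hn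
        have : (n : ℝ) ≠ 0 := by positivity
        field_simp
      have h2 : ∀ᶠ n in atTop, U z ≤ U (a n * 1) := by
        rcases le_or_gt y 0 with hy0 | hy0
        · exact Eventually.of_forall fun n => by rw [hy z (hy0.trans hz.le)]; exact hU0 _
        · filter_upwards [hpos' (y / z) (by positivity)] with n hn
          apply hU
          rw [← mul_div_assoc, div_lt_iff₀ hz] at hn
          rw [mul_one]
          nlinarith
      exact le_antisymm (ge_of_tendsto h1 h2) (hU0 z)
    have h3 := h 1 one_pos
    simp only [mul_one, hz _ (ha _), mul_zero, Real.one_rpow] at h3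
    exact hv.ne (tendsto_nhds_unique tendsto_const_nhds h3)
  refine ⟨hU, hpos, fun x hx => ?_⟩
  -- Chosen so that `N t * U t → v`, which is the limit of `n U (a_n)`. Hence `a (N t)` is
  -- asymptotic to `t`, as `hupper` and `hlower` express, and the hypothesis at integers transfers
  -- to real `t`.
  set N : ℝ → ℕ := fun t => ⌊v * (U t)⁻¹⌋₊
  have hinv : Tendsto (fun t => (U t)⁻¹) atTop atTop :=
    (tendsto_nhdsWithin_iff.mpr ⟨hlim, Eventually.of_forall hpos⟩).inv_tendsto_nhdsGT_zero
  have hN : Tendsto N atTop atTop := tendsto_nat_floor_atTop.comp (hinv.const_mul_atTop hv)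
  have hNU : Tendsto (fun t => (N t : ℝ) * U t) atTop (𝓝 v) := by
    have := (tendsto_nat_floor_mul_div_atTop (R := ℝ) hv.le).comp hinv
    refine this.congr fun t => ?_
    simp [N]
  have hcomp : ∀ y, 0 < y → Tendsto (fun t => (N t : ℝ) * U (a (N t) * y)) atTop
      (𝓝 (v * y ^ (-α))) := fun y hy => (h y hy).comp hN
  have hupper : ∀ y, 1 < y → ∀ᶠ t in atTop, t < a (N t) * y := by
    intro y hy
    have hlt : v * y ^ (-α) < v := by
      have := Real.rpow_lt_one_of_one_lt_of_neg hy (neg_lt_zero.mpr hα)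
      nlinarith
    obtain ⟨m, hm1, hm2⟩ := exists_between hlt
    filter_upwards [(hcomp y (by linarith)).eventually_lt_const hm1,
      hNU.eventually_const_lt hm2] with t h1 h2
    by_contra! hcon
    have := mul_le_mul_of_nonneg_left (hU hcon) (Nat.cast_nonneg (α := ℝ) (N t))
    linarith
  have hlower : ∀ y, 0 < y → y < 1 → ∀ᶠ t in atTop, a (N t) * y < t := by
    intro y hy hy1
    have hlt : v < v * y ^ (-α) := by
      have := Real.one_lt_rpow_of_pos_of_lt_one_of_neg hy hy1 (neg_lt_zero.mpr hα)
      nlinarith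
    obtain ⟨m, hm1, hm2⟩ := exists_between hlt
    filter_upwards [(hcomp y hy).eventually_const_lt hm2,
      hNU.eventually_lt_const hm1] with t h1 h2
    by_contra! hcon
    have := mul_le_mul_of_nonneg_left (hU hcon) (Nat.cast_nonneg (α := ℝ) (N t))
    linarith
  have hmain : Tendsto (fun t => (N t : ℝ) * U (t * x)) atTop (𝓝 (v * x ^ (-α))) := by
    have hcont : ContinuousAt (fun y : ℝ => v * (y * x) ^ (-α)) 1 := by
      apply ContinuousAt.mul continuousAt_const
      exact ContinuousAt.rpow_const (by fun_prop) (Or.inl (by simpa using hx.ne'))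
    have h1x : v * x ^ (-α) = v * (1 * x) ^ (-α) := by rw [one_mul]
    rw [tendsto_order]
    constructor
    · intro c hc
      rw [h1x] at hc
      obtain ⟨y, hy1, hy2⟩ : ∃ y, c < v * (y * x) ^ (-α) ∧ 1 < y := by
        have := (hcont.eventually_const_lt hc).filter_mono (nhdsWithin_le_nhds (s := Set.Ioi 1))
        exact (this.and self_mem_nhdsWithin).exists
      have hy : 0 < y := by linarith
      filter_upwards [hupper y hy2, (hcomp (y * x) (by positivity)).eventually_const_lt hy1]
        with t h1 h2
      refine h2.trans_le (mul_le_mul_of_nonneg_left (hU ?_) (Nat.cast_nonneg _))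
      nlinarith
    · intro c hc
      rw [h1x] at hc
      obtain ⟨y, ⟨hy1, hy⟩, hy2⟩ : ∃ y, (v * (y * x) ^ (-α) < c ∧ 0 < y) ∧ y < 1 := by
        have := ((hcont.eventually_lt_const hc).and (eventually_gt_nhds one_pos)).filter_mono
          (nhdsWithin_le_nhds (s := Set.Iio 1))
        exact (this.and self_mem_nhdsWithin).exists
      filter_upwards [hlower y hy hy2, (hcomp (y * x) (by positivity)).eventually_lt_const hy1]
        with t h1 h2
      refine lt_of_le_of_lt (mul_le_mul_of_nonneg_left (hU ?_) (Nat.cast_nonneg _)) h2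
      nlinarith
  have hdiv := hmain.div hNU hv.ne'
  rw [mul_div_cancel_left₀ _ hv.ne'] at hdiv
  refine hdiv.congr' ?_
  filter_upwards [hN.eventually_gt_atTop 0] with t ht
  have : (N t : ℝ) ≠ 0 := by positivity
  exact mul_div_mul_left _ _ this

/-! ### Scaled probabilities of patterns of events. -/

section Patterns

variable {Ω : Type*} [MeasurableSpace Ω] {μ : Measure Ω} [IsFiniteMeasure μ] {ι : Type*}

/-- Inclusion-exclusion by induction on `J`. For a single `j` the event is a difference of two
unions; requiring one more `j` to occur means subtracting the case in which `j` joins the forbidden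
indices. Nonemptiness of `J` matters, as the hypothesis controls unions and not their complements.
-/
lemma tendsto_measure_inter_compl {E : ℕ → ι → Set Ω} (hE : ∀ n i, MeasurableSet (E n i))
    (h : ∀ I : Finset ι, ∃ c, Tendsto (fun n : ℕ => (n : ℝ) * μ.real (⋃ i ∈ I, E n i)) atTop (𝓝 c))
    {J : Finset ι} (hJ : J.Nonempty) (I : Finset ι) :
    ∃ c, Tendsto (fun n : ℕ => (n : ℝ) * μ.real ((⋂ j ∈ J, E n j) ∩ ⋂ i ∈ I, (E n i)ᶜ))
      atTop (𝓝 c) := by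
  classical
  induction hJ using Finset.Nonempty.cons_induction generalizing I with
  | singleton j =>
    obtain ⟨c₁, h₁⟩ := h (insert j I)
    obtain ⟨c₂, h₂⟩ := h I
    refine ⟨c₁ - c₂, (h₁.sub h₂).congr fun n => ?_⟩
    rw [← mul_sub]
    congr 1
    have hm : MeasurableSet (⋃ i ∈ I, E n i) := Finset.measurableSet_biUnion _ fun i _ => hE n i
    rw [Finset.set_biUnion_insert, ← measureReal_sdiff (Set.subset_union_right) hm]
    congr 1
    ext ω
    simp only [Set.mem_sdiff, Set.mem_union, Set.mem_iUnion, Set.mem_inter_iff, Set.mem_iInter,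
      Finset.mem_singleton, Set.mem_compl_iff, exists_prop, not_exists, not_and]
    constructor
    · rintro ⟨h1 | ⟨i, h1, h2⟩, h3⟩
      · exact ⟨by rintro _ rfl; exact h1, h3⟩
      · exact absurd h2 (h3 i h1)
    · rintro ⟨h1, h3⟩
      exact ⟨Or.inl (h1 j rfl), h3⟩
  | cons j J hj hJ ih =>
    obtain ⟨c₁, h₁⟩ := ih I
    obtain ⟨c₂, h₂⟩ := ih (insert j I)
    refine ⟨c₁ - c₂, (h₁.sub h₂).congr fun n => ?_⟩
    rw [← mul_sub]
    congr 1
    have := measureReal_inter_add_sdiff (μ := μ)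
      (s := (⋂ j ∈ J, E n j) ∩ ⋂ i ∈ I, (E n i)ᶜ) (hE n j)
    rw [← this, Finset.set_biInter_insert, Finset.cons_eq_insert, Finset.set_biInter_insert]
    have e1 : ((⋂ j ∈ J, E n j) ∩ ⋂ i ∈ I, (E n i)ᶜ) \ E n j
        = (⋂ j ∈ J, E n j) ∩ ((E n j)ᶜ ∩ ⋂ i ∈ I, (E n i)ᶜ) := by
      ext; simp only [Set.mem_sdiff, Set.mem_inter_iff, Set.mem_compl_iff]; tauto
    rw [e1, add_sub_cancel_right]
    congr 1
    ext; simp only [Set.mem_inter_iff]; tauto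

/-- If the scaled probabilities of all unions of events converge, so do those of the events that a
weighted number of them occur. -/
lemma tendsto_measure_weighted_sum [Fintype ι] {E : ℕ → ι → Set Ω}
    (hE : ∀ n i, MeasurableSet (E n i))
    (h : ∀ I : Finset ι, ∃ c, Tendsto (fun n : ℕ => (n : ℝ) * μ.real (⋃ i ∈ I, E n i)) atTop (𝓝 c))
    (w : ι → ℝ) {y : ℝ} (hy : 0 ≤ y) :
    ∃ c, Tendsto (fun n : ℕ => (n : ℝ) * μ.real {ω | y < ∑ i, (E n i).indicator (fun _ => w i) ω})
      atTop (𝓝 c) := by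
  classical
  -- `P n S` is the atom on which exactly the events indexed by `S` occur. The weighted sum is
  -- constant on each atom.
  set P : ℕ → Finset ι → Set Ω := fun n S => (⋂ j ∈ S, E n j) ∩ ⋂ i ∈ Sᶜ, (E n i)ᶜ with hP
  have hmem : ∀ n S ω, ω ∈ P n S ↔ S = Finset.univ.filter (fun i => ω ∈ E n i) := by
    intro n S ω
    simp only [hP, Set.mem_inter_iff, Set.mem_iInter, Set.mem_compl_iff, Finset.mem_compl,
      Finset.ext_iff, Finset.mem_filter, Finset.mem_univ, true_and]
    constructor
    · rintro ⟨h1, h2⟩ i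
      exact ⟨h1 i, fun hi => by_contra fun hcon => h2 i hcon hi⟩
    · intro h1
      exact ⟨fun i hi => (h1 i).mp hi, fun i hi hcon => hi ((h1 i).mpr hcon)⟩
  set T : Finset (Finset ι) := Finset.univ.filter (fun S => y < ∑ i ∈ S, w i)
  -- Here `0 ≤ y` enters: the empty pattern has weight `0`, so it does not contribute.
  have hTne : ∀ S ∈ T, S.Nonempty := by
    intro S hS
    rw [Finset.nonempty_iff_ne_empty]
    rintro rfl
    simp only [T, Finset.mem_filter, Finset.sum_empty] at hS
    linarith [hS.2]
  have hsum : ∀ n ω, ∑ i, (E n i).indicator (fun _ => w i) ω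
      = ∑ i ∈ Finset.univ.filter (fun i => ω ∈ E n i), w i := by
    intro n ω
    rw [Finset.sum_filter]
    rfl
  have hD : ∀ n, {ω | y < ∑ i, (E n i).indicator (fun _ => w i) ω} = ⋃ S ∈ T, P n S := by
    intro n
    ext ω
    simp only [Set.mem_ofPred_eq, hsum, Set.mem_iUnion, hmem, exists_prop, T,
      Finset.mem_filter, Finset.mem_univ, true_and]
    simp
  have hPm : ∀ n S, MeasurableSet (P n S) := fun n S =>
    (Finset.measurableSet_biInter _ fun i _ => hE n i).inter
      (Finset.measurableSet_biInter _ fun i _ => (hE n i).compl)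
  have hdisj : ∀ n, (T : Set (Finset ι)).PairwiseDisjoint (P n) := by
    intro n S _ S' _ hne
    rw [Function.onFun, Set.disjoint_left]
    intro ω h1 h2
    rw [hmem] at h1 h2
    exact hne (h1.trans h2.symm)
  have hex : ∀ S : Finset ι, ∃ c, S ∈ T →
      Tendsto (fun n : ℕ => (n : ℝ) * μ.real (P n S)) atTop (𝓝 c) := by
    intro S
    by_cases hS : S ∈ T
    · obtain ⟨c, hc⟩ := tendsto_measure_inter_compl hE h (hTne S hS) Sᶜ
      exact ⟨c, fun _ => hc⟩
    · exact ⟨0, fun h => absurd h hS⟩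
  choose c hc using hex
  refine ⟨∑ S ∈ T, c S, (tendsto_finsetSum T fun S hS => hc S hS).congr fun n => ?_⟩
  rw [hD, measureReal_biUnion_finset (hdisj n) (fun S _ => hPm n S), Finset.mul_sum]

end Patterns

/-- Rounding `x` down to a multiple of `ε`, and to at most `J * ε`. -/
lemma rounding_bounds {ε x : ℝ} (hε : 0 < ε) (hx : 0 ≤ x) (J : ℕ) :
    ∑ j ∈ Finset.range J, (if (j + 1) * ε ≤ x then ε else 0) ≤ x ∧
    (J * ε ≤ x → ∑ j ∈ Finset.range J, (if (j + 1) * ε ≤ x then ε else 0) = J * ε) ∧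
    (x < J * ε → x - ε < ∑ j ∈ Finset.range J, (if (j + 1) * ε ≤ x then ε else 0)) := by
  induction J with
  | zero => refine ⟨by simpa using hx, by simp, fun h => ?_⟩; simp at h; linarith
  | succ J ih =>
    obtain ⟨h1, h2, h3⟩ := ih
    rw [Finset.sum_range_succ]
    push_cast
    split_ifs with hJ
    · have h4 := h2 (by linarith)
      exact ⟨by linarith, fun _ => by linarith, fun h => by linarith⟩
    · refine ⟨by linarith, fun h => absurd h hJ, fun h => ?_⟩
      rcases lt_or_ge x (J * ε) with h5 | h5
      · linarith [h3 h5]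
      · linarith [h2 h5]

/-! ### From convergence of maxima to tails. -/

section Maxima

variable {Ω : Type*} [MeasurableSpace Ω] {μ : Measure Ω}
  {E : Type*} [MeasurableSpace E]

lemma measureReal_forall_mem {X : ℕ → Ω → E} (hindep : iIndepFun X μ)
    (hident : ∀ i, IdentDistrib (X i) (X 0) μ μ) {B : Set E} (hB : MeasurableSet B) (n : ℕ) :
    μ.real {ω | ∀ i : Fin n, X i ω ∈ B} = μ.real {ω | X 0 ω ∈ B} ^ n := by
  have h1 := hindep.measure_inter_preimage_eq_mul (Finset.range n) (sets := fun _ => B)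
    (fun _ _ => hB)
  have h2 : {ω | ∀ i : Fin n, X i ω ∈ B} = ⋂ i ∈ Finset.range n, X i ⁻¹' B := by
    ext ω
    simp only [Set.mem_ofPred_eq, Set.mem_iInter, Finset.mem_range, Set.mem_preimage]
    exact ⟨fun h i hi => h ⟨i, hi⟩, fun h i => h i i.2⟩
  have h3 : ∀ i, μ (X i ⁻¹' B) = μ {ω | X 0 ω ∈ B} := fun i => (hident i).measure_mem_eq hB
  rw [measureReal_def, h2, h1, ENNReal.toReal_prod]
  simp [h3, measureReal_def]

end Maxima

/-- The distribution function of a nondegenerate law on the half-line lies strictly between `0` and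
`1` at some positive continuity point. -/
lemma exists_continuousAt_cdf (ν : Measure ℝ) [IsProbabilityMeasure ν]
    (hν : ¬ ∃ z₀ : ℝ, ∀ᵐ z ∂ν, z = z₀) (h0 : ∀ x < 0, cdf ν x = 0) :
    ∃ x, 0 < x ∧ ContinuousAt (cdf ν) x ∧ 0 < cdf ν x ∧ cdf ν x < 1 := by
  obtain ⟨x, hx0, hx1⟩ : ∃ x, 0 < cdf ν x ∧ cdf ν x < 1 := by
    -- Otherwise the distribution function takes only the values `0` and `1`, and the law is a point
    -- mass at the jump.
    by_contra! hcon
    apply hν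
    set S := {x | 0 < cdf ν x}
    have hne : S.Nonempty := ((tendsto_cdf_atTop ν).eventually_const_lt one_pos).exists
    have hbdd : BddBelow S := ⟨0, fun x hx => by
      by_contra! hlt
      exact absurd (h0 x hlt) (ne_of_gt hx)⟩
    set z := sInf S
    have hlt : ∀ x < z, cdf ν x = 0 := fun x hx =>
      le_antisymm (not_lt.mp fun hp => notMem_of_lt_csInf (s := S) hx hbdd hp) (cdf_nonneg ν x)
    have hgt : ∀ x, z < x → cdf ν x = 1 := by
      intro x hx
      obtain ⟨y, hy, hyx⟩ := exists_lt_of_csInf_lt hne hx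
      exact le_antisymm (cdf_le_one ν x) (hcon x (lt_of_lt_of_le hy (monotone_cdf ν hyx.le)))
    have hz : cdf ν z = 1 := by
      have h1 : Tendsto (cdf ν) (𝓝[>] z) (𝓝 (cdf ν z)) :=
        ((cdf ν).right_continuous z).tendsto.mono_left (nhdsWithin_mono _ Set.Ioi_subset_Ici_self)
      have h2 : Tendsto (cdf ν) (𝓝[>] z) (𝓝 1) := tendsto_const_nhds.congr' (by
        filter_upwards [self_mem_nhdsWithin] with x hx using (hgt x hx).symm)
      exact tendsto_nhds_unique h1 h2
    refine ⟨z, ?_⟩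
    have e1 : ν (Set.Iio z) = 0 := by
      obtain ⟨u, -, hu, hlim⟩ := exists_seq_strictMono_tendsto z
      have : Set.Iio z ⊆ ⋃ n, Set.Iic (u n) := by
        intro x hx
        obtain ⟨n, hn⟩ := (hlim.eventually_const_lt hx).exists
        exact Set.mem_iUnion.mpr ⟨n, hn.le⟩
      refine measure_mono_null this (measure_iUnion_null fun n => ?_)
      have := hlt (u n) (hu n)
      rw [cdf_eq_real, measureReal_eq_zero_iff] at this
      exact this
    have e2 : ν (Set.Ioi z) = 0 := by
      rw [cdf_eq_real] at hz
      have := probReal_compl_eq_one_sub (μ := ν) (measurableSet_Iic (a := z))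
      rw [hz, sub_self, Set.compl_Iic, measureReal_eq_zero_iff] at this
      exact this
    rw [ae_iff]
    refine measure_mono_null (fun x hx => ?_) (measure_union_null e1 e2)
    exact lt_or_gt_of_ne hx
  have hxn : 0 ≤ x := by
    by_contra! hlt
    exact absurd (h0 x hlt) hx0.ne'
  have h1 : Tendsto (cdf ν) (𝓝[>] x) (𝓝 (cdf ν x)) :=
    ((cdf ν).right_continuous x).tendsto.mono_left (nhdsWithin_mono _ Set.Ioi_subset_Ici_self)
  obtain ⟨q, hq, hq'⟩ := mem_nhdsGT_iff_exists_Ioo_subset.mp (h1.eventually_lt_const hx1)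
  obtain ⟨p, hp1, hp2, hpc⟩ := exists_continuousAt_between (monotone_cdf ν) hq
  exact ⟨p, hxn.trans_lt hp1, hpc, hx0.trans_le (monotone_cdf ν hp1.le), hq' ⟨hp1, hp2⟩⟩

lemma measure_singleton_of_continuousAt_cdf (ν : Measure ℝ) [IsProbabilityMeasure ν] {x : ℝ}
    (h : ContinuousAt (cdf ν) x) : ν {x} = 0 := by
  have h1 : Tendsto (fun y => cdf ν x - cdf ν y) (𝓝[<] x) (𝓝 (cdf ν x - cdf ν x)) :=
    tendsto_const_nhds.sub (h.tendsto.mono_left nhdsWithin_le_nhds)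
  rw [sub_self] at h1
  have h2 : ν.real {x} ≤ 0 := by
    refine ge_of_tendsto h1 ?_
    filter_upwards [self_mem_nhdsWithin] with y hy
    have hy : y < x := hy
    rw [cdf_eq_real, cdf_eq_real, ← measureReal_sdiff (Set.Iic_subset_Iic.mpr hy.le)
      measurableSet_Iic]
    refine measureReal_mono ?_
    intro z hz
    rw [Set.mem_singleton_iff] at hz
    subst hz
    exact ⟨Set.mem_Iic.mpr le_rfl, fun hz => not_le.mpr hy (Set.mem_Iic.mp hz)⟩
  exact (measureReal_eq_zero_iff).mp (le_antisymm h2 measureReal_nonneg)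

/-- If `n (1 - F(a_n y))` is squeezed between convergent sequences, up to arbitrarily small
changes of `y`, and the maxima neither explode nor vanish, then `1 - F` varies regularly. -/
theorem regVar_of_sandwich {F : ℝ → ℝ} {a : ℕ → ℝ} (monoF : Monotone F) (F_nonneg : ∀ x, 0 ≤ F x)
    (F_le_one : ∀ x, F x ≤ 1) (F_top : Tendsto F atTop (𝓝 1)) (ha : ∀ n, 0 < a n)
    (hs : ∀ y y', 0 < y → y < y' → ∃ p : ℕ → ℝ, ∃ c,
      Tendsto (fun n : ℕ => (n : ℝ) * p n) atTop (𝓝 c) ∧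
        ∀ n, 1 - F (a n * y') ≤ p n ∧ p n ≤ 1 - F (a n * y))
    (htop : ∀ ε > 0, ∃ y > 0, ∀ᶠ n in atTop, 1 - ε ≤ F (a n * y) ^ n)
    (hlt : ∀ y > 0, ∃ g < 1, ∀ᶠ n in atTop, F (a n * y) ^ n ≤ g) :
    ∃ α, 0 < α ∧ RegVar (fun t => 1 - F t) (-α) := by
  -- Convergence of `F (a_n y) ^ n` is not yet known, so `G` is defined by limits along an
  -- ultrafilter. The sandwiching sequences converge along all `n`, with limits between `G y` and `G
  -- y'`, and this upgrades to convergence at continuity points of `G`.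
  set u : Ultrafilter ℕ := Ultrafilter.of atTop
  have hu : (u : Filter ℕ) ≤ atTop := Ultrafilter.of_le _
  have hG : ∀ y, ∃ g ∈ Set.Icc (0 : ℝ) 1, Tendsto (fun n => F (a n * y) ^ n) u (𝓝 g) := by
    intro y
    exact isCompact_Icc.ultrafilter_le_nhds (u.map fun n => F (a n * y) ^ n) (tendsto_principal.mpr (Eventually.of_forall fun n =>
        ⟨pow_nonneg (F_nonneg _) _, pow_le_one₀ (F_nonneg _) (F_le_one _)⟩))
  choose G hG01 hGlim using hG
  have hstep : ∀ y y', 0 < y → y < y' → ∃ q : ℕ → ℝ, ∃ c, Tendsto q atTop (𝓝 c) ∧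
      G y ≤ c ∧ c ≤ G y' ∧ ∀ n, F (a n * y) ^ n ≤ q n ∧ q n ≤ F (a n * y') ^ n := by
    intro y y' hy hyy
    obtain ⟨p, c, hp, hpb⟩ := hs y y' hy hyy
    have h1 := tendsto_one_sub_pow hp
    have h2 : ∀ n, F (a n * y) ^ n ≤ (1 - p n) ^ n ∧ (1 - p n) ^ n ≤ F (a n * y') ^ n := by
      intro n
      obtain ⟨e1, e2⟩ := hpb n
      refine ⟨pow_le_pow_left₀ (F_nonneg _) (by linarith) _,
        pow_le_pow_left₀ (by linarith [F_nonneg (a n * y)]) (by linarith) _⟩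
    exact ⟨_, _, h1, le_of_tendsto_of_tendsto' (hGlim y) (h1.mono_left hu) fun n => (h2 n).1,
      le_of_tendsto_of_tendsto' (h1.mono_left hu) (hGlim y') fun n => (h2 n).2, h2⟩
  have hmax : MaxConverges F G a := by
    refine ⟨monoF, F_nonneg, F_le_one, ha, ?_, fun x => (hG01 x).1, fun x => (hG01 x).2, ?_, ?_⟩
    · intro y y' hyy
      exact le_of_tendsto_of_tendsto' (hGlim y) (hGlim y') fun n =>
        pow_le_pow_left₀ (F_nonneg _) (monoF (mul_le_mul_of_nonneg_left hyy (ha n).le)) _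
    · rw [tendsto_order]
      refine ⟨fun c hc => ?_, fun c hc => Eventually.of_forall fun x => (hG01 x).2.trans_lt hc⟩
      obtain ⟨y, hy, hy'⟩ := htop ((1 - c) / 2) (by linarith)
      filter_upwards [eventually_ge_atTop y] with x hx
      have : 1 - (1 - c) / 2 ≤ G x := ge_of_tendsto (hGlim x) (by
        filter_upwards [hy'.filter_mono hu] with n hn
        exact hn.trans (pow_le_pow_left₀ (F_nonneg _)
          (monoF (mul_le_mul_of_nonneg_left hx (ha n).le)) _))
      linarith
    · intro y hy hc
      rw [tendsto_order]
      constructor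
      · intro c hcG
        obtain ⟨z, ⟨hz1, hz0⟩, hz2⟩ : ∃ z, (c < G z ∧ 0 < z) ∧ z < y := by
          have := ((hc.eventually_const_lt hcG).and (eventually_gt_nhds hy)).filter_mono
            (nhdsWithin_le_nhds (s := Set.Iio y))
          exact (this.and self_mem_nhdsWithin).exists
        obtain ⟨q, c', hq, hq1, -, hq3⟩ := hstep z y hz0 hz2
        filter_upwards [hq.eventually_const_lt (hz1.trans_le hq1)] with n hn
        exact hn.trans_le (hq3 n).2
      · intro c hcG
        obtain ⟨z, hz1, hz2⟩ : ∃ z, G z < c ∧ y < z := by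
          have := (hc.eventually_lt_const hcG).filter_mono
            (nhdsWithin_le_nhds (s := Set.Ioi y))
          exact (this.and self_mem_nhdsWithin).exists
        obtain ⟨q, c', hq, -, hq2, hq3⟩ := hstep y z hy hz2
        filter_upwards [hq.eventually_lt_const (hq2.trans_lt hz1)] with n hn
        exact (hq3 n).1.trans_lt hn
  have hGlt : ∀ y, 0 < y → G y < 1 := by
    intro y hy
    obtain ⟨g, hg, hg'⟩ := hlt y hy
    exact (le_of_tendsto (hGlim y) (hg'.filter_mono hu)).trans_lt hg
  obtain ⟨z, hz0, hz⟩ := ((eventually_gt_atTop 0).and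
    (hmax.G_top.eventually_const_lt one_pos)).exists
  obtain ⟨x₁, hx1, -, hxc⟩ := exists_continuousAt_between hmax.monoG (lt_add_one z)
  have hx₁ : 0 < x₁ := hz0.trans hx1
  obtain ⟨α, v, hα, hv, hform⟩ := hmax.frechet hx₁ (hGlt x₁ hx₁)
    (hz.trans_le (hmax.monoG hx1.le)) hxc
  refine ⟨α, hα, regVar_of_tendsto ha (fun x y hxy => by linarith [monoF hxy])
    (fun x => by linarith [F_le_one x]) ?_ hα hv fun x hx => ?_⟩
  · simpa using (tendsto_const_nhds (x := (1 : ℝ))).sub F_top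
  · have hcont : ContinuousAt G x := by
      have h1 : ContinuousAt (fun x : ℝ => Real.exp (-(v * x ^ (-α)))) x := by
        have : ContinuousAt (fun x : ℝ => x ^ (-α)) x :=
          Real.continuousAt_rpow_const _ _ (Or.inl hx.ne')
        exact (continuousAt_const.mul this).neg.rexp
      refine h1.congr ?_
      filter_upwards [eventually_gt_nhds hx] with y hy using (hform y hy).symm
    have h1 := hmax.conv x hx hcont
    have h2 : 0 < G x := by rw [hform x hx]; positivity
    have h3 := tendsto_mul_of_tendsto_one_sub_pow (p := fun n => 1 - F (a n * x))
      (fun n => by linarith [F_le_one (a n * x)]) (fun n => by linarith [F_nonneg (a n * x)]) h2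
      (by simpa using h1)
    rwa [hform x hx, Real.log_exp, neg_neg] at h3

section Maxima

variable {Ω : Type*} [MeasurableSpace Ω] {μ : Measure Ω} [IsProbabilityMeasure μ]
  {Ω' : Type*} [MeasurableSpace Ω'] {μ' : Measure Ω'} [IsProbabilityMeasure μ']

lemma _root_.MeasureTheory.TendstoInDistribution.tendsto_measureReal {E : Type*}
    [TopologicalSpace E] [MeasurableSpace E] [OpensMeasurableSpace E] [HasOuterApproxClosed E]
    {X : ℕ → Ω → E} {Z : Ω' → E}
    (h : TendstoInDistribution X atTop Z (fun _ => μ) μ') {S : Set E} (hS : MeasurableSet S)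
    (hfr : μ' (Z ⁻¹' frontier S) = 0) :
    Tendsto (fun n => μ.real (X n ⁻¹' S)) atTop (𝓝 (μ'.real (Z ⁻¹' S))) := by
  have h1 := ProbabilityMeasure.tendsto_measure_of_null_frontier_of_tendsto' h.tendsto
    (E := S) (by
      rw [ProbabilityMeasure.coe_mk, Measure.map_apply_of_aemeasurable h.aemeasurable_limit
        measurableSet_frontier]
      exact hfr)
  simp only [ProbabilityMeasure.coe_mk,
    Measure.map_apply_of_aemeasurable h.aemeasurable_limit hS,
    Measure.map_apply_of_aemeasurable (h.forall_aemeasurable _) hS] at h1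
  exact (ENNReal.tendsto_toReal (measure_ne_top _ _)).comp h1

lemma iSup_div_le_iff {n : ℕ} (hn : 0 < n) (x : Fin n → ℝ) {a y : ℝ} (ha : 0 < a) :
    (⨆ i, x i) / a ≤ y ↔ ∀ i, x i ≤ a * y := by
  have : Nonempty (Fin n) := ⟨⟨0, hn⟩⟩
  rw [div_le_iff₀ ha, ciSup_le_iff (Set.finite_range x).bddAbove, mul_comm]

lemma iSup_div_lt_iff {n : ℕ} (hn : 0 < n) (x : Fin n → ℝ) {a y : ℝ} (ha : 0 < a) :
    (⨆ i, x i) / a < y ↔ ∀ i, x i < a * y := by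
  have : Nonempty (Fin n) := ⟨⟨0, hn⟩⟩
  rw [div_lt_iff₀ ha, mul_comm]
  constructor
  · exact fun h i => (le_ciSup (Set.finite_range x).bddAbove i).trans_lt h
  · intro h
    obtain ⟨i, hi⟩ := exists_eq_ciSup_of_finite (f := x)
    rw [← hi]
    exact h i

/-- If the rescaled maxima of nonnegative i.i.d. random variables converge in distribution to a
nondegenerate limit, then this limit is a Fréchet law and the tail is attracted to it. -/
theorem exists_frechet_of_tendstoInDistribution {X : ℕ → Ω → ℝ} (hmeas : Measurable (X 0))
    (hindep : iIndepFun X μ) (hident : ∀ i, IdentDistrib (X i) (X 0) μ μ)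
    (hnonneg : ∀ᵐ ω ∂μ, 0 ≤ X 0 ω) {a : ℕ → ℝ} (ha : ∀ n, 0 < a n) {Z : Ω' → ℝ}
    (hZ : ¬ ∃ z₀ : ℝ, ∀ᵐ ω ∂μ', Z ω = z₀)
    (h : TendstoInDistribution (fun n ω => (⨆ i : Fin n, X i ω) / a n) atTop Z (fun _ => μ) μ') :
    ∃ α v : ℝ, 0 < α ∧ 0 < v ∧
      (∀ x, 0 < x → Tendsto (fun n : ℕ => (n : ℝ) * μ.real {ω | a n * x < X 0 ω}) atTop
        (𝓝 (v * x ^ (-α)))) ∧ ∀ x, 0 < x → μ' {ω | Z ω = x} = 0 := by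
  have hZm : AEMeasurable Z μ' := h.aemeasurable_limit
  have : IsProbabilityMeasure (μ.map (X 0)) := Measure.isProbabilityMeasure_map hmeas.aemeasurable
  have : IsProbabilityMeasure (μ'.map Z) := Measure.isProbabilityMeasure_map hZm
  set F := cdf (μ.map (X 0)) with hF
  set G := cdf (μ'.map Z) with hG
  have hFx : ∀ x, F x = μ.real {ω | X 0 ω ≤ x} := fun x => by
    rw [hF, cdf_eq_real, map_measureReal_apply hmeas measurableSet_Iic]; rfl
  have hGx : ∀ x, G x = μ'.real (Z ⁻¹' Set.Iic x) := fun x => by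
    rw [hG, cdf_eq_real, measureReal_def, Measure.map_apply_of_aemeasurable hZm measurableSet_Iic]
    rfl
  have hsing : ∀ x, ContinuousAt G x → μ' (Z ⁻¹' {x}) = 0 := by
    intro x hx
    have := measure_singleton_of_continuousAt_cdf _ hx
    rwa [Measure.map_apply_of_aemeasurable hZm (measurableSet_singleton x)] at this
  have hconv : ∀ x, ContinuousAt G x → Tendsto (fun n => F (a n * x) ^ n) atTop (𝓝 (G x)) := by
    intro x hx
    have h1 := h.tendsto_measureReal (measurableSet_Iic (a := x))
      (by rw [frontier_Iic]; exact hsing x hx)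
    rw [hGx]
    refine h1.congr' ?_
    filter_upwards [eventually_gt_atTop 0] with n hn
    rw [hFx]
    have := measureReal_forall_mem hindep hident (measurableSet_Iic (a := a n * x)) n
    simp only [Set.mem_Iic] at this
    rw [← this]
    congr 1
    ext ω
    exact iSup_div_le_iff hn _ (ha n)
  have hG0 : ∀ x < 0, G x = 0 := by
    intro x hx
    obtain ⟨y, hy1, hy2, hyc⟩ := exists_continuousAt_between (monotone_cdf (μ'.map Z)) hx
    have h1 : Tendsto (fun n => F (a n * y) ^ n) atTop (𝓝 0) := by
      refine tendsto_const_nhds.congr' ?_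
      filter_upwards [eventually_gt_atTop 0] with n hn
      have : F (a n * y) = 0 := by
        rw [hFx, measureReal_eq_zero_iff]
        refine measure_mono_null (fun ω (hω : X 0 ω ≤ a n * y) => ?_) hnonneg
        have := ha n
        show ¬ 0 ≤ X 0 ω
        nlinarith
      rw [this, zero_pow hn.ne']
    have h2 := tendsto_nhds_unique (hconv y hyc) h1
    exact le_antisymm (h2 ▸ monotone_cdf (μ'.map Z) hy1.le) (cdf_nonneg _ _)
  have hmax : MaxConverges F G a := ⟨monotone_cdf _, cdf_nonneg _, cdf_le_one _, ha,
    monotone_cdf _, cdf_nonneg _, cdf_le_one _, tendsto_cdf_atTop _, fun x _ => hconv x⟩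
  obtain ⟨x₁, hx₁, hc, h0, h1⟩ := exists_continuousAt_cdf (μ'.map Z) (by
    rintro ⟨z₀, hz₀⟩
    exact hZ ⟨z₀, ae_of_ae_map hZm hz₀⟩) hG0
  obtain ⟨α, v, hα, hv, hform⟩ := hmax.frechet hx₁ h1 h0 hc
  have hcont : ∀ x, 0 < x → ContinuousAt G x := by
    intro x hx
    have h1 : ContinuousAt (fun x : ℝ => Real.exp (-(v * x ^ (-α)))) x := by
      have : ContinuousAt (fun x : ℝ => x ^ (-α)) x :=
        Real.continuousAt_rpow_const _ _ (Or.inl hx.ne')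
      exact (continuousAt_const.mul this).neg.rexp
    refine h1.congr ?_
    filter_upwards [eventually_gt_nhds hx] with y hy using (hform y hy).symm
  refine ⟨α, v, hα, hv, fun x hx => ?_, fun x hx => hsing x (hcont x hx)⟩
  have h2 : 0 < G x := by rw [hform x hx]; positivity
  have h3 := tendsto_mul_of_tendsto_one_sub_pow (p := fun n => 1 - F (a n * x))
    (fun n => by linarith [cdf_le_one (μ.map (X 0)) (a n * x)])
    (fun n => by linarith [cdf_nonneg (μ.map (X 0)) (a n * x)]) h2
    (by simpa using hconv x (hcont x hx))
  rw [hform x hx, Real.log_exp, neg_neg] at h3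
  refine h3.congr fun n => ?_
  have h4 := probReal_compl_eq_one_sub (μ := μ) (measurableSet_le hmeas
    (measurable_const (a := a n * x)))
  rw [hFx, ← h4]
  congr 2
  ext ω
  simp

variable {d : ℕ}

/-- Scaled probabilities of joint exceedances converge when the rescaled maxima converge. -/
lemma tendsto_measure_exceedances {X : ℕ → Ω → Fin d → ℝ} (hmeas : Measurable (X 0))
    (hindep : iIndepFun X μ) (hident : ∀ i, IdentDistrib (X i) (X 0) μ μ)
    {A : ℕ → ℝ} (hA : ∀ n, 0 < A n) {W : Ω' → Fin d → ℝ}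
    (hW : TendstoInDistribution (fun n ω k => (⨆ i : Fin n, X i ω k) / A n) atTop W
      (fun _ => μ) μ')
    (hnull : ∀ k x, 0 < x → μ' {ω | W ω k = x} = 0)
    (hbd : ∀ k x, 0 < x → ∃ C, ∀ᶠ n : ℕ in atTop, (n : ℝ) * μ.real {ω | A n * x ≤ X 0 ω k} ≤ C)
    {ι : Type*} (κ : ι → Fin d) (s : ι → ℝ) (hs : ∀ i, 0 < s i) (I : Finset ι) :
    ∃ c, Tendsto (fun n : ℕ => (n : ℝ) * μ.real (⋃ i ∈ I, {ω | A n * s i ≤ X 0 ω (κ i)}))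
      atTop (𝓝 c) := by
  have hmk : ∀ k, Measurable fun ω => X 0 ω k := fun k => (measurable_pi_apply k).comp hmeas
  set p : ℕ → ℝ := fun n => μ.real (⋃ i ∈ I, {ω | A n * s i ≤ X 0 ω (κ i)}) with hp
  -- Exceedances are defined with `≤`, so the complementary event corresponds to an open set. Its
  -- boundary lies in hyperplanes which the limit law does not charge.
  set S : Set (Fin d → ℝ) := {z | ∀ i ∈ I, z (κ i) < s i} with hS
  have hSopen : IsOpen S := by
    have : S = ⋂ i ∈ I, {z | z (κ i) < s i} := by ext; simp [hS]
    rw [this]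
    exact isOpen_biInter_finset fun i _ => isOpen_lt (continuous_apply _) continuous_const
  have hfr : frontier S ⊆ ⋃ i ∈ I, {z | z (κ i) = s i} := by
    intro z hz
    rw [hSopen.frontier_eq] at hz
    have hcl : closure S ⊆ {z | ∀ i ∈ I, z (κ i) ≤ s i} := by
      apply closure_minimal
      · exact fun z hz i hi => (hz i hi).le
      · have : {z : Fin d → ℝ | ∀ i ∈ I, z (κ i) ≤ s i} = ⋂ i ∈ I, {z | z (κ i) ≤ s i} := by
          ext; simp
        rw [this]
        exact isClosed_biInter fun i _ => isClosed_le (continuous_apply _) continuous_const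
    have h1 := hcl hz.1
    have h2 : ∃ i ∈ I, s i ≤ z (κ i) := by
      by_contra! hcon
      exact hz.2 hcon
    obtain ⟨i, hi, h3⟩ := h2
    exact Set.mem_biUnion hi (le_antisymm (h1 i hi) h3)
  have hlim : Tendsto (fun n => (1 - p n) ^ n) atTop (𝓝 (μ'.real (W ⁻¹' S))) := by
    have h1 := hW.tendsto_measureReal hSopen.measurableSet (by
      refine measure_mono_null (Set.preimage_mono hfr) ?_
      rw [Set.preimage_iUnion₂]
      exact (measure_biUnion_null_iff I.countable_toSet).mpr fun i _ => hnull (κ i) (s i) (hs i))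
    refine h1.congr' ?_
    filter_upwards [eventually_gt_atTop 0] with n hn
    have hBm : MeasurableSet {z : Fin d → ℝ | ∀ i ∈ I, z (κ i) < A n * s i} := by
      have : {z : Fin d → ℝ | ∀ i ∈ I, z (κ i) < A n * s i}
          = ⋂ i ∈ I, {z | z (κ i) < A n * s i} := by ext; simp
      rw [this]
      exact Finset.measurableSet_biInter _ fun i _ =>
        measurableSet_lt (measurable_pi_apply _) measurable_const
    have h2 := measureReal_forall_mem hindep hident hBm n
    have h3 : 1 - p n = μ.real {ω | X 0 ω ∈ {z : Fin d → ℝ | ∀ i ∈ I, z (κ i) < A n * s i}} := by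
      have hm : MeasurableSet (⋃ i ∈ I, {ω | A n * s i ≤ X 0 ω (κ i)}) :=
        Finset.measurableSet_biUnion _ fun i _ => measurableSet_le measurable_const (hmk _)
      rw [hp, ← probReal_compl_eq_one_sub hm]
      congr 1
      ext ω
      simp
    rw [h3, ← h2]
    congr 1
    ext ω
    simp only [hS, Set.mem_preimage, Set.mem_ofPred_eq, iSup_div_lt_iff hn _ (hA n)]
    exact ⟨fun h j i hi => h i hi j, fun h i hi j => h j i hi⟩
  have hC : ∃ C, ∀ᶠ n : ℕ in atTop, (n : ℝ) * p n ≤ C := by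
    have hex : ∀ i, ∃ C, ∀ᶠ n : ℕ in atTop,
        (n : ℝ) * μ.real {ω | A n * s i ≤ X 0 ω (κ i)} ≤ C := fun i => hbd (κ i) (s i) (hs i)
    choose C hC using hex
    refine ⟨∑ i ∈ I, C i, ?_⟩
    have hall : ∀ᶠ n : ℕ in atTop, ∀ i ∈ I,
        (n : ℝ) * μ.real {ω | A n * s i ≤ X 0 ω (κ i)} ≤ C i :=
      (I.eventually_all).mpr fun i _ => hC i
    filter_upwards [hall] with n hn
    calc (n : ℝ) * p n ≤ n * ∑ i ∈ I, μ.real {ω | A n * s i ≤ X 0 ω (κ i)} :=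
          mul_le_mul_of_nonneg_left (measureReal_biUnion_finset_le _ _) (Nat.cast_nonneg _)
      _ ≤ _ := by rw [Finset.mul_sum]; exact Finset.sum_le_sum hn
  obtain ⟨C, hC⟩ := hC
  -- Taking logarithms requires a positive limit: `n p ≤ C` gives `(1 - p) ^ n ≥ (1 - C / n) ^ n →
  -- exp (-C)`.
  have hpos : 0 < μ'.real (W ⁻¹' S) := by
    have h1 : Tendsto (fun n : ℕ => (1 - C / n) ^ n) atTop (𝓝 (Real.exp (-C))) := by
      apply tendsto_one_sub_pow
      refine tendsto_const_nhds.congr' ?_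
      filter_upwards [eventually_gt_atTop 0] with n hn
      have : (n : ℝ) ≠ 0 := by positivity
      field_simp
    refine (Real.exp_pos (-C)).trans_le (le_of_tendsto_of_tendsto h1 hlim ?_)
    have h2 : ∀ᶠ n : ℕ in atTop, C / n < 1 :=
      (tendsto_const_nhds.div_atTop tendsto_natCast_atTop_atTop).eventually_lt_const one_pos
    filter_upwards [hC, h2, eventually_gt_atTop 0] with n hn hn2 hn0
    have hn' : (0 : ℝ) < n := by exact_mod_cast hn0
    have : p n ≤ C / n := by rw [le_div_iff₀ hn']; linarith
    exact pow_le_pow_left₀ (by linarith) (by linarith) _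
  exact ⟨_, tendsto_mul_of_tendsto_one_sub_pow (fun n => measureReal_nonneg)
    (fun n => measureReal_le_one) hpos hlim⟩

end Maxima

/-! ### Tails of positive linear combinations. -/

section Sum

variable {Ω : Type*} [MeasurableSpace Ω] {μ : Measure Ω} [IsProbabilityMeasure μ] {d : ℕ}

/-- The tail of a positive combination of the coordinates is squeezed between convergent
sequences, by rounding the coordinates to a finite grid. -/
lemma exists_sandwich_linear_combination {X : Ω → Fin d → ℝ} (hmeas : Measurable X)
    (hnonneg : ∀ᵐ ω ∂μ, ∀ k, 0 ≤ X ω k) {A : ℕ → ℝ} (hA : ∀ n, 0 < A n)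
    (hbox : ∀ (J : ℕ) (s : Fin d × Fin J → ℝ), (∀ i, 0 < s i) → ∀ I : Finset (Fin d × Fin J),
      ∃ c, Tendsto (fun n : ℕ => (n : ℝ) * μ.real (⋃ i ∈ I, {ω | A n * s i ≤ X ω i.1}))
        atTop (𝓝 c))
    {θ : Fin d → ℝ} (hθ : ∀ k, 0 < θ k) {y y' : ℝ} (hy : 0 < y) (hyy : y < y') :
    ∃ p : ℕ → ℝ, ∃ c, Tendsto (fun n : ℕ => (n : ℝ) * p n) atTop (𝓝 c) ∧
      ∀ n, μ.real {ω | A n * y' < ∑ k, θ k * X ω k} ≤ p n ∧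
        p n ≤ μ.real {ω | A n * y < ∑ k, θ k * X ω k} := by
  have hmk : ∀ k, Measurable fun ω => X ω k := fun k => (measurable_pi_apply k).comp hmeas
  set S := ∑ k, θ k
  have hS0 : 0 ≤ S := Finset.sum_nonneg fun k _ => (hθ k).le
  -- Rounding costs less than `ε` per coordinate below the top of the grid, hence at most `ε * S ≤
  -- y' - y` in the combination. The `+ 1` keeps the denominator visibly positive.
  set ε := (y' - y) / (S + 1) with hεdef
  have hε : 0 < ε := div_pos (by linarith) (by linarith)
  have hεS : ε * S ≤ y' - y := by
    rw [hεdef, div_mul_eq_mul_div, div_le_iff₀ (by linarith)]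
    nlinarith
  -- The grid reaches so far that one coordinate beyond its top already brings the rounded
  -- combination to `y'`.
  obtain ⟨J, hJ⟩ : ∃ J : ℕ, ∀ k, y' ≤ θ k * (J * ε) := by
    have : ∀ᶠ J : ℕ in atTop, ∀ k, y' ≤ θ k * (J * ε) := by
      rw [eventually_all]
      intro k
      exact ((tendsto_natCast_atTop_atTop.atTop_mul_const hε).const_mul_atTop
        (hθ k)).eventually_ge_atTop y'
    exact this.exists
  set s : Fin d × Fin J → ℝ := fun i => ((i.2 : ℕ) + 1) * ε
  have hs : ∀ i, 0 < s i := fun i => by positivity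
  set E : ℕ → Fin d × Fin J → Set Ω := fun n i => {ω | A n * s i ≤ X ω i.1}
  have hE : ∀ n i, MeasurableSet (E n i) := fun n i => measurableSet_le measurable_const (hmk _)
  obtain ⟨c, hc⟩ := tendsto_measure_weighted_sum hE (hbox J s hs) (fun i => θ i.1 * ε) hy.le
  set r : ℝ → ℝ := fun x => ∑ j ∈ Finset.range J, (if ((j : ℕ) + 1) * ε ≤ x then ε else 0)
  have hsum : ∀ n ω, ∑ i, (E n i).indicator (fun _ => θ i.1 * ε) ω
      = ∑ k, θ k * r (X ω k / A n) := by
    intro n ω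
    rw [Fintype.sum_prod_type]
    refine Finset.sum_congr rfl fun k _ => ?_
    simp only [r, Finset.mul_sum]
    rw [← Fin.sum_univ_eq_sum_range
      (fun j => θ k * (if ((j : ℕ) + 1) * ε ≤ X ω k / A n then ε else 0))]
    refine Finset.sum_congr rfl fun j _ => ?_
    have hiff : ω ∈ E n (k, j) ↔ ((j : ℕ) + 1) * ε ≤ X ω k / A n := by
      simp only [E, s, Set.mem_ofPred_eq]
      rw [le_div_iff₀ (hA n), mul_comm]
    by_cases h : ω ∈ E n (k, j)
    · rw [Set.indicator_of_mem h, if_pos (hiff.mp h)]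
    · rw [Set.indicator_of_notMem h, if_neg (fun h' => h (hiff.mpr h')), mul_zero]
  have hY : ∀ n ω, (∑ k, θ k * X ω k) = A n * ∑ k, θ k * (X ω k / A n) := by
    intro n ω
    rw [Finset.mul_sum]
    refine Finset.sum_congr rfl fun k _ => ?_
    have := (hA n).ne'
    field_simp
  refine ⟨_, c, hc, fun n => ⟨?_, ?_⟩⟩
  · refine ENNReal.toReal_mono (measure_ne_top _ _) (measure_mono_ae ?_)
    filter_upwards [hnonneg] with ω hω hlt
    replace hlt : A n * y' < ∑ k, θ k * X ω k := hlt
    show y < ∑ i, (E n i).indicator (fun _ => θ i.1 * ε) ω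
    rw [hsum]
    rw [hY n, mul_lt_mul_iff_right₀ (hA n)] at hlt
    have hx : ∀ k, 0 ≤ X ω k / A n := fun k => div_nonneg (hω k) (hA n).le
    have hr0 : ∀ k, 0 ≤ r (X ω k / A n) := fun k => Finset.sum_nonneg fun j _ => by
      split_ifs <;> linarith
    by_cases hbig : ∃ k, J * ε ≤ X ω k / A n
    · obtain ⟨k, hk⟩ := hbig
      calc y < y' := hyy
        _ ≤ θ k * (J * ε) := hJ k
        _ = θ k * r (X ω k / A n) := by rw [← (rounding_bounds hε (hx k) J).2.1 hk]
        _ ≤ _ := Finset.single_le_sum (f := fun k => θ k * r (X ω k / A n))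
          (fun k _ => mul_nonneg (hθ k).le (hr0 k)) (Finset.mem_univ k)
    · push Not at hbig
      have h1 : ∑ k, θ k * (X ω k / A n - ε) ≤ ∑ k, θ k * r (X ω k / A n) :=
        Finset.sum_le_sum fun k _ => mul_le_mul_of_nonneg_left
          ((rounding_bounds hε (hx k) J).2.2 (hbig k)).le (hθ k).le
      have h2 : ∑ k, θ k * (X ω k / A n - ε) = ∑ k, θ k * (X ω k / A n) - ε * S := by
        simp only [mul_sub, Finset.sum_sub_distrib, S, Finset.mul_sum]
        congr 1
        exact Finset.sum_congr rfl fun k _ => mul_comm _ _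
      linarith
  · refine ENNReal.toReal_mono (measure_ne_top _ _) (measure_mono_ae ?_)
    filter_upwards [hnonneg] with ω hω hlt
    replace hlt : y < ∑ i, (E n i).indicator (fun _ => θ i.1 * ε) ω := hlt
    show A n * y < ∑ k, θ k * X ω k
    rw [hsum] at hlt
    rw [hY n, mul_lt_mul_iff_right₀ (hA n)]
    refine hlt.trans_le (Finset.sum_le_sum fun k _ => mul_le_mul_of_nonneg_left ?_ (hθ k).le)
    exact (rounding_bounds hε (div_nonneg (hω k) (hA n).le) J).1

/-- Positive combinations of the coordinates of a heavy-tailed random vector have regularly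
varying tails. -/
theorem HeavyTailed.regVar_linear_combination (hd : 0 < d) {X : ℕ → Ω → Fin d → ℝ}
    (hmeas : ∀ i, Measurable (X i)) (hindep : iIndepFun X μ)
    (hident : ∀ i, IdentDistrib (X i) (X 0) μ μ) (hnonneg : ∀ᵐ ω ∂μ, ∀ k, 0 ≤ X 0 ω k)
    (h : HeavyTailed μ X) {θ : Fin d → ℝ} (hθ : ∀ k, 0 < θ k) :
    ∃ α, 0 < α ∧ RegVar (fun t => μ.real {ω | t < ∑ k, θ k * X 0 ω k}) (-α) := by
  obtain ⟨a, ha, ⟨b, hb⟩, G, hG, hconv⟩ := h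
  have hmk : ∀ i k, Measurable fun ω => X i ω k := fun i k =>
    (measurable_pi_apply k).comp (hmeas i)
  have hmarg : ∀ k, ∃ α v : ℝ, 0 < α ∧ 0 < v ∧
      (∀ x, 0 < x → Tendsto (fun n : ℕ => (n : ℝ) * μ.real {ω | a n k * x < X 0 ω k}) atTop
        (𝓝 (v * x ^ (-α)))) ∧
      ∀ x, 0 < x → (G : Measure (Fin d → ℝ)) {z | z k = x} = 0 := by
    intro k
    refine exists_frechet_of_tendstoInDistribution (X := fun i ω => X i ω k) (a := fun n => a n k)
      (Z := fun z : Fin d → ℝ => z k) (hmk 0 k)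
      (hindep.comp (fun _ z => z k) fun _ => measurable_pi_apply k)
      (fun i => (hident i).comp (measurable_pi_apply k))
      (hnonneg.mono fun ω hω => hω k) (fun n => ha n k) (hG k) ?_
    exact hconv.continuous_comp (continuous_apply k)
  choose α v hα hv hlim hnull using hmarg
  -- One scale for all coordinates. The limits `b k` of `a n k / A n` absorb the difference; `b k =
  -- 0` is allowed and means that coordinate `k` is negligible at scale `A n`.
  set A : ℕ → ℝ := fun n => ‖a n‖ with hAdef
  have haA : ∀ n k, a n k ≤ A n := fun n k =>
    (Real.le_norm_self _).trans (norm_le_pi_norm (a n) k)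
  have hA : ∀ n, 0 < A n := fun n => (ha n ⟨0, hd⟩).trans_le (haA n _)
  have hbk : ∀ k, Tendsto (fun n => a n k / A n) atTop (𝓝 (b k)) := by
    intro k
    refine (((continuous_apply k).tendsto b).comp hb).congr fun n => ?_
    simp [hAdef, div_eq_inv_mul]
  have hb0 : ∀ k, 0 ≤ b k := fun k => ge_of_tendsto' (hbk k) fun n =>
    (div_pos (ha n k) (hA n)).le
  -- The normalized vectors have norm `1`, hence so does their limit. The coordinate `k₀` keeps the
  -- maxima of the combination from vanishing.
  obtain ⟨k₀, hk₀⟩ : ∃ k, 0 < b k := by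
    by_contra! hcon
    have hbz : b = 0 := funext fun k => le_antisymm (hcon k) (hb0 k)
    have h1 : Tendsto (fun n => ‖‖a n‖⁻¹ • a n‖) atTop (𝓝 ‖b‖) := hb.norm
    have h2 : ∀ n, ‖‖a n‖⁻¹ • a n‖ = 1 := fun n => by
      rw [norm_smul, norm_inv, norm_norm, inv_mul_cancel₀ (hA n).ne']
    simp only [h2, hbz, norm_zero] at h1
    exact one_ne_zero (tendsto_nhds_unique tendsto_const_nhds h1)
  have hW : TendstoInDistribution (fun n ω k => (⨆ i : Fin n, X i ω k) / A n) atTop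
      (fun (z : Fin d → ℝ) k => z k * b k) (fun _ => μ) (G : Measure (Fin d → ℝ)) := by
    have h1 := hconv.continuous_comp_prodMk_of_tendstoInMeasure_const
      (g := fun q : (Fin d → ℝ) × (Fin d → ℝ) => fun k => q.1 k * q.2 k)
      (Y := fun n _ => ‖a n‖⁻¹ • a n) (c := b) (by fun_prop) (by
        refine tendstoInMeasure_of_tendsto_ae (fun n => aestronglyMeasurable_const) ?_
        exact ae_of_all _ fun _ => hb) (fun i => aemeasurable_const)
    refine h1.congr (fun n => ae_of_all _ fun ω => ?_) (ae_of_all _ fun z => ?_)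
    · ext k
      have e1 := (ha n k).ne'
      have e2 := (hA n).ne'
      simp only [Pi.smul_apply, smul_eq_mul]
      change _ / _ * ((A n)⁻¹ * _) = _
      field_simp
    · rfl
  have hWnull : ∀ k x, 0 < x → (G : Measure (Fin d → ℝ)) {z | z k * b k = x} = 0 := by
    intro k x hx
    rcases (hb0 k).eq_or_lt with h0 | h0
    · have : {z : Fin d → ℝ | z k * b k = x} = ∅ := by
        ext z
        simp [← h0, hx.ne]
      rw [this, measure_empty]
    · have : {z : Fin d → ℝ | z k * b k = x} = {z | z k = x / b k} := by
        ext z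
        exact (eq_div_iff h0.ne').symm
      rw [this]
      exact hnull k _ (by positivity)
  have hbd : ∀ k x, 0 < x →
      ∃ C, ∀ᶠ n : ℕ in atTop, (n : ℝ) * μ.real {ω | A n * x ≤ X 0 ω k} ≤ C := by
    intro k x hx
    -- As `a n k ≤ A n`, the marginal tail at `a n k * (x / 2)` is an upper bound; the half turns
    -- `≤` into `<`.
    refine ⟨v k * (x / 2) ^ (-α k) + 1, ?_⟩
    filter_upwards [(hlim k (x / 2) (by positivity)).eventually_le_const (lt_add_one _)] with n hn
    refine le_trans (mul_le_mul_of_nonneg_left (measureReal_mono ?_) (Nat.cast_nonneg _)) hn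
    intro ω hω
    have hω : A n * x ≤ X 0 ω k := hω
    have h1 := haA n k
    have h2 := ha n k
    show a n k * (x / 2) < X 0 ω k
    nlinarith
  have hbox : ∀ (J : ℕ) (s : Fin d × Fin J → ℝ), (∀ i, 0 < s i) →
      ∀ I : Finset (Fin d × Fin J), ∃ c,
      Tendsto (fun n : ℕ => (n : ℝ) * μ.real (⋃ i ∈ I, {ω | A n * s i ≤ X 0 ω i.1}))
        atTop (𝓝 c) := by
    intro J s hs I
    exact tendsto_measure_exceedances (μ' := (G : Measure (Fin d → ℝ))) (hmeas 0) hindep hident hA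
      hW hWnull hbd (ι := Fin d × Fin J) Prod.fst s hs I
  set Y : Ω → ℝ := fun ω => ∑ k, θ k * X 0 ω k with hYdef
  have hYm : Measurable Y := Finset.measurable_sum _ fun k _ => (hmk 0 k).const_mul (θ k)
  have : IsProbabilityMeasure (μ.map Y) := Measure.isProbabilityMeasure_map hYm.aemeasurable
  set F := cdf (μ.map Y) with hF
  have hFx : ∀ x, F x = μ.real {ω | Y ω ≤ x} := fun x => by
    rw [hF, cdf_eq_real, map_measureReal_apply hYm measurableSet_Iic]; rfl
  have hFc : ∀ x, 1 - F x = μ.real {ω | x < Y ω} := fun x => by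
    rw [hFx, ← probReal_compl_eq_one_sub (measurableSet_le hYm measurable_const)]
    congr 1
    ext ω
    simp
  have hF0 : ∀ x, 0 ≤ F x := cdf_nonneg _
  have hF1 : ∀ x, F x ≤ 1 := cdf_le_one _
  have hres : ∃ α, 0 < α ∧ RegVar (fun t => 1 - F t) (-α) := by
    refine regVar_of_sandwich (monotone_cdf _) hF0 hF1 (tendsto_cdf_atTop _) hA ?_ ?_ ?_
    · intro y y' hy hyy
      obtain ⟨p, c, hp, hpb⟩ := exists_sandwich_linear_combination (hmeas 0) hnonneg hA hbox hθ hy hyy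
      exact ⟨p, c, hp, fun n => by rw [hFc, hFc]; exact hpb n⟩
    · intro ε hε
      set S := ∑ k, θ k
      have : Nonempty (Fin d) := ⟨⟨0, hd⟩⟩
      have hS : 0 < S := Finset.sum_pos (fun k _ => hθ k) Finset.univ_nonempty
      have h1 : Tendsto (fun y : ℝ => ∑ k, v k * (y / S) ^ (-α k)) atTop (𝓝 (∑ _k : Fin d, 0)) := by
        refine tendsto_finsetSum _ fun k _ => ?_
        have := ((tendsto_rpow_neg_atTop (hα k)).comp (tendsto_id.atTop_div_const hS)).const_mul (v k)
        simpa using this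
      rw [Finset.sum_const_zero] at h1
      obtain ⟨y, hy0, hy⟩ := ((eventually_gt_atTop 0).and (h1.eventually_lt_const hε)).exists
      refine ⟨y, hy0, ?_⟩
      have h2 : Tendsto (fun n : ℕ => ∑ k, (n : ℝ) * μ.real {ω | a n k * (y / S) < X 0 ω k}) atTop
          (𝓝 (∑ k, v k * (y / S) ^ (-α k))) :=
        tendsto_finsetSum _ fun k _ => hlim k (y / S) (by positivity)
      filter_upwards [h2.eventually_lt_const hy] with n hn
      have h3 : μ.real {ω | A n * y < Y ω} ≤ ∑ k, μ.real {ω | a n k * (y / S) < X 0 ω k} := by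
        refine le_trans (measureReal_mono (fun ω hω => ?_)) (measureReal_iUnion_fintype_le _)
        have hω : A n * y < Y ω := hω
        by_contra hcon
        simp only [Set.mem_iUnion, Set.mem_ofPred_eq, not_exists, not_lt] at hcon
        have h4 : Y ω ≤ ∑ k, θ k * (A n * (y / S)) := by
          refine Finset.sum_le_sum fun k _ => mul_le_mul_of_nonneg_left ?_ (hθ k).le
          exact (hcon k).trans (mul_le_mul_of_nonneg_right (haA n k) (by positivity))
        rw [← Finset.sum_mul] at h4
        change Y ω ≤ S * _ at h4
        have h5 : S * (A n * (y / S)) = A n * y := by field_simp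
        linarith
      have hFn := hFc (A n * y)
      -- Bernoulli's inequality turns the union bound on the tail into a lower bound for the law of
      -- the maximum.
      have h4 : 1 + (n : ℝ) * -(1 - F (A n * y)) ≤ (1 + -(1 - F (A n * y))) ^ n :=
        one_add_mul_le_pow (by linarith [hF0 (A n * y)]) n
      have h5 : 1 + -(1 - F (A n * y)) = F (A n * y) := by ring
      rw [h5] at h4
      rw [← Finset.mul_sum] at hn
      have := mul_le_mul_of_nonneg_left h3 (Nat.cast_nonneg (α := ℝ) n)
      rw [← hFn] at this
      linarith
    · intro y hy
      -- Once `a n k₀ > b k₀ / 2 * A n`, an exceedance of `a n k₀ * z` by coordinate `k₀` alone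
      -- pushes the combination above `A n * y`.
      set z := 2 * y / (b k₀ * θ k₀)
      have hz : 0 < z := div_pos (by linarith) (mul_pos hk₀ (hθ k₀))
      have h1 := tendsto_one_sub_pow (hlim k₀ z hz)
      have hlt : Real.exp (-(v k₀ * z ^ (-α k₀))) < 1 := by
        rw [Real.exp_lt_one_iff, neg_lt_zero]
        exact mul_pos (hv k₀) (Real.rpow_pos_of_pos hz _)
      obtain ⟨g, hg1, hg2⟩ := exists_between hlt
      refine ⟨g, hg2, ?_⟩
      filter_upwards [h1.eventually_lt_const hg1, (hbk k₀).eventually_const_lt (half_lt_self hk₀)]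
        with n hn1 hn2
      refine le_trans (pow_le_pow_left₀ (hF0 _) ?_ n) hn1.le
      have h2 : μ.real {ω | a n k₀ * z < X 0 ω k₀} ≤ μ.real {ω | A n * y < Y ω} := by
        refine ENNReal.toReal_mono (measure_ne_top _ _) (measure_mono_ae ?_)
        filter_upwards [hnonneg] with ω hω hlt
        have hlt : a n k₀ * z < X 0 ω k₀ := hlt
        show A n * y < Y ω
        rw [lt_div_iff₀ (hA n)] at hn2
        have e1 : A n * y < θ k₀ * (a n k₀ * z) := by
          have : θ k₀ * (a n k₀ * z) = a n k₀ * (2 * y / b k₀) := by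
            have := (hθ k₀).ne'
            simp only [z]
            field_simp
          rw [this]
          have e2 := mul_lt_mul_of_pos_right hn2 (show 0 < 2 * y / b k₀ by positivity)
          have e3 : b k₀ / 2 * A n * (2 * y / b k₀) = A n * y := by field_simp
          linarith
        calc A n * y < θ k₀ * (a n k₀ * z) := e1
          _ ≤ θ k₀ * X 0 ω k₀ := mul_le_mul_of_nonneg_left hlt.le (hθ k₀).le
          _ ≤ Y ω := Finset.single_le_sum (f := fun k => θ k * X 0 ω k)
            (fun k _ => mul_nonneg (hθ k).le (hω k)) (Finset.mem_univ k₀)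
      rw [← hFc] at h2
      linarith
  obtain ⟨α', hα', hreg⟩ := hres
  refine ⟨α', hα', ?_⟩
  simpa only [hFc] using hreg

end Sum

/-! ### The loss function preserves regular variation. -/

lemma eventually_div_rpow_lt {f : ℝ → ℝ} {u₀ ρ m M : ℝ} (hρ : 0 ≤ ρ)
    (hf : ∀ u, u₀ < u → DifferentiableAt ℝ f u)
    (hd : ∀ᶠ u in atTop, deriv f u ≤ m * u ^ ρ) (hM : m / (ρ + 1) < M) :
    ∀ᶠ u in atTop, f u / u ^ (ρ + 1) < M := by
  obtain ⟨u₁, hu₁⟩ := eventually_atTop.mp hd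
  set w := max (max (u₀ + 1) u₁) 1
  have hw1 : u₀ < w := lt_of_lt_of_le (lt_add_one _) ((le_max_left _ _).trans (le_max_left _ _))
  have hw2 : u₁ ≤ w := (le_max_right _ _).trans (le_max_left _ _)
  have hw3 : 0 < w := lt_of_lt_of_le one_pos (le_max_right _ _)
  have hρ1 : 0 < ρ + 1 := by linarith
  have hder : ∀ u, w ≤ u → HasDerivAt (fun u => f u - m / (ρ + 1) * u ^ (ρ + 1))
      (deriv f u - m * u ^ ρ) u := by
    intro u hu
    have h1 := (hf u (hw1.trans_le hu)).hasDerivAt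
    have h2 := (Real.hasDerivAt_rpow_const (x := u) (p := ρ + 1)
      (Or.inl (hw3.trans_le hu).ne')).const_mul (m / (ρ + 1))
    refine (h1.sub h2).congr_deriv ?_
    rw [add_sub_cancel_right]
    field_simp
  -- Beyond `w` the derivative bound makes `f u - m / (ρ + 1) * u ^ (ρ + 1)` decrease, so it stays
  -- below its value `D` at `w`, which is negligible against `u ^ (ρ + 1)`. Applied to `ℓ` and to
  -- `-ℓ`, this yields both sides of the asymptotics.
  have hanti : AntitoneOn (fun u => f u - m / (ρ + 1) * u ^ (ρ + 1)) (Set.Ici w) := by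
    refine antitoneOn_of_deriv_nonpos (convex_Ici w)
      (fun u hu => (hder u hu).continuousAt.continuousWithinAt)
      (fun u hu => (hder u (interior_subset hu)).differentiableAt.differentiableWithinAt)
      fun u hu => ?_
    have hu' : w ≤ u := interior_subset hu
    rw [(hder u hu').deriv]
    linarith [hu₁ u (hw2.trans hu')]
  set D := f w - m / (ρ + 1) * w ^ (ρ + 1)
  have hlim : Tendsto (fun u : ℝ => D / u ^ (ρ + 1) + m / (ρ + 1)) atTop (𝓝 (0 + m / (ρ + 1))) :=
    (tendsto_const_nhds.div_atTop (tendsto_rpow_atTop hρ1)).add_const _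
  rw [zero_add] at hlim
  filter_upwards [hlim.eventually_lt_const hM, eventually_ge_atTop w] with u h1 h2
  refine lt_of_le_of_lt ?_ h1
  have h3 : f u - m / (ρ + 1) * u ^ (ρ + 1) ≤ D :=
    hanti (Set.mem_Ici.mpr le_rfl) (Set.mem_Ici.mpr h2) h2
  have h4 : 0 < u ^ (ρ + 1) := Real.rpow_pos_of_pos (hw3.trans_le h2) _
  rw [div_le_iff₀ h4, add_mul, div_mul_cancel₀ _ h4.ne']
  linarith

/-- A regular loss function is asymptotic to a power. -/
lemma RegularLoss.tendsto_div_rpow {ℓ : ℝ → ℝ} (h : RegularLoss ℓ) :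
    ∃ m κ : ℝ, 0 < m ∧ 0 < κ ∧ Tendsto (fun u => ℓ u / u ^ m) atTop (𝓝 κ) := by
  obtain ⟨u₀, -, hdiff⟩ := h.differentiable
  obtain ⟨ρ, c₁, hρ, hc₁, hlim⟩ := h.deriv_asymp
  have hρ1 : 0 < ρ + 1 := by linarith
  refine ⟨ρ + 1, c₁ / (ρ + 1), hρ1, by positivity, ?_⟩
  rw [tendsto_order]
  constructor
  · intro M hM
    rw [lt_div_iff₀ hρ1] at hM
    obtain ⟨m, hm1, hm2⟩ := exists_between hM
    have h1 := eventually_div_rpow_lt (f := fun u => -ℓ u) (m := -m) (M := -M) hρ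
      (fun u hu => (hdiff u hu).neg) (by
        filter_upwards [hlim.eventually_const_lt hm2, eventually_gt_atTop 0] with u hu hu0
        rw [lt_div_iff₀ (Real.rpow_pos_of_pos hu0 _)] at hu
        have : deriv (fun u => -ℓ u) u = -deriv ℓ u := deriv.fun_neg
        rw [this]
        linarith) (by rw [div_lt_iff₀ hρ1]; linarith)
    filter_upwards [h1] with u hu
    rw [neg_div] at hu
    linarith
  · intro M hM
    rw [gt_iff_lt, div_lt_iff₀ hρ1] at hM
    obtain ⟨m, hm1, hm2⟩ := exists_between hM
    exact eventually_div_rpow_lt (m := m) hρ hdiff (by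
      filter_upwards [hlim.eventually_lt_const hm1, eventually_gt_atTop 0] with u hu hu0
      rw [div_lt_iff₀ (Real.rpow_pos_of_pos hu0 _)] at hu
      exact hu.le) (by rw [div_lt_iff₀ hρ1]; linarith)

/-- This is what polynomial growth is for: a large loss can only come from a large argument, where
the asymptotics hold. -/
lemma RegularLoss.bounded {ℓ : ℝ → ℝ} (h : RegularLoss ℓ) (B : ℝ) :
    ∃ D, ∀ u, 0 ≤ u → u ≤ B → ℓ u ≤ D := by
  obtain ⟨K, p, hK⟩ := h.growth
  refine ⟨max K 0 * (1 + B ^ p), fun u h0 hB => (hK u h0).trans ?_⟩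
  have h1 : u ^ p ≤ B ^ p := pow_le_pow_left₀ h0 hB p
  have h2 : 0 ≤ u ^ p := pow_nonneg h0 p
  calc K * (1 + u ^ p) ≤ max K 0 * (1 + u ^ p) :=
        mul_le_mul_of_nonneg_right (le_max_left _ _) (by linarith)
    _ ≤ _ := mul_le_mul_of_nonneg_left (by linarith) (le_max_right _ _)

/-- Regular losses of random variables with regularly varying tails have regularly varying
tails. -/
theorem RegularLoss.regVar {ℓ : ℝ → ℝ} (h : RegularLoss ℓ) {Ω : Type*} [MeasurableSpace Ω]
    {μ : Measure Ω} [IsProbabilityMeasure μ] {Y : Ω → ℝ} (hY : ∀ᵐ ω ∂μ, 0 ≤ Y ω) {α : ℝ}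
    (hα : 0 < α) (hreg : RegVar (fun t => μ.real {ω | t < Y ω}) (-α)) :
    ∃ α', 0 < α' ∧ RegVar (fun t => μ.real {ω | t < ℓ (Y ω)}) (-α') := by
  obtain ⟨m, κ, hm, hκ, hlim⟩ := h.tendsto_div_rpow
  set U := fun t => μ.real {ω | t < Y ω}
  set V := fun t => μ.real {ω | t < ℓ (Y ω)}
  -- The inverse of `u ↦ κ * u ^ m`. The tail of the loss at `t` is squeezed between the tails of
  -- `Y` at `q t * y` for fixed `y` on the two sides of `1`; the gap absorbs the error in the
  -- asymptotics of `ℓ`.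
  set q : ℝ → ℝ := fun t => (t / κ) ^ m⁻¹
  have hq : Tendsto q atTop atTop :=
    (tendsto_rpow_atTop (inv_pos.mpr hm)).comp (tendsto_id.atTop_div_const hκ)
  have hqm : ∀ t, 0 ≤ t → q t ^ m = t / κ := fun t ht =>
    Real.rpow_inv_rpow (by positivity) hm.ne'
  have hupper : ∀ y, 0 < y → y < 1 → ∀ᶠ t in atTop, V t ≤ U (q t * y) := by
    intro y hy hy1
    have h1 : κ < κ * y ^ (-m) := by
      have := Real.one_lt_rpow_of_pos_of_lt_one_of_neg hy hy1 (neg_lt_zero.mpr hm)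
      nlinarith
    obtain ⟨B, hB⟩ := eventually_atTop.mp (hlim.eventually_lt_const h1)
    obtain ⟨D, hD⟩ := h.bounded (max B 1)
    filter_upwards [eventually_ge_atTop D, eventually_ge_atTop 0] with t ht ht0
    refine ENNReal.toReal_mono (measure_ne_top _ _) (measure_mono_ae ?_)
    filter_upwards [hY] with ω hω hlt
    have hlt : t < ℓ (Y ω) := hlt
    show q t * y < Y ω
    have h2 : max B 1 < Y ω := by
      by_contra! hcon
      linarith [hD _ hω hcon]
    have h3 : 0 < Y ω := (lt_max_of_lt_right one_pos).trans h2
    have h4 := hB (Y ω) ((le_max_left _ _).trans h2.le)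
    rw [div_lt_iff₀ (Real.rpow_pos_of_pos h3 _)] at h4
    have h5 : (q t * y) ^ m < Y ω ^ m := by
      rw [Real.mul_rpow (by positivity) hy.le, hqm t ht0, div_mul_eq_mul_div, div_lt_iff₀ hκ]
      rw [Real.rpow_neg hy.le] at h4
      have h6 : 0 < y ^ m := Real.rpow_pos_of_pos hy _
      have h7 : κ * (y ^ m)⁻¹ * Y ω ^ m * y ^ m = Y ω ^ m * κ := by field_simp
      nlinarith [hlt.trans h4]
    exact (Real.rpow_lt_rpow_iff (by positivity) h3.le hm).mp h5
  have hlower : ∀ y, 1 < y → ∀ᶠ t in atTop, U (q t * y) ≤ V t := by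
    intro y hy1
    have hy : 0 < y := by linarith
    have h1 : κ * y ^ (-m) < κ := by
      have := Real.rpow_lt_one_of_one_lt_of_neg hy1 (neg_lt_zero.mpr hm)
      nlinarith
    obtain ⟨B, hB⟩ := eventually_atTop.mp (hlim.eventually_const_lt h1)
    filter_upwards [hq.eventually_ge_atTop (max B 1), eventually_ge_atTop 0] with t ht ht0
    refine measureReal_mono fun ω hlt => ?_
    have hlt : q t * y < Y ω := hlt
    show t < ℓ (Y ω)
    have hq0 : 1 ≤ q t := (le_max_right _ _).trans ht
    have h2 : q t ≤ Y ω := by nlinarith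
    have h3 : 0 < Y ω := by linarith
    have h4 := hB (Y ω) ((le_max_left _ _).trans (ht.trans h2))
    rw [lt_div_iff₀ (Real.rpow_pos_of_pos h3 _)] at h4
    have h5 : (q t * y) ^ m < Y ω ^ m := Real.rpow_lt_rpow (by positivity) hlt hm
    rw [Real.mul_rpow (by positivity) hy.le, hqm t ht0, div_mul_eq_mul_div, div_lt_iff₀ hκ] at h5
    rw [Real.rpow_neg hy.le] at h4
    have h6 : 0 < y ^ m := Real.rpow_pos_of_pos hy _
    have h7 : κ * (y ^ m)⁻¹ * Y ω ^ m * y ^ m = Y ω ^ m * κ := by field_simp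
    have h8 : t * y ^ m < ℓ (Y ω) * y ^ m := by nlinarith
    exact lt_of_mul_lt_mul_right h8 h6.le
  have hVanti : Antitone V := fun s t hst =>
    measureReal_mono fun ω (hω : t < ℓ (Y ω)) => lt_of_le_of_lt hst hω
  have hVpos : ∀ t, 0 < V t := by
    intro t
    obtain ⟨s, hs1, hs2⟩ := ((hlower 2 one_lt_two).and (eventually_ge_atTop t)).exists
    exact ((hreg.pos _).trans_le hs1).trans_le (hVanti hs2)
  have hUV : Tendsto (fun t => V t / U (q t)) atTop (𝓝 1) := by
    have hcont : ContinuousAt (fun y : ℝ => y ^ (-α)) 1 :=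
      Real.continuousAt_rpow_const _ _ (Or.inl one_ne_zero)
    have h1 : (1 : ℝ) ^ (-α) = 1 := Real.one_rpow _
    rw [tendsto_order]
    constructor
    · intro c hc
      rw [← h1] at hc
      obtain ⟨y, hy1, hy2⟩ : ∃ y, c < y ^ (-α) ∧ 1 < y := by
        have := (hcont.eventually_const_lt hc).filter_mono (nhdsWithin_le_nhds (s := Set.Ioi 1))
        exact (this.and self_mem_nhdsWithin).exists
      filter_upwards [hlower y hy2, ((hreg.ratio y (by linarith)).comp hq).eventually_const_lt hy1]
        with t h2 h3
      exact h3.trans_le (div_le_div_of_nonneg_right h2 (hreg.pos _).le)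
    · intro c hc
      rw [← h1] at hc
      obtain ⟨y, ⟨hy1, hy⟩, hy2⟩ : ∃ y, (y ^ (-α) < c ∧ 0 < y) ∧ y < 1 := by
        have := ((hcont.eventually_lt_const hc).and (eventually_gt_nhds one_pos)).filter_mono
          (nhdsWithin_le_nhds (s := Set.Iio 1))
        exact (this.and self_mem_nhdsWithin).exists
      filter_upwards [hupper y hy hy2, ((hreg.ratio y hy).comp hq).eventually_lt_const hy1]
        with t h2 h3
      exact lt_of_le_of_lt (div_le_div_of_nonneg_right h2 (hreg.pos _).le) h3
  refine ⟨m⁻¹ * α, by positivity, hVanti, hVpos, fun x hx => ?_⟩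
  have h1 : Tendsto (fun t => V (t * x) / U (q (t * x))) atTop (𝓝 1) :=
    hUV.comp (tendsto_id.atTop_mul_const hx)
  have h2 : Tendsto (fun t => U (q (t * x)) / U (q t)) atTop (𝓝 ((x ^ m⁻¹) ^ (-α))) := by
    refine hreg.tendsto_comp hq (Real.rpow_pos_of_pos hx _) ?_
    refine tendsto_const_nhds.congr' ?_
    filter_upwards [eventually_gt_atTop 0] with t ht
    have h3 : 0 < q t := Real.rpow_pos_of_pos (by positivity) _
    rw [eq_div_iff h3.ne']
    simp only [q]
    rw [mul_div_right_comm, Real.mul_rpow (by positivity) hx.le, mul_comm]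
  have h3 := (h1.mul h2).div hUV one_ne_zero
  rw [one_mul, div_one, ← Real.rpow_mul hx.le, mul_neg] at h3
  refine h3.congr fun t => ?_
  have e1 := (hreg.pos (q t)).ne'
  have e2 := (hreg.pos (q (t * x))).ne'
  have e3 := (hVpos t).ne'
  simp only [Pi.div_apply]
  change V (t * x) / U (q (t * x)) * (U (q (t * x)) / U (q t)) / (V t / U (q t)) = _
  change U (q t) ≠ 0 at e1
  change U (q (t * x)) ≠ 0 at e2
  field_simp

/-! ### Logarithmic excesses. -/

/-- A Potter bound. -/
lemma RegVar.potter {U : ℝ → ℝ} {b b' : ℝ} (h : RegVar U b) (hb : b < b') (hb' : b' ≤ 0) :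
    ∃ C t₀ : ℝ, 0 < C ∧ 0 < t₀ ∧ ∀ t, t₀ ≤ t → ∀ x, 1 ≤ x → U (t * x) ≤ C * x ^ b' * U t := by
  have h2 : (2 : ℝ) ^ b < 2 ^ b' := Real.rpow_lt_rpow_of_exponent_lt one_lt_two hb
  obtain ⟨t₁, ht₁⟩ := eventually_atTop.mp ((h.ratio 2 two_pos).eventually_lt_const h2)
  -- Each doubling beyond `t₁` gains the factor `2 ^ b'`. Passing from a general `x` to the power of
  -- two just below it costs the constant `2 ^ (-b')`.
  have hstep : ∀ t, max t₁ 1 ≤ t → ∀ j : ℕ, U (t * 2 ^ j) ≤ ((2 : ℝ) ^ j) ^ b' * U t := by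
    intro t ht j
    induction j with
    | zero => simp
    | succ j ih =>
      have ht1 : 1 ≤ t := (le_max_right _ _).trans ht
      have hp : (1 : ℝ) ≤ 2 ^ j := one_le_pow₀ one_le_two
      have h3 := ht₁ (t * 2 ^ j) (((le_max_left _ _).trans ht).trans (by nlinarith))
      rw [div_lt_iff₀ (h.pos _)] at h3
      rw [pow_succ, ← mul_assoc, Real.mul_rpow (by positivity) two_pos.le]
      have h4 : 0 < (2 : ℝ) ^ b' := by positivity
      nlinarith
  refine ⟨2 ^ (-b'), max t₁ 1, by positivity, lt_max_of_lt_right one_pos, fun t ht x hx => ?_⟩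
  have ht1 : 1 ≤ t := (le_max_right _ _).trans ht
  obtain ⟨j, hj1, hj2⟩ := exists_nat_pow_near hx one_lt_two
  have hx0 : 0 < x := by linarith
  calc U (t * x) ≤ U (t * 2 ^ j) := h.anti (mul_le_mul_of_nonneg_left hj1 (by linarith))
    _ ≤ ((2 : ℝ) ^ j) ^ b' * U t := hstep t ht j
    _ ≤ (x / 2) ^ b' * U t := by
      refine mul_le_mul_of_nonneg_right ?_ (h.pos t).le
      refine Real.rpow_le_rpow_of_nonpos (by positivity) ?_ hb'
      rw [div_le_iff₀ two_pos, ← pow_succ]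
      exact hj2.le
    _ = 2 ^ (-b') * x ^ b' * U t := by
      rw [Real.div_rpow hx0.le two_pos.le, Real.rpow_neg two_pos.le]
      ring

section

variable {Ω : Type*} [MeasurableSpace Ω] {μ : Measure Ω} {L : Ω → ℝ}

lemma lt_max_log_iff {x v t : ℝ} (hx : 0 ≤ x) (hv : 0 < v) (ht : 0 ≤ t) :
    t < max (Real.log (x / v)) 0 ↔ v * Real.exp t < x := by
  rw [lt_max_iff, or_iff_left (not_lt.mpr ht)]
  rcases hx.eq_or_lt with rfl | hx
  -- Since `Real.log 0 = 0`, a zero observation has no positive logarithmic excess, as it should.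
  · simp only [zero_div, Real.log_zero, not_lt.mpr ht, false_iff, not_lt]
    positivity
  · rw [Real.lt_log_iff_exp_lt (by positivity), lt_div_iff₀ hv, mul_comm]

lemma max_log_le_div {x v : ℝ} (hx : 0 ≤ x) (hv : 0 < v) :
    max (Real.log (x / v)) 0 ≤ x / v :=
  max_le (Real.log_le_self (by positivity)) (by positivity)

lemma integrable_max_log (hL : Measurable L) (hL0 : ∀ ω, 0 ≤ L ω) (hLint : Integrable L μ)
    {v : ℝ} (hv : 0 < v) : Integrable (fun ω => max (Real.log (L ω / v)) 0) μ := by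
  refine (hLint.div_const v).mono' ?_ (ae_of_all _ fun ω => ?_)
  · exact ((Real.measurable_log.comp (hL.div_const v)).max measurable_const).aestronglyMeasurable
  · rw [Real.norm_of_nonneg (le_max_right _ _)]
    exact max_log_le_div (hL0 ω) hv

/-- Karamata's theorem for the mean of the logarithmic excess. -/
lemma tendsto_integral_max_log (hL : Measurable L) (hL0 : ∀ ω, 0 ≤ L ω) (hLint : Integrable L μ)
    {α : ℝ} (hα : 0 < α) (hreg : RegVar (fun t => μ.real {ω | t < L ω}) (-α)) :
    Tendsto (fun v => (∫ ω, max (Real.log (L ω / v)) 0 ∂μ) / μ.real {ω | v < L ω}) atTop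
      (𝓝 α⁻¹) := by
  set U := fun t => μ.real {ω | t < L ω}
  obtain ⟨C, t₀, hC, ht₀, hpot⟩ := hreg.potter (b' := -(α / 2)) (by linarith) (by linarith)
  -- By the layer-cake formula, the mean divided by `U v` is the integral of `U (v * exp t) / U v`.
  -- This tends to `exp (-α t)`, whose integral is `1/α`; the Potter bound with exponent `-α/2`
  -- dominates.
  have hrep : ∀ v, 0 < v → ∫ ω, max (Real.log (L ω / v)) 0 ∂μ
      = ∫ t in Set.Ioi 0, U (v * Real.exp t) := by
    intro v hv
    rw [(integrable_max_log hL hL0 hLint hv).integral_eq_integral_meas_lt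
      (ae_of_all _ fun ω => le_max_right _ _)]
    refine setIntegral_congr_fun measurableSet_Ioi fun t ht => ?_
    simp only [U]
    congr 1
    ext ω
    exact lt_max_log_iff (hL0 ω) hv (le_of_lt ht)
  have hlim : Tendsto (fun v => ∫ t in Set.Ioi 0, U (v * Real.exp t) / U v) atTop
      (𝓝 (∫ t in Set.Ioi 0, Real.exp (-α * t))) := by
    refine tendsto_integral_filter_of_dominated_convergence
      (fun t => C * Real.exp (-(α / 2) * t)) ?_ ?_ ?_ ?_
    · filter_upwards [eventually_gt_atTop 0] with v hv
      have hm : Measurable fun t => U (v * Real.exp t) := by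
        have : Antitone fun t => U (v * Real.exp t) := fun s t hst =>
          hreg.anti (mul_le_mul_of_nonneg_left (Real.exp_le_exp.mpr hst) hv.le)
        exact this.measurable
      exact (hm.div_const _).aestronglyMeasurable
    · filter_upwards [eventually_ge_atTop t₀] with v hv
      filter_upwards [ae_restrict_mem measurableSet_Ioi] with t ht
      have ht : 0 < t := ht
      have hUv : 0 < U v := hreg.pos v
      rw [Real.norm_of_nonneg (div_nonneg measureReal_nonneg hUv.le), div_le_iff₀ hUv]
      have := hpot v hv (Real.exp t) (Real.one_le_exp ht.le)
      rwa [← Real.exp_mul, mul_comm t] at this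
    · exact (integrableOn_exp_mul_Ioi (by linarith) 0).const_mul C
    · refine ae_of_all _ fun t => ?_
      have := hreg.ratio (Real.exp t) (Real.exp_pos t)
      rwa [← Real.exp_mul, mul_comm t] at this
  rw [integral_exp_mul_Ioi (by linarith)] at hlim
  have hval : -Real.exp (-α * 0) / -α = α⁻¹ := by
    rw [mul_zero, Real.exp_zero, neg_div_neg_eq, one_div]
  rw [hval] at hlim
  refine hlim.congr' ?_
  filter_upwards [eventually_gt_atTop 0] with v hv
  rw [integral_div, hrep v hv]

/-- The second moment of the logarithmic excess is of the order of the tail. -/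
lemma exists_sq_max_log_le [IsFiniteMeasure μ] (hL : Measurable L) (hL0 : ∀ ω, 0 ≤ L ω)
    {α : ℝ} (hα : 0 < α) (hreg : RegVar (fun t => μ.real {ω | t < L ω}) (-α)) :
    ∃ K, 0 ≤ K ∧ ∀ᶠ v in atTop, MemLp (fun ω => max (Real.log (L ω / v)) 0) 2 μ ∧
      ∫ ω, max (Real.log (L ω / v)) 0 ^ 2 ∂μ ≤ K * μ.real {ω | v < L ω} := by
  set U := fun t => μ.real {ω | t < L ω}
  obtain ⟨C, t₀, hC, ht₀, hpot⟩ := hreg.potter (b' := -(α / 2)) (by linarith) (by linarith)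
  -- Half of the Potter decay `exp (-(α/2) t)` is spent on the factor `t` of the second moment,
  -- through `t ≤ 4/α * exp (α/4 * t)`; the other half remains integrable.
  set I := ∫⁻ t in Set.Ioi (0 : ℝ), ENNReal.ofReal (Real.exp (-(α / 4) * t))
  have hI : I < ⊤ := (integrableOn_exp_mul_Ioi (a := -(α / 4)) (by linarith) 0).lintegral_lt_top
  refine ⟨2 * (4 * C / α) * I.toReal, by positivity, ?_⟩
  filter_upwards [eventually_ge_atTop t₀] with v hv
  have hv0 : 0 < v := ht₀.trans_le hv
  set W := fun ω => max (Real.log (L ω / v)) 0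
  have hWm : Measurable W := (Real.measurable_log.comp (hL.div_const v)).max measurable_const
  have hUv : 0 < U v := hreg.pos v
  have hbound : ∫⁻ ω, ENNReal.ofReal (W ω ^ 2) ∂μ
      ≤ ENNReal.ofReal (2 * (4 * C / α) * I.toReal * U v) := by
    have h1 := lintegral_rpow_eq_lintegral_meas_lt_mul μ (f := W)
      (ae_of_all _ fun ω => le_max_right _ _) hWm.aemeasurable (p := 2) two_pos
    simp only [Real.rpow_two] at h1
    rw [h1]
    have h2 : ∀ t ∈ Set.Ioi (0 : ℝ), μ {ω | t < W ω} * ENNReal.ofReal (t ^ ((2 : ℝ) - 1))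
        ≤ ENNReal.ofReal (4 * C / α * U v) * ENNReal.ofReal (Real.exp (-(α / 4) * t)) := by
      intro t ht
      have ht : 0 < t := ht
      have hset : {ω | t < W ω} = {ω | v * Real.exp t < L ω} := by
        ext ω
        exact lt_max_log_iff (hL0 ω) hv0 ht.le
      rw [hset, ← ofReal_measureReal, ← ENNReal.ofReal_mul measureReal_nonneg,
        ← ENNReal.ofReal_mul (by positivity)]
      refine ENNReal.ofReal_le_ofReal ?_
      have h3 := hpot v hv (Real.exp t) (Real.one_le_exp ht.le)
      rw [← Real.exp_mul, mul_comm t] at h3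
      have h4 : t ^ ((2 : ℝ) - 1) = t := by norm_num
      have h5 : t ≤ 4 / α * Real.exp (α / 4 * t) := by
        have := Real.add_one_le_exp (α / 4 * t)
        rw [div_mul_eq_mul_div, le_div_iff₀ hα]
        linarith
      have h6 : Real.exp (-(α / 2) * t) * Real.exp (α / 4 * t) = Real.exp (-(α / 4) * t) := by
        rw [← Real.exp_add]
        congr 1
        ring
      rw [h4]
      calc U (v * Real.exp t) * t
          ≤ (C * Real.exp (-(α / 2) * t) * U v) * (4 / α * Real.exp (α / 4 * t)) :=
            mul_le_mul h3 h5 ht.le (by positivity)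
        _ = 4 * C / α * U v * (Real.exp (-(α / 2) * t) * Real.exp (α / 4 * t)) := by ring
        _ = _ := by rw [h6]
    calc ENNReal.ofReal 2 * ∫⁻ t in Set.Ioi 0, μ {ω | t < W ω} * ENNReal.ofReal (t ^ ((2 : ℝ) - 1))
        ≤ ENNReal.ofReal 2 * ∫⁻ t in Set.Ioi (0 : ℝ),
          ENNReal.ofReal (4 * C / α * U v) * ENNReal.ofReal (Real.exp (-(α / 4) * t)) :=
          mul_le_mul_right (setLIntegral_mono' measurableSet_Ioi h2) _
      _ = ENNReal.ofReal 2 * (ENNReal.ofReal (4 * C / α * U v) * I) := by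
          rw [lintegral_const_mul _ (by fun_prop)]
      _ = _ := by
          rw [← ENNReal.ofReal_toReal hI.ne, ← ENNReal.ofReal_mul (by positivity),
            ← ENNReal.ofReal_mul (by positivity), ENNReal.toReal_ofReal (by positivity)]
          congr 1
          ring
  have hint : Integrable (fun ω => W ω ^ 2) μ := by
    refine ⟨(hWm.pow_const 2).aestronglyMeasurable, ?_⟩
    rw [hasFiniteIntegral_iff_ofReal (ae_of_all _ fun ω => sq_nonneg _)]
    exact hbound.trans_lt ENNReal.ofReal_lt_top
  refine ⟨(memLp_two_iff_integrable_sq hWm.aestronglyMeasurable).mpr hint, ?_⟩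
  rw [integral_eq_lintegral_of_nonneg_ae (ae_of_all _ fun ω => sq_nonneg _)
    (hWm.pow_const 2).aestronglyMeasurable]
  exact ENNReal.toReal_le_of_le_ofReal (by positivity) hbound

end

/-! ### Mean excess, value at risk and conditional value at risk. -/

section

variable {Ω : Type*} [MeasurableSpace Ω] {μ : Measure Ω} {L : Ω → ℝ}

lemma integral_excess_eq (hL0 : ∀ ω, 0 ≤ L ω) (hLint : Integrable L μ) {v : ℝ} (hv : 0 ≤ v) :
    ∫ ω, max (L ω - v) 0 ∂μ = ∫ u in Set.Ioi v, μ.real {ω | u < L ω} := by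
  have hint : Integrable (fun ω => max (L ω - v) 0) μ := by
    refine hLint.mono (((hLint.aestronglyMeasurable.sub aestronglyMeasurable_const)).sup
      aestronglyMeasurable_const) (ae_of_all _ fun ω => ?_)
    rw [Real.norm_of_nonneg (le_max_right _ _), Real.norm_of_nonneg (hL0 ω)]
    exact max_le (by linarith) (hL0 ω)
  rw [hint.integral_eq_integral_meas_lt (ae_of_all _ fun ω => le_max_right _ _)]
  have h1 := (measurePreserving_add_right volume v).setIntegral_preimage_emb
    (measurableEmbedding_addRight v) (fun u => μ.real {ω | u < L ω}) (Set.Ioi v)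
  rw [Set.preimage_add_const_Ioi, sub_self] at h1
  rw [← h1]
  refine setIntegral_congr_fun measurableSet_Ioi fun t ht => ?_
  have ht : 0 < t := ht
  congr 1
  ext ω
  simp only [Set.mem_ofPred_eq, lt_max_iff, not_lt.mpr ht.le, or_false, lt_sub_iff_add_lt]

lemma integrableOn_tail [IsFiniteMeasure μ] (hL0 : ∀ ω, 0 ≤ L ω) (hLint : Integrable L μ) {v : ℝ}
    (hv : 0 ≤ v) : IntegrableOn (fun u => μ.real {ω | u < L ω}) (Set.Ioi v) := by
  have hanti : Antitone fun u => μ.real {ω | u < L ω} := fun s t hst =>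
    measureReal_mono fun ω (hω : t < L ω) => lt_of_le_of_lt hst hω
  have h0 : IntegrableOn (fun u => μ.real {ω | u < L ω}) (Set.Ioi 0) := by
    refine ⟨hanti.measurable.aestronglyMeasurable, ?_⟩
    rw [hasFiniteIntegral_iff_ofReal (ae_of_all _ fun _ => measureReal_nonneg)]
    have h1 := lintegral_eq_lintegral_meas_lt μ (ae_of_all _ hL0) hLint.aemeasurable
    have h2 : ∀ u, ENNReal.ofReal (μ.real {ω | u < L ω}) = μ {ω | u < L ω} :=
      fun u => ofReal_measureReal
    simp only [h2]
    rw [← h1]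
    exact hLint.lintegral_lt_top
  exact h0.mono_set (Set.Ioi_subset_Ioi hv)

variable [IsProbabilityMeasure μ]

/-- Karamata's theorem for the mean excess. -/
lemma regVar_integral_excess (hL0 : ∀ ω, 0 ≤ L ω) (hLint : Integrable L μ) {b : ℝ}
    (hreg : RegVar (fun t => μ.real {ω | t < L ω}) b) :
    RegVar (fun v => ∫ ω, max (L ω - v) 0 ∂μ) (1 + b) := by
  set U := fun t => μ.real {ω | t < L ω}
  have hint : ∀ v : ℝ, Integrable (fun ω => max (L ω - v) 0) μ := fun v =>
    (hLint.sub (integrable_const v)).pos_part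
  have hpos : ∀ v, 0 < ∫ ω, max (L ω - v) 0 ∂μ := by
    intro v
    refine (integral_pos_iff_support_of_nonneg (fun ω => le_max_right _ _) (hint v)).mpr ?_
    refine lt_of_lt_of_le ?_ (measure_mono (s := {ω | v < L ω}) fun ω hω => ?_)
    · exact (ENNReal.toReal_pos_iff.mp (hreg.pos v)).1
    · have hω : v < L ω := hω
      rw [Function.mem_support]
      exact (lt_max_of_lt_left (sub_pos.mpr hω)).ne'
  refine ⟨fun s t hst => integral_mono (hint t) (hint s) fun ω =>
    max_le_max_right _ (by linarith), hpos, fun x hx => ?_⟩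
  -- The substitution `u ↦ x * u` gives both tail integrals the same domain, so bounds on `U (x * u)
  -- / U u` integrate directly. The Jacobian `x` accounts for the `1` in the index.
  have hrep : ∀ v, 0 < v → ∫ ω, max (L ω - v * x) 0 ∂μ = x * ∫ u in Set.Ioi v, U (x * u) := by
    intro v hv
    rw [integral_excess_eq hL0 hLint (by positivity)]
    have := integral_comp_mul_left_Ioi U v hx
    rw [this, smul_eq_mul, mul_inv_cancel_left₀ hx.ne', mul_comm v x]
  have hxU : ∀ v, 0 < v → IntegrableOn (fun u => U (x * u)) (Set.Ioi v) := by
    intro v hv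
    rw [integrableOn_Ioi_comp_mul_left_iff U v hx]
    exact integrableOn_tail hL0 hLint (by positivity)
  rw [Real.rpow_add hx, Real.rpow_one, tendsto_order]
  constructor
  · intro c hc
    have hc' : c / x < x ^ b := by rw [div_lt_iff₀ hx]; linarith
    obtain ⟨m, hm1, hm2⟩ := exists_between hc'
    obtain ⟨v₁, hv₁⟩ := eventually_atTop.mp ((hreg.ratio x hx).eventually_const_lt hm2)
    filter_upwards [eventually_gt_atTop v₁, eventually_gt_atTop 0] with v h1 h0
    have h2 : m * ∫ u in Set.Ioi v, U u ≤ ∫ u in Set.Ioi v, U (x * u) := by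
      rw [← integral_const_mul]
      refine setIntegral_mono_on ((integrableOn_tail hL0 hLint h0.le).const_mul m) (hxU v h0)
        measurableSet_Ioi fun u hu => ?_
      have hu : v < u := hu
      have h3 := hv₁ u (h1.trans hu).le
      rw [lt_div_iff₀ (hreg.pos u), mul_comm u x] at h3
      exact h3.le
    have h4 : 0 < ∫ u in Set.Ioi v, U u := by
      rw [← integral_excess_eq hL0 hLint h0.le]; exact hpos v
    rw [hrep v h0, lt_div_iff₀ (hpos v), integral_excess_eq hL0 hLint h0.le]
    rw [div_lt_iff₀ hx] at hm1
    calc c * ∫ u in Set.Ioi v, U u < (m * x) * ∫ u in Set.Ioi v, U u :=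
          mul_lt_mul_of_pos_right hm1 h4
      _ = x * (m * ∫ u in Set.Ioi v, U u) := by ring
      _ ≤ _ := mul_le_mul_of_nonneg_left h2 hx.le
  · intro c hc
    have hc' : x ^ b < c / x := by rw [lt_div_iff₀ hx]; linarith
    obtain ⟨m, hm1, hm2⟩ := exists_between hc'
    obtain ⟨v₁, hv₁⟩ := eventually_atTop.mp ((hreg.ratio x hx).eventually_lt_const hm1)
    filter_upwards [eventually_gt_atTop v₁, eventually_gt_atTop 0] with v h1 h0
    have h2 : ∫ u in Set.Ioi v, U (x * u) ≤ m * ∫ u in Set.Ioi v, U u := by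
      rw [← integral_const_mul]
      refine setIntegral_mono_on (hxU v h0) ((integrableOn_tail hL0 hLint h0.le).const_mul m)
        measurableSet_Ioi fun u hu => ?_
      have hu : v < u := hu
      have h3 := hv₁ u (h1.trans hu).le
      rw [div_lt_iff₀ (hreg.pos u), mul_comm u x] at h3
      exact h3.le
    have h4 : 0 < ∫ u in Set.Ioi v, U u := by
      rw [← integral_excess_eq hL0 hLint h0.le]; exact hpos v
    rw [hrep v h0, div_lt_iff₀ (hpos v), integral_excess_eq hL0 hLint h0.le]
    rw [lt_div_iff₀ hx] at hm2
    calc _ ≤ x * (m * ∫ u in Set.Ioi v, U u) := mul_le_mul_of_nonneg_left h2 hx.le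
      _ = (m * x) * ∫ u in Set.Ioi v, U u := by ring
      _ < c * ∫ u in Set.Ioi v, U u := mul_lt_mul_of_pos_right hm2 h4

/-- The defining inequalities of the value at risk. -/
lemma VaR_spec (hL : Measurable L) {β : ℝ} (h0 : 0 < β) (h1 : β < 1) :
    μ.real {ω | VaR μ L β < L ω} ≤ β ∧ ∀ u < VaR μ L β, β < μ.real {ω | u < L ω} := by
  have : IsProbabilityMeasure (μ.map L) := Measure.isProbabilityMeasure_map hL.aemeasurable
  have hF : ∀ u, cdf (μ.map L) u = μ.real {ω | L ω ≤ u} := fun u => by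
    rw [cdf_eq_real, map_measureReal_apply hL measurableSet_Iic]; rfl
  have hc : ∀ u, μ.real {ω | u < L ω} = 1 - cdf (μ.map L) u := fun u => by
    rw [hF, ← probReal_compl_eq_one_sub (measurableSet_le hL measurable_const)]
    congr 1
    ext ω
    simp
  set S := {u : ℝ | 1 - β ≤ μ.real {ω | L ω ≤ u}} with hS
  have hmem : ∀ u, u ∈ S ↔ 1 - β ≤ cdf (μ.map L) u := fun u => by rw [hF]; rfl
  have hne : S.Nonempty := by
    obtain ⟨u, hu⟩ := ((tendsto_cdf_atTop (μ.map L)).eventually_const_lt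
      (show 1 - β < 1 by linarith)).exists
    exact ⟨u, (hmem u).mpr hu.le⟩
  have hbdd : BddBelow S := by
    obtain ⟨u, hu⟩ := ((tendsto_cdf_atBot (μ.map L)).eventually_lt_const
      (show 0 < 1 - β by linarith)).exists
    refine ⟨u, fun s hs => ?_⟩
    by_contra! hlt
    have := (hmem s).mp hs
    linarith [monotone_cdf (μ.map L) hlt.le]
  change μ.real {ω | sInf S < L ω} ≤ β ∧ ∀ u < sInf S, _
  constructor
  · rw [hc]
    have h2 : Tendsto (cdf (μ.map L)) (𝓝[>] sInf S) (𝓝 (cdf (μ.map L) (sInf S))) :=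
      ((cdf (μ.map L)).right_continuous _).tendsto.mono_left
        (nhdsWithin_mono _ Set.Ioi_subset_Ici_self)
    have h3 : 1 - β ≤ cdf (μ.map L) (sInf S) := ge_of_tendsto h2 (by
      filter_upwards [self_mem_nhdsWithin] with u hu
      obtain ⟨s, hs, hsu⟩ := exists_lt_of_csInf_lt hne hu
      exact ((hmem s).mp hs).trans (monotone_cdf _ hsu.le))
    linarith
  · intro u hu
    have h2 : u ∉ S := notMem_of_lt_csInf (s := S) hu hbdd
    rw [hmem, not_le] at h2
    rw [hc]
    linarith

lemma tendsto_VaR (hL : Measurable L) {b : ℝ} (hreg : RegVar (fun t => μ.real {ω | t < L ω}) b) :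
    Tendsto (VaR μ L) (𝓝[>] 0) atTop := by
  rw [tendsto_atTop]
  intro B
  have hmin : 0 < min (μ.real {ω | B < L ω}) 1 := lt_min (hreg.pos B) one_pos
  filter_upwards [Ioo_mem_nhdsGT hmin] with β hβ
  by_contra! hlt
  have h1 := (VaR_spec (μ := μ) hL hβ.1 (hβ.2.trans_le (min_le_right _ _))).1
  have h2 : μ.real {ω | B < L ω} ≤ μ.real {ω | VaR μ L β < L ω} := hreg.anti hlt.le
  linarith [hβ.2.trans_le (min_le_left (μ.real {ω | B < L ω}) 1)]

/-- A function squeezed between the tail at `v` and at slightly smaller points is asymptotic to the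
tail. -/
lemma RegVar.tendsto_div_of_squeeze {U : ℝ → ℝ} {b : ℝ} (h : RegVar U b) {ι : Type*} {l : Filter ι}
    {v q : ι → ℝ} (hv : Tendsto v l atTop) (h1 : ∀ᶠ i in l, U (v i) ≤ q i)
    (h2 : ∀ y, y < 1 → ∀ᶠ i in l, q i ≤ U (v i * y)) :
    Tendsto (fun i => q i / U (v i)) l (𝓝 1) := by
  have hcont : ContinuousAt (fun y : ℝ => y ^ b) 1 :=
    Real.continuousAt_rpow_const _ _ (Or.inl one_ne_zero)
  rw [tendsto_order]
  constructor
  · intro c hc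
    filter_upwards [h1] with i hi
    exact hc.trans_le ((one_le_div (h.pos _)).mpr hi)
  · intro c hc
    rw [← Real.one_rpow b] at hc
    obtain ⟨y, ⟨hy1, hy⟩, hy2⟩ : ∃ y, (y ^ b < c ∧ 0 < y) ∧ y < 1 := by
      have := ((hcont.eventually_lt_const hc).and (eventually_gt_nhds one_pos)).filter_mono
        (nhdsWithin_le_nhds (s := Set.Iio 1))
      exact (this.and self_mem_nhdsWithin).exists
    filter_upwards [h2 y hy2, ((h.ratio y hy).comp hv).eventually_lt_const hy1] with i h3 h4
    exact lt_of_le_of_lt (div_le_div_of_nonneg_right h3 (h.pos _).le) h4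

/-- The distribution may jump at its quantile, so `β` is only known to lie between the tail at `v_β`
and the tail at any smaller point. Regular variation makes this gap relatively negligible. -/
lemma tendsto_level_div_tail (hL : Measurable L) {b : ℝ}
    (hreg : RegVar (fun t => μ.real {ω | t < L ω}) b) :
    Tendsto (fun β => β / μ.real {ω | VaR μ L β < L ω}) (𝓝[>] 0) (𝓝 1) := by
  have h01 : ∀ᶠ β : ℝ in 𝓝[>] 0, 0 < β ∧ β < 1 := Ioo_mem_nhdsGT one_pos
  refine hreg.tendsto_div_of_squeeze (q := fun β => β) (tendsto_VaR hL hreg)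
    (h01.mono fun β hβ => (VaR_spec hL hβ.1 hβ.2).1) fun y hy => ?_
  filter_upwards [h01, (tendsto_VaR hL hreg).eventually_gt_atTop 0] with β hβ hv
  exact ((VaR_spec hL hβ.1 hβ.2).2 _ (by nlinarith)).le

/-- Needed because `CVaR` conditions on `L ≥ v` whereas `RegVar` speaks of `L > v`. -/
lemma tendsto_weak_tail_div_tail {b : ℝ}
    (hreg : RegVar (fun t => μ.real {ω | t < L ω}) b) :
    Tendsto (fun v => μ.real {ω | v ≤ L ω} / μ.real {ω | v < L ω}) atTop (𝓝 1) := by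
  refine hreg.tendsto_div_of_squeeze (q := fun v => μ.real {ω | v ≤ L ω}) tendsto_id
    (Eventually.of_forall fun v => measureReal_mono fun ω (hω : v < L ω) => hω.le) fun y hy => ?_
  filter_upwards [eventually_gt_atTop 0] with v hv
  refine measureReal_mono fun ω (hω : v ≤ L ω) => ?_
  show v * y < L ω
  nlinarith

/-- On the conditioning event `L = v + (L - v)⁺`. The point is that both summands scale by the same
factor when the level changes. -/
lemma CVaR_eq (hL : Measurable L) (hLint : Integrable L μ) {β : ℝ}
    (hpos : 0 < μ.real {ω | VaR μ L β ≤ L ω}) :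
    CVaR μ L β = VaR μ L β +
      (∫ ω, max (L ω - VaR μ L β) 0 ∂μ) / μ.real {ω | VaR μ L β ≤ L ω} := by
  set v := VaR μ L β
  have hm : MeasurableSet {ω | v ≤ L ω} := measurableSet_le measurable_const hL
  have h1 : CVaR μ L β = (μ.real {ω | v ≤ L ω})⁻¹ * ∫ ω in {ω | v ≤ L ω}, L ω ∂μ := by
    rw [CVaR, ProbabilityTheory.cond, integral_smul_measure, smul_eq_mul, ENNReal.toReal_inv]
    rfl
  have h2 : ∫ ω in {ω | v ≤ L ω}, L ω ∂μ
      = v * μ.real {ω | v ≤ L ω} + ∫ ω, max (L ω - v) 0 ∂μ := by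
    have h3 : ∫ ω in {ω | v ≤ L ω}, max (L ω - v) 0 ∂μ = ∫ ω, max (L ω - v) 0 ∂μ := by
      refine setIntegral_eq_integral_of_forall_compl_eq_zero fun ω hω => ?_
      have hω : ¬ v ≤ L ω := hω
      exact max_eq_right (by linarith [not_le.mp hω])
    rw [← h3]
    have h4 : ∫ ω in {ω | v ≤ L ω}, L ω ∂μ
        = ∫ ω in {ω | v ≤ L ω}, (v + max (L ω - v) 0) ∂μ := by
      refine setIntegral_congr_fun hm fun ω hω => ?_
      have hω : v ≤ L ω := hω
      change L ω = v + max (L ω - v) 0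
      rw [max_eq_left (by linarith)]
      ring
    have h5 : Integrable (fun ω => max (L ω - v) 0) (μ.restrict {ω | v ≤ L ω}) :=
      (hLint.sub (integrable_const v)).pos_part.integrableOn
    rw [h4, integral_add (integrable_const v) h5]
    simp [mul_comm]
  rw [h1, h2]
  field_simp

lemma CVaR_pos (hL : Measurable L) (hL0 : ∀ ω, 0 ≤ L ω) (hLint : Integrable L μ) {b : ℝ}
    (hreg : RegVar (fun t => μ.real {ω | t < L ω}) b) :
    ∀ᶠ β in 𝓝[>] (0 : ℝ), 0 < CVaR μ L β ∧ VaR μ L β ≤ CVaR μ L β := by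
  filter_upwards [(tendsto_VaR hL hreg).eventually_gt_atTop 0] with β hv
  have hQ : 0 < μ.real {ω | VaR μ L β ≤ L ω} := (hreg.pos (VaR μ L β)).trans_le
    (measureReal_mono fun ω (hω : _ < L ω) => hω.le)
  rw [CVaR_eq hL hLint hQ]
  have : 0 < (∫ ω, max (L ω - VaR μ L β) 0 ∂μ) / μ.real {ω | VaR μ L β ≤ L ω} :=
    div_pos ((regVar_integral_excess hL0 hLint hreg).pos _) hQ
  constructor <;> linarith

/-- With positive denominators, the mediant lies between the two ratios. -/
lemma tendsto_add_div_add {ι : Type*} {l : Filter ι} {a b a' b' : ι → ℝ} {r : ℝ}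
    (ha : ∀ᶠ i in l, 0 < a i) (hb : ∀ᶠ i in l, 0 < b i)
    (h1 : Tendsto (fun i => a' i / a i) l (𝓝 r)) (h2 : Tendsto (fun i => b' i / b i) l (𝓝 r)) :
    Tendsto (fun i => (a' i + b' i) / (a i + b i)) l (𝓝 r) := by
  rw [tendsto_order] at *
  refine ⟨fun c hc => ?_, fun c hc => ?_⟩
  · filter_upwards [ha, hb, h1.1 c hc, h2.1 c hc] with i e1 e2 e3 e4
    rw [lt_div_iff₀ (by positivity)] at *
    linarith
  · filter_upwards [ha, hb, h1.2 c hc, h2.2 c hc] with i e1 e2 e3 e4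
    rw [div_lt_iff₀ (by positivity)] at *
    linarith

/-- The ratio of the conditional values at risk at two levels with converging ratio. -/
theorem tendsto_CVaR_div (hL : Measurable L) (hL0 : ∀ ω, 0 ≤ L ω) (hLint : Integrable L μ) {α : ℝ}
    (hα : 0 < α) (hreg : RegVar (fun t => μ.real {ω | t < L ω}) (-α)) {β β₀ : ℕ → ℝ}
    (hβ : Tendsto β atTop (𝓝[>] 0)) (hβ₀ : Tendsto β₀ atTop (𝓝[>] 0)) {c : ℝ} (hc : 0 < c)
    (hr : Tendsto (fun n => β₀ n / β n) atTop (𝓝 c)) :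
    Tendsto (fun n => CVaR μ L (β₀ n) / CVaR μ L (β n)) atTop (𝓝 (c ^ (-α⁻¹))) := by
  set U := fun t => μ.real {ω | t < L ω} with hU
  set Q := fun t => μ.real {ω | t ≤ L ω} with hQdef
  set I := fun v => ∫ ω, max (L ω - v) 0 ∂μ with hI
  have hIreg : RegVar I (1 + -α) := regVar_integral_excess hL0 hLint hreg
  set v := fun n => VaR μ L (β n)
  set w := fun n => VaR μ L (β₀ n)
  have hv : Tendsto v atTop atTop := (tendsto_VaR hL hreg).comp hβ
  have hw : Tendsto w atTop atTop := (tendsto_VaR hL hreg).comp hβ₀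
  have hQpos : ∀ t, 0 < Q t := fun t => (hreg.pos t).trans_le
    (measureReal_mono fun ω (hω : _ < L ω) => hω.le)
  have hUpos : ∀ t, 0 < U t := hreg.pos
  have e1 : Tendsto (fun n => β n / U (v n)) atTop (𝓝 1) := (tendsto_level_div_tail hL hreg).comp hβ
  have e2 : Tendsto (fun n => β₀ n / U (w n)) atTop (𝓝 1) :=
    (tendsto_level_div_tail hL hreg).comp hβ₀
  have hβpos : ∀ᶠ n in atTop, 0 < β n := hβ.eventually self_mem_nhdsWithin
  have hβ₀pos : ∀ᶠ n in atTop, 0 < β₀ n := hβ₀.eventually self_mem_nhdsWithin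
  have e3 : Tendsto (fun n => U (w n) / U (v n)) atTop (𝓝 c) := by
    have := (e1.mul hr).div e2 one_ne_zero
    rw [one_mul, div_one] at this
    refine this.congr' ?_
    filter_upwards [hβpos, hβ₀pos] with n h1 h2
    have h3 := (hUpos (v n)).ne'
    have h4 := (hUpos (w n)).ne'
    simp only [Pi.div_apply]
    field_simp
  have hx : 0 < c ^ (-α⁻¹) := Real.rpow_pos_of_pos hc _
  have hxα : (c ^ (-α⁻¹)) ^ (-α) = c := by
    rw [← Real.rpow_mul hc.le, neg_mul_neg, inv_mul_cancel₀ hα.ne', Real.rpow_one]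
  -- Regular variation inverted: tails in ratio `c` force quantiles in ratio `c ^ (-1/α)`.
  have e4 : Tendsto (fun n => w n / v n) atTop (𝓝 (c ^ (-α⁻¹))) :=
    hreg.tendsto_div_of_ratio (by linarith) hv hx (by rw [hxα]; exact e3)
  have e5 : Tendsto (fun n => I (w n) / I (v n)) atTop (𝓝 (c ^ (-α⁻¹) * c)) := by
    have := hIreg.tendsto_comp hv hx e4
    rwa [Real.rpow_add hx, Real.rpow_one, hxα] at this
  have hQU : Tendsto (fun t => Q t / U t) atTop (𝓝 1) := tendsto_weak_tail_div_tail hreg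
  have e6 : Tendsto (fun n => Q (w n) / Q (v n)) atTop (𝓝 c) := by
    have := ((hQU.comp hw).mul e3).div (hQU.comp hv) one_ne_zero
    rw [one_mul, div_one] at this
    refine this.congr fun n => ?_
    have h3 := (hUpos (v n)).ne'
    have h4 := (hUpos (w n)).ne'
    have h5 := (hQpos (v n)).ne'
    simp only [Pi.div_apply, Function.comp_apply]
    field_simp
  -- The integrated tail has index `1 - α` and contributes `c ^ (-1/α) * c`; dividing by the ratio
  -- `c` of the tails leaves the ratio of the quantiles.
  have e7 : Tendsto (fun n => (I (w n) / Q (w n)) / (I (v n) / Q (v n))) atTop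
      (𝓝 (c ^ (-α⁻¹))) := by
    have := e5.div e6 hc.ne'
    rw [mul_div_cancel_right₀ _ hc.ne'] at this
    refine this.congr fun n => ?_
    have h3 := (hIreg.pos (v n)).ne'
    have h5 := (hQpos (v n)).ne'
    have h6 := (hQpos (w n)).ne'
    simp only [Pi.div_apply]
    field_simp
  have e8 := tendsto_add_div_add (hv.eventually_gt_atTop 0)
    (Eventually.of_forall fun n => div_pos (hIreg.pos (v n)) (hQpos (v n))) e4 e7
  refine e8.congr fun n => ?_
  rw [CVaR_eq hL hLint (hQpos (w n)), CVaR_eq hL hLint (hQpos (v n))]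

end

/-! ### Deterministic inequalities for order statistics. -/

section OrderStatistics

variable {n : ℕ} (x : Fin n → ℝ)

lemma orderStat_eq {j : ℕ} (h1 : 1 ≤ j) (h2 : j ≤ n) :
    orderStat x j = x (Tuple.sort x ⟨j - 1, by omega⟩) := dif_pos ⟨h1, h2⟩

lemma exists_eq_orderStat {j : ℕ} (h1 : 1 ≤ j) (h2 : j ≤ n) : ∃ i, orderStat x j = x i :=
  ⟨_, orderStat_eq x h1 h2⟩

lemma orderStat_mono {j k : ℕ} (h1 : 1 ≤ j) (hjk : j ≤ k) (h2 : k ≤ n) :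
    orderStat x j ≤ orderStat x k := by
  rw [orderStat_eq x h1 (hjk.trans h2), orderStat_eq x (h1.trans hjk) h2]
  exact Tuple.monotone_sort x (Fin.mk_le_mk.mpr (by omega))

/-- The number of observations that exceed `t`. -/
noncomputable def exceedances (t : ℝ) : ℕ := (Finset.univ.filter fun i => t < x i).card

lemma exceedances_eq_sum (t : ℝ) :
    (exceedances x t : ℝ) = ∑ i, Set.indicator (Set.Ioi t) (fun _ => (1 : ℝ)) (x i) := by
  simp [exceedances, Set.indicator_apply]

lemma exceedances_anti {s t : ℝ} (h : s ≤ t) : exceedances x t ≤ exceedances x s := by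
  refine Finset.card_le_card fun i hi => ?_
  simp only [Finset.mem_filter, Finset.mem_univ, true_and] at hi ⊢
  exact lt_of_le_of_lt h hi

lemma exceedances_eq_card_sort (t : ℝ) :
    exceedances x t = (Finset.univ.filter fun i => t < x (Tuple.sort x i)).card := by
  refine Finset.card_bij' (fun i _ => (Tuple.sort x).symm i) (fun i _ => Tuple.sort x i)
    ?_ ?_ ?_ ?_ <;> simp

/-- With `lt_exceedances_of_lt_orderStat`, this translates bounds on order statistics into bounds on
counts, which are sums of independent indicators. Ties can make the count smaller than `n - j`. -/
lemma exceedances_orderStat_le {j : ℕ} (h1 : 1 ≤ j) (h2 : j ≤ n) :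
    exceedances x (orderStat x j) ≤ n - j := by
  rw [exceedances_eq_card_sort, orderStat_eq x h1 h2]
  have hsub : (Finset.univ.filter fun i =>
      x (Tuple.sort x ⟨j - 1, by omega⟩) < x (Tuple.sort x i)) ⊆
      Finset.Ioi (⟨j - 1, by omega⟩ : Fin n) := by
    intro i hi
    simp only [Finset.mem_filter, Finset.mem_univ, true_and] at hi
    rw [Finset.mem_Ioi]
    by_contra! hle
    exact absurd (Tuple.monotone_sort x hle) (not_le.mpr hi)
  refine (Finset.card_le_card hsub).trans ?_
  rw [Fin.card_Ioi]
  simp only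
  omega

lemma lt_exceedances_of_lt_orderStat {j : ℕ} (h1 : 1 ≤ j) (h2 : j ≤ n) {t : ℝ}
    (ht : t < orderStat x j) : n - j < exceedances x t := by
  rw [exceedances_eq_card_sort]
  rw [orderStat_eq x h1 h2] at ht
  have hsub : Finset.Ici (⟨j - 1, by omega⟩ : Fin n) ⊆
      (Finset.univ.filter fun i => t < x (Tuple.sort x i)) := by
    intro i hi
    simp only [Finset.mem_filter, Finset.mem_univ, true_and]
    rw [Finset.mem_Ici] at hi
    exact ht.trans_le (Tuple.monotone_sort x hi)
  refine lt_of_lt_of_le ?_ (Finset.card_le_card hsub)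
  rw [Fin.card_Ici]
  simp only
  omega

/-- The sum of the logarithmic excesses over `s`. -/
noncomputable def logExcess (s : ℝ) : ℝ := ∑ i, max (Real.log (x i / s)) 0

variable {x}

/-- Truncated log excesses vanish below the threshold, so the sum over the top observations extends
to the whole sample. At a deterministic threshold it would be a sum of i.i.d. terms. -/
lemma hill_eq (hx : ∀ i, 0 ≤ x i) {β : ℝ} (hk : ⌊(n : ℝ) * β⌋₊ < n)
    (hv : 0 < orderStat x (n - ⌊(n : ℝ) * β⌋₊)) :
    hill x β = 1 / ((n : ℝ) * β) * logExcess x (orderStat x (n - ⌊(n : ℝ) * β⌋₊)) := by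
  set k := ⌊(n : ℝ) * β⌋₊
  set v := orderStat x (n - k)
  rw [hill]
  congr 1
  have h1 : logExcess x v = ∑ i : Fin n, max (Real.log (x (Tuple.sort x i) / v)) 0 :=
    (Equiv.sum_comp (Tuple.sort x) fun i => max (Real.log (x i / v)) 0).symm
  have h2 : ∀ i : Fin n, max (Real.log (x (Tuple.sort x i) / v)) 0
      = max (Real.log (orderStat x (i + 1) / v)) 0 := by
    intro i
    rw [orderStat_eq x (by omega) (by omega)]
    rfl
  rw [h1, Finset.sum_congr rfl fun i _ => h2 i,
    Fin.sum_univ_eq_sum_range (fun j => max (Real.log (orderStat x (j + 1) / v)) 0),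
    ← Finset.sum_range_reflect (fun j => max (Real.log (orderStat x (j + 1) / v)) 0)]
  have hsub : Finset.range k ⊆ Finset.range n := Finset.range_subset_range.mpr hk.le
  rw [← Finset.sum_subset hsub]
  · refine Finset.sum_congr rfl fun i hi => ?_
    rw [Finset.mem_range] at hi
    have e : n - 1 - i + 1 = n - i := by omega
    have hle : v ≤ orderStat x (n - i) := orderStat_mono x (by omega) (by omega) (by omega)
    rw [e, Real.log_div (hv.trans_le hle).ne' hv.ne', max_eq_left]
    linarith [Real.log_le_log hv hle]
  · intro i hi hik
    rw [Finset.mem_range] at hi hik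
    have e : n - 1 - i + 1 = n - i := by omega
    have hle : orderStat x (n - i) ≤ v := orderStat_mono x (by omega) (by omega) (by omega)
    obtain ⟨l, hl⟩ := exists_eq_orderStat x (show 1 ≤ n - i by omega) (by omega)
    have h0 : 0 ≤ orderStat x (n - i) := hl ▸ hx l
    rw [e, max_eq_right]
    exact Real.log_nonpos (by positivity) ((div_le_one hv).mpr hle)

/-- Only observations above `s` or above `t` feel a change of threshold, each by at most `|log s -
log t|`. This is how the random threshold is exchanged for the quantile. -/
lemma abs_logExcess_sub_le (hx : ∀ i, 0 ≤ x i) {s t : ℝ} (hs : 0 < s) (ht : 0 < t) :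
    |logExcess x s - logExcess x t|
      ≤ |Real.log s - Real.log t| * (exceedances x s + exceedances x t) := by
  rw [logExcess, logExcess, ← Finset.sum_sub_distrib, exceedances_eq_sum, exceedances_eq_sum,
    ← Finset.sum_add_distrib, Finset.mul_sum]
  refine (Finset.abs_sum_le_sum_abs _ _).trans (Finset.sum_le_sum fun i _ => ?_)
  have hzero : ∀ {s}, 0 < s → x i ≤ s → max (Real.log (x i / s)) 0 = 0 := fun hs h =>
    max_eq_right (Real.log_nonpos (div_nonneg (hx i) hs.le) ((div_le_one hs).mpr h))
  have hone : ∀ {s}, 0 < s → s < x i → max (Real.log (x i / s)) 0 = Real.log (x i) - Real.log s := by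
    intro s hs h
    rw [Real.log_div (hs.trans h).ne' hs.ne', max_eq_left]
    linarith [Real.log_le_log hs h.le]
  simp only [Set.indicator_apply, Set.mem_Ioi]
  split_ifs with h1 h2 h2
  · rw [hone hs h1, hone ht h2, show Real.log (x i) - Real.log s - (Real.log (x i) - Real.log t)
      = -(Real.log s - Real.log t) by ring, abs_neg]
    nlinarith [abs_nonneg (Real.log s - Real.log t)]
  · rw [hone hs h1, hzero ht (not_lt.mp h2)]
    have e1 := Real.log_le_log hs h1.le
    have e2 := Real.log_le_log (hs.trans h1) (not_lt.mp h2)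
    rw [abs_of_nonneg (by linarith), abs_of_nonpos (by linarith)]
    linarith
  · rw [hzero hs (not_lt.mp h1), hone ht h2]
    have e1 := Real.log_le_log ht h2.le
    have e2 := Real.log_le_log (ht.trans h2) (not_lt.mp h1)
    rw [abs_of_nonpos (by linarith), abs_of_nonneg (by linarith)]
    linarith
  · rw [hzero hs (not_lt.mp h1), hzero ht (not_lt.mp h2)]
    simp

lemma sampleVaR_index (hn : 0 < n) {β : ℝ} (h0 : 0 < β) (h1 : β < 1) :
    1 ≤ ⌈(n : ℝ) * (1 - β)⌉₊ ∧ ⌈(n : ℝ) * (1 - β)⌉₊ ≤ n := by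
  have hn' : (0 : ℝ) < n := by exact_mod_cast hn
  refine ⟨Nat.one_le_ceil_iff.mpr (mul_pos hn' (by linarith)), Nat.ceil_le.mpr ?_⟩
  nlinarith

/-- The sample-average estimator does not exceed the sample maximum. -/
lemma sampleCVaR_le (hn : 0 < n) {β : ℝ} (h0 : 0 < β) (h1 : β < 1) {t : ℝ} (ht : ∀ i, x i ≤ t) :
    sampleCVaR x β ≤ t := by
  obtain ⟨hj1, hj2⟩ := sampleVaR_index hn h0 h1
  have hn' : (0 : ℝ) < n := by exact_mod_cast hn
  set v := sampleVaR x β with hv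
  have hvt : v ≤ t := by
    obtain ⟨i, hi⟩ := exists_eq_orderStat x hj1 hj2
    rw [hv, sampleVaR, hi]
    exact ht i
  have hsum : ∑ i, max (x i - v) 0 ≤ n * β * (t - v) := by
    calc ∑ i, max (x i - v) 0
        ≤ ∑ i, Set.indicator (Set.Ioi v) (fun _ => (1 : ℝ)) (x i) * (t - v) := by
          refine Finset.sum_le_sum fun i _ => ?_
          simp only [Set.indicator_apply, Set.mem_Ioi]
          split_ifs with h
          · rw [one_mul]; exact max_le (by linarith [ht i]) (by linarith)
          · rw [zero_mul]; exact max_le (by linarith [not_lt.mp h]) le_rfl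
      _ = exceedances x v * (t - v) := by rw [← Finset.sum_mul, exceedances_eq_sum]
      _ ≤ n * β * (t - v) := by
          refine mul_le_mul_of_nonneg_right ?_ (by linarith)
          -- At most `n - ⌈n (1 - β)⌉ ≤ n β` observations exceed `v`, so the normalized excess sum
          -- is at most `t - v`.
          have h2 := exceedances_orderStat_le x hj1 hj2
          have h3 : (exceedances x v : ℝ) ≤ ((n - ⌈(n : ℝ) * (1 - β)⌉₊ : ℕ) : ℝ) := by
            exact_mod_cast h2
          rw [Nat.cast_sub hj2] at h3
          linarith [Nat.le_ceil ((n : ℝ) * (1 - β))]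
  rw [sampleCVaR, ← hv, one_div, inv_mul_eq_div]
  have : (∑ i, max (x i - v) 0) / (n * β) ≤ t - v := by
    rw [div_le_iff₀ (by positivity)]
    linarith
  linarith

/-- The sample maximum is at most a multiple of the sample-average estimator. -/
lemma le_mul_sampleCVaR (hx : ∀ i, 0 ≤ x i) {β : ℝ} (h0 : 0 < β) (h1 : β < 1)
    {K : ℝ} (hK1 : 1 ≤ K) (hK : n * β ≤ K) (i : Fin n) : x i ≤ K * sampleCVaR x β := by
  have hn : 0 < n := Fin.pos i
  obtain ⟨hj1, hj2⟩ := sampleVaR_index hn h0 h1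
  have hn' : (0 : ℝ) < n := by exact_mod_cast hn
  set v := sampleVaR x β with hv
  have hv0 : 0 ≤ v := by
    obtain ⟨i, hi⟩ := exists_eq_orderStat x hj1 hj2
    rw [hv, sampleVaR, hi]
    exact hx i
  set S := ∑ i, max (x i - v) 0 with hS
  have hxS : x i - v ≤ S := (le_max_left _ _).trans
    (Finset.single_le_sum (f := fun i => max (x i - v) 0) (fun i _ => le_max_right _ _)
      (Finset.mem_univ i))
  have hS0 : 0 ≤ S := Finset.sum_nonneg fun i _ => le_max_right _ _
  rw [sampleCVaR, ← hv, ← hS, one_div, inv_mul_eq_div]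
  -- With `n β ≤ K` the weight `1 / (n β)` is at least `1 / K`, so a single large excess survives
  -- the averaging.
  have h2 : S ≤ K * (S / (n * β)) := by
    rw [mul_div_assoc', le_div_iff₀ (by positivity)]
    nlinarith
  nlinarith

end OrderStatistics

/-! ### Law of large numbers and consistency of the Hill estimator. -/

section

variable {Ω : Type*} [MeasurableSpace Ω] {μ : Measure Ω}

lemma tendsto_measure_zero_of_subset_union {ι : Type*} {l : Filter ι} {S A B : ι → Set Ω}
    (h : ∀ᶠ i in l, S i ⊆ A i ∪ B i) (hA : Tendsto (fun i => μ (A i)) l (𝓝 0))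
    (hB : Tendsto (fun i => μ (B i)) l (𝓝 0)) : Tendsto (fun i => μ (S i)) l (𝓝 0) := by
  have hAB := hA.add hB
  rw [add_zero] at hAB
  exact tendsto_of_tendsto_of_tendsto_of_le_of_le' tendsto_const_nhds hAB
    (Eventually.of_forall fun _ => zero_le)
    (h.mono fun i hi => (measure_mono hi).trans (measure_union_le _ _))

variable [IsProbabilityMeasure μ] {L : ℕ → Ω → ℝ}

/-- A weak law of large numbers for row sums of a triangular array. -/
lemma tendsto_measure_rowSum (hindep : iIndepFun L μ)
    (hident : ∀ i, IdentDistrib (L i) (L 0) μ μ) {f : ℕ → ℝ → ℝ} (hf : ∀ n, Measurable (f n))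
    {r : ℕ → ℝ} (hr : ∀ᶠ n in atTop, 0 < r n)
    (hmem : ∀ᶠ n in atTop, MemLp (fun ω => f n (L 0 ω)) 2 μ) {m : ℝ}
    (hmean : Tendsto (fun n : ℕ => n * (∫ ω, f n (L 0 ω) ∂μ) / r n) atTop (𝓝 m))
    (hsq : Tendsto (fun n : ℕ => n * (∫ ω, f n (L 0 ω) ^ 2 ∂μ) / r n ^ 2) atTop (𝓝 0))
    {ε : ℝ} (hε : 0 < ε) :
    Tendsto (fun n => μ {ω | ε ≤ |(∑ i : Fin n, f n (L i ω)) / r n - m|}) atTop (𝓝 0) := by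
  -- Chebyshev's bound for a deviation `ε / 2 * r n`, whence `4 / ε ^ 2`; the other `ε / 2` is left
  -- for the bias of the mean.
  have hlim : Tendsto (fun n : ℕ => ENNReal.ofReal
      (n * (∫ ω, f n (L 0 ω) ^ 2 ∂μ) / r n ^ 2 * (4 / ε ^ 2))) atTop (𝓝 0) := by
    have := ENNReal.tendsto_ofReal (hsq.mul_const (4 / ε ^ 2))
    simpa using this
  refine tendsto_of_tendsto_of_tendsto_of_le_of_le' tendsto_const_nhds hlim
    (Eventually.of_forall fun _ => zero_le) ?_
  have hclose : ∀ᶠ n : ℕ in atTop, |n * (∫ ω, f n (L 0 ω) ∂μ) / r n - m| < ε / 2 := by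
    have := (tendsto_order.mp ((hmean.sub_const m).abs)).2 (ε / 2)
    simp only [sub_self, abs_zero] at this
    exact this (by positivity)
  filter_upwards [hr, hmem, hclose] with n hrn hmemn hcn
  set Z : ℕ → Ω → ℝ := fun i ω => f n (L i ω)
  have hidZ : ∀ i, IdentDistrib (Z i) (Z 0) μ μ := fun i => (hident i).comp (hf n)
  have hZmem : ∀ i, MemLp (Z i) 2 μ := fun i => (hidZ i).memLp_iff.mpr hmemn
  set S : Ω → ℝ := ∑ i ∈ Finset.range n, Z i with hS
  have hSmem : MemLp S 2 μ := memLp_finsetSum' _ fun i _ => hZmem i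
  have hES : μ[S] = n * ∫ ω, f n (L 0 ω) ∂μ := by
    have : μ[S] = ∑ i ∈ Finset.range n, ∫ ω, Z i ω ∂μ := by
      rw [← integral_finsetSum _ fun i _ => (hZmem i).integrable one_le_two]
      simp [hS]
    rw [this, Finset.sum_congr rfl fun i _ => (hidZ i).integral_eq]
    simp [Z]
  have hVar : Var[S; μ] ≤ n * ∫ ω, f n (L 0 ω) ^ 2 ∂μ := by
    rw [hS, IndepFun.variance_sum (fun i _ => hZmem i) fun i _ j _ hij =>
      (hindep.indepFun hij).comp (hf n) (hf n),
      Finset.sum_congr rfl fun i _ => (hidZ i).variance_eq, Finset.sum_const, Finset.card_range,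
      nsmul_eq_mul]
    refine mul_le_mul_of_nonneg_left ?_ (Nat.cast_nonneg _)
    exact variance_le_expectation_sq (hZmem 0).aestronglyMeasurable
  have hc : 0 < ε / 2 * r n := by positivity
  calc μ {ω | ε ≤ |(∑ i : Fin n, f n (L i ω)) / r n - m|}
      ≤ μ {ω | ε / 2 * r n ≤ |S ω - μ[S]|} := by
        refine measure_mono fun ω hω => ?_
        have hω : ε ≤ |(∑ i : Fin n, f n (L i ω)) / r n - m| := hω
        show ε / 2 * r n ≤ |S ω - μ[S]|
        have e1 : ∑ i : Fin n, f n (L i ω) = S ω := by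
          rw [hS, Finset.sum_apply, Finset.sum_range]
        rw [e1] at hω
        have e2 := abs_sub_le (S ω / r n) (n * (∫ ω, f n (L 0 ω) ∂μ) / r n) m
        rw [← sub_div, abs_div, abs_of_pos hrn, ← hES] at e2
        rw [← hES] at hcn
        have e3 : ε / 2 ≤ |S ω - μ[S]| / r n := by linarith
        rwa [le_div_iff₀ hrn] at e3
    _ ≤ ENNReal.ofReal (Var[S; μ] / (ε / 2 * r n) ^ 2) := meas_ge_le_variance_div_sq hSmem hc
    _ ≤ _ := by
        refine ENNReal.ofReal_le_ofReal ?_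
        calc Var[S; μ] / (ε / 2 * r n) ^ 2
            ≤ (n * ∫ ω, f n (L 0 ω) ^ 2 ∂μ) / (ε / 2 * r n) ^ 2 :=
              div_le_div_of_nonneg_right hVar (by positivity)
          _ = _ := by field_simp; norm_num

variable (hL : ∀ i, Measurable (L i)) (hindep : iIndepFun L μ)
  (hident : ∀ i, IdentDistrib (L i) (L 0) μ μ) {α : ℝ}
  (hreg : RegVar (fun t => μ.real {ω | t < L 0 ω}) (-α)) {β : ℕ → ℝ}
  (hβ : Tendsto β atTop (𝓝[>] 0)) (hnβ : Tendsto (fun n : ℕ => n * β n) atTop atTop)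

include hL hindep hident hreg hβ hnβ

/-- The number of exceedances of a multiple of the value at risk. -/
lemma tendsto_measure_exceedances_VaR {y : ℝ} (hy : 0 < y) {ε : ℝ} (hε : 0 < ε) :
    Tendsto (fun n => μ {ω | ε ≤ |(exceedances (fun i : Fin n => L i ω)
      (VaR μ (L 0) (β n) * y) : ℝ) / (n * β n) - y ^ (-α)|}) atTop (𝓝 0) := by
  set v := fun n => VaR μ (L 0) (β n)
  have hv : Tendsto v atTop atTop := (tendsto_VaR (hL 0) hreg).comp hβ
  set f : ℕ → ℝ → ℝ := fun n => Set.indicator (Set.Ioi (v n * y)) fun _ => 1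
  have hfm : ∀ n, Measurable (f n) := fun n => measurable_const.indicator measurableSet_Ioi
  have hfint : ∀ n, ∫ ω, f n (L 0 ω) ∂μ = μ.real {ω | v n * y < L 0 ω} := by
    intro n
    have : (fun ω => f n (L 0 ω)) = Set.indicator {ω | v n * y < L 0 ω} fun _ => 1 := by
      ext ω
      simp [f, Set.indicator_apply]
    rw [this, integral_indicator (measurableSet_lt measurable_const (hL 0))]
    simp
  have hfsq : ∀ n ω, f n (L 0 ω) ^ 2 = f n (L 0 ω) := by
    intro n ω
    simp only [f, Set.indicator_apply]
    split_ifs <;> norm_num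
  have hβpos : ∀ᶠ n in atTop, 0 < β n := hβ.eventually self_mem_nhdsWithin
  have hrate : Tendsto (fun n => μ.real {ω | v n * y < L 0 ω} / β n) atTop (𝓝 (y ^ (-α))) := by
    have h1 := ((hreg.ratio y hy).comp hv).div ((tendsto_level_div_tail (hL 0) hreg).comp hβ)
      one_ne_zero
    rw [div_one] at h1
    refine h1.congr fun n => ?_
    have := (hreg.pos (v n)).ne'
    exact div_div_div_cancel_right₀ this _ _
  have hmean : Tendsto (fun n : ℕ => n * (∫ ω, f n (L 0 ω) ∂μ) / (n * β n)) atTop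
      (𝓝 (y ^ (-α))) := by
    refine hrate.congr' ?_
    filter_upwards [eventually_gt_atTop 0] with n hn
    have : (n : ℝ) ≠ 0 := by positivity
    rw [hfint, mul_div_mul_left _ _ this]
  have hsq : Tendsto (fun n : ℕ => n * (∫ ω, f n (L 0 ω) ^ 2 ∂μ) / (n * β n) ^ 2) atTop
      (𝓝 0) := by
    refine (hmean.div_atTop hnβ).congr fun n => ?_
    simp only [hfsq]
    rw [div_div, sq]
  have := tendsto_measure_rowSum hindep hident hfm (hnβ.eventually_gt_atTop 0)
    (Eventually.of_forall fun n => MemLp.of_bound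
      ((hfm n).comp (hL 0)).aestronglyMeasurable 1 (ae_of_all _ fun ω => by
        simp only [f, Set.indicator_apply]
        split_ifs <;> simp)) hmean hsq hε
  simpa only [exceedances_eq_sum] using this

/-- The intermediate order statistics are asymptotic to the value at risk. -/
lemma tendsto_measure_orderStat {η : ℝ} (hα : 0 < α) (hη : 0 < η) :
    Tendsto (fun n => μ {ω | ¬ (VaR μ (L 0) (β n) * Real.exp (-η)
        < orderStat (fun i : Fin n => L i ω) (n - ⌊(n : ℝ) * β n⌋₊) ∧
      orderStat (fun i : Fin n => L i ω) (n - ⌊(n : ℝ) * β n⌋₊)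
        ≤ VaR μ (L 0) (β n) * Real.exp η)}) atTop (𝓝 0) := by
  -- About `n β * y ^ (-α)` observations exceed `v_β * y`. For `y` below, respectively above, `1`
  -- this is strictly more, respectively less, than `n β`, so a misplaced order statistic forces an
  -- atypical count.
  have h1 : 1 < Real.exp (-η) ^ (-α) :=
    Real.one_lt_rpow_of_pos_of_lt_one_of_neg (Real.exp_pos _) (by simpa using hη) (by linarith)
  have h2 : Real.exp η ^ (-α) < 1 :=
    Real.rpow_lt_one_of_one_lt_of_neg (by simpa using hη) (by linarith)
  have e1 := tendsto_measure_exceedances_VaR hL hindep hident hreg hβ hnβ (Real.exp_pos (-η))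
    (sub_pos.mpr h1)
  have e2 := tendsto_measure_exceedances_VaR hL hindep hident hreg hβ hnβ (Real.exp_pos η)
    (sub_pos.mpr h2)
  refine tendsto_measure_zero_of_subset_union ?_ e1 e2
  have hβ01 : ∀ᶠ n in atTop, β n ∈ Set.Ioo (0 : ℝ) 1 := hβ.eventually (Ioo_mem_nhdsGT one_pos)
  filter_upwards [hβ01, hnβ.eventually_gt_atTop 0, eventually_gt_atTop 0] with n hβn hpos hn ω hω
  have hn' : (0 : ℝ) < n := by exact_mod_cast hn
  set x : Fin n → ℝ := fun i => L i ω
  set k := ⌊(n : ℝ) * β n⌋₊ with hk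
  have hkn : k < n := (Nat.floor_lt hpos.le).mpr (by nlinarith [hβn.2])
  have hω : ¬ (VaR μ (L 0) (β n) * Real.exp (-η) < orderStat x (n - k) ∧
      orderStat x (n - k) ≤ VaR μ (L 0) (β n) * Real.exp η) := hω
  rw [not_and_or, not_lt, not_le] at hω
  rcases hω with hω | hω
  · left
    have h3 := (exceedances_anti x hω).trans
      (exceedances_orderStat_le x (show 1 ≤ n - k by omega) (by omega))
    have h4 : exceedances x (VaR μ (L 0) (β n) * Real.exp (-η)) ≤ k := by omega
    have h5 : (exceedances x (VaR μ (L 0) (β n) * Real.exp (-η)) : ℝ) / (n * β n) ≤ 1 := by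
      rw [div_le_one hpos]
      exact (Nat.cast_le.mpr h4).trans (Nat.floor_le hpos.le)
    rw [Set.mem_ofPred_eq]
    rw [abs_sub_comm]
    exact le_trans (by linarith) (le_abs_self _)
  · right
    have h3 := lt_exceedances_of_lt_orderStat x (show 1 ≤ n - k by omega) (by omega) hω
    have h4 : k + 1 ≤ exceedances x (VaR μ (L 0) (β n) * Real.exp η) := by omega
    have h5 : 1 ≤ (exceedances x (VaR μ (L 0) (β n) * Real.exp η) : ℝ) / (n * β n) := by
      rw [one_le_div hpos]
      have h6 : ((k + 1 : ℕ) : ℝ) ≤ exceedances x (VaR μ (L 0) (β n) * Real.exp η) :=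
        Nat.cast_le.mpr h4
      push_cast at h6
      exact ((Nat.lt_floor_add_one _).le).trans h6
    rw [Set.mem_ofPred_eq]
    exact le_trans (by linarith) (le_abs_self _)

/-- Consistency of the Hill estimator. -/
theorem tendsto_measure_hill (hL0 : ∀ i ω, 0 ≤ L i ω) (hLint : Integrable (L 0) μ) (hα : 0 < α)
    {ε : ℝ} (hε : 0 < ε) :
    Tendsto (fun n => μ {ω | ε ≤ |hill (fun i : Fin n => L i ω) (β n) - α⁻¹|}) atTop (𝓝 0) := by
  set v := fun n => VaR μ (L 0) (β n)
  have hv : Tendsto v atTop atTop := (tendsto_VaR (hL 0) hreg).comp hβ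
  have hβ01 : ∀ᶠ n in atTop, β n ∈ Set.Ioo (0 : ℝ) 1 := hβ.eventually (Ioo_mem_nhdsGT one_pos)
  have hUβ : Tendsto (fun n => μ.real {ω | v n < L 0 ω} / β n) atTop (𝓝 1) := by
    have := ((tendsto_level_div_tail (hL 0) hreg).comp hβ).inv₀ one_ne_zero
    rw [inv_one] at this
    refine this.congr fun n => ?_
    simp [v]
  set f : ℕ → ℝ → ℝ := fun n z => max (Real.log (z / v n)) 0
  have hfm : ∀ n, Measurable (f n) := fun n =>
    (Real.measurable_log.comp (measurable_id.div_const _)).max measurable_const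
  obtain ⟨K, hK, hKv⟩ := exists_sq_max_log_le (hL 0) (hL0 0) hα hreg
  have hmean : Tendsto (fun n : ℕ => n * (∫ ω, f n (L 0 ω) ∂μ) / (n * β n)) atTop
      (𝓝 α⁻¹) := by
    have h1 := ((tendsto_integral_max_log (hL 0) (hL0 0) hLint hα hreg).comp hv).mul hUβ
    rw [mul_one] at h1
    refine h1.congr' ?_
    filter_upwards [eventually_gt_atTop 0] with n hn
    have h2 : (n : ℝ) ≠ 0 := by positivity
    rw [mul_div_mul_left _ _ h2]
    exact div_mul_div_cancel₀ (hreg.pos (v n)).ne'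
  have hsq : Tendsto (fun n : ℕ => n * (∫ ω, f n (L 0 ω) ^ 2 ∂μ) / (n * β n) ^ 2) atTop
      (𝓝 0) := by
    refine squeeze_zero' (Eventually.of_forall fun n => ?_) ?_
      ((hUβ.const_mul K).div_atTop hnβ)
    · exact div_nonneg (mul_nonneg (Nat.cast_nonneg _) (integral_nonneg fun ω => sq_nonneg _))
        (sq_nonneg _)
    · filter_upwards [hv.eventually hKv, hβ01, eventually_gt_atTop 0] with n hn hb hn0
      have hn' : (0 : ℝ) < n := by exact_mod_cast hn0
      have hb0 := hb.1
      calc n * (∫ ω, f n (L 0 ω) ^ 2 ∂μ) / (n * β n) ^ 2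
          ≤ n * (K * μ.real {ω | v n < L 0 ω}) / (n * β n) ^ 2 :=
            div_le_div_of_nonneg_right (mul_le_mul_of_nonneg_left hn.2 hn'.le) (by positivity)
        _ = _ := by field_simp
  -- Moving the threshold by `η` on the logarithmic scale affects at most `3 n β` exceedances in
  -- total, an error of `3 η = ε / 4`. Together with `ε / 2` from the law of large numbers this
  -- stays below `ε`.
  set η := ε / 12 with hηdef
  have hη : 0 < η := by positivity
  have e1 := tendsto_measure_rowSum hindep hident hfm (hnβ.eventually_gt_atTop 0)
    (hv.eventually (hKv.mono fun _ h => h.1)) hmean hsq (half_pos hε)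
  have e2 := tendsto_measure_exceedances_VaR hL hindep hident hreg hβ hnβ one_pos one_pos
  have e3 := tendsto_measure_orderStat hL hindep hident hreg hβ hnβ hα hη
  have e12 := tendsto_measure_zero_of_subset_union (Eventually.of_forall fun _ => subset_rfl) e1 e2
  refine tendsto_measure_zero_of_subset_union ?_ e12 e3
  filter_upwards [hβ01, hnβ.eventually_gt_atTop 0, hv.eventually_gt_atTop 0,
    eventually_gt_atTop 0] with n hβn hpos hvn hn ω hω
  have hn' : (0 : ℝ) < n := by exact_mod_cast hn
  set x : Fin n → ℝ := fun i => L i ω with hx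
  have hx0 : ∀ i, 0 ≤ x i := fun i => hL0 i ω
  set k := ⌊(n : ℝ) * β n⌋₊ with hk
  have hkn : k < n := (Nat.floor_lt hpos.le).mpr (by nlinarith [hβn.2])
  by_contra hcon
  rw [Set.mem_union, Set.mem_union, not_or, not_or] at hcon
  obtain ⟨⟨c1, c2⟩, c3⟩ := hcon
  have c1 : |logExcess x (v n) / (n * β n) - α⁻¹| < ε / 2 := not_le.mp c1
  have c2 : |(exceedances x (v n * 1) : ℝ) / (n * β n) - 1 ^ (-α)| < 1 := not_le.mp c2
  have c3 : v n * Real.exp (-η) < orderStat x (n - k) ∧ orderStat x (n - k) ≤ v n * Real.exp η :=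
    not_not.mp c3
  set w := orderStat x (n - k) with hw
  have hw0 : 0 < w := lt_trans (by positivity) c3.1
  have hlog : |Real.log w - Real.log (v n)| ≤ η := by
    have h1 := Real.log_le_log (by positivity) c3.1.le
    have h2 := Real.log_le_log hw0 c3.2
    rw [Real.log_mul hvn.ne' (Real.exp_pos _).ne', Real.log_exp] at h1 h2
    rw [abs_le]
    constructor <;> linarith
  have hN1 : (exceedances x (v n) : ℝ) ≤ 2 * (n * β n) := by
    rw [mul_one, Real.one_rpow] at c2
    have := (abs_lt.mp c2).2
    rw [sub_lt_iff_lt_add, div_lt_iff₀ hpos] at this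
    linarith
  have hN2 : (exceedances x w : ℝ) ≤ n * β n := by
    have h3 := exceedances_orderStat_le x (show 1 ≤ n - k by omega) (by omega)
    have h4 : exceedances x w ≤ k := h3.trans (by omega)
    exact (Nat.cast_le.mpr h4).trans (Nat.floor_le hpos.le)
  have hdiff := abs_logExcess_sub_le hx0 hw0 hvn
  have hdiff2 : |logExcess x w - logExcess x (v n)| ≤ η * (3 * (n * β n)) :=
    hdiff.trans (mul_le_mul hlog (by linarith) (by positivity) hη.le)
  have hh : hill x (β n) = logExcess x w / (n * β n) := by
    rw [hill_eq hx0 hkn hw0, one_div, inv_mul_eq_div]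
  have hω : ε ≤ |hill x (β n) - α⁻¹| := hω
  rw [hh] at hω
  have h5 := abs_sub_le (logExcess x w / (n * β n)) (logExcess x (v n) / (n * β n)) α⁻¹
  rw [← sub_div, abs_div, abs_of_pos hpos] at h5
  have h6 : |logExcess x w - logExcess x (v n)| / (n * β n) ≤ 3 * η := by
    rw [div_le_iff₀ hpos]
    linarith
  have h7 : 3 * η = ε / 4 := by rw [hηdef]; ring
  linarith

end

/-! ### Consistent sample averages force the number of tail observations to infinity. -/

section

variable {Ω : Type*} [MeasurableSpace Ω] {μ : Measure Ω} [IsProbabilityMeasure μ] {L : ℕ → Ω → ℝ}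

/-- If the sample-average estimators have vanishing relative error, then the expected number of
observations beyond the level tends to infinity. -/
theorem tendsto_sample_level (hL : ∀ i, Measurable (L i)) (hindep : iIndepFun L μ)
    (hident : ∀ i, IdentDistrib (L i) (L 0) μ μ) (hL0 : ∀ i ω, 0 ≤ L i ω)
    (hLint : Integrable (L 0) μ) {α : ℝ}
    (hreg : RegVar (fun t => μ.real {ω | t < L 0 ω}) (-α)) {β : ℕ → ℝ}
    (hβ : Tendsto β atTop (𝓝[>] 0))
    (hSA : IsLittleOP μ
      (fun n ω => sampleCVaR (fun i : Fin n => L i ω) (β n) - CVaR μ (L 0) (β n))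
      (fun n => CVaR μ (L 0) (β n))) :
    Tendsto (fun n : ℕ => n * β n) atTop atTop := by
  by_contra hcon
  rw [tendsto_atTop] at hcon
  push Not at hcon
  obtain ⟨K₀, hK₀⟩ := hcon
  -- The subsequence along which `n β n` stays below `K₀`, kept as a filter.
  set l : Filter ℕ := atTop ⊓ 𝓟 {n | n * β n < K₀} with hl
  have hne : l.NeBot := frequently_iff_neBot.mp (hK₀.mono fun n hn => hn)
  have hle : l ≤ atTop := inf_le_left
  have hlK : ∀ᶠ n in l, n * β n < K₀ := mem_inf_of_right (mem_principal_self _)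
  set K := max 1 K₀
  have hK1 : 1 ≤ K := le_max_left _ _
  have hK0 : 0 < K := by linarith
  set C := fun n => CVaR μ (L 0) (β n)
  set U := fun t => μ.real {ω | t < L 0 ω}
  have hCV := hβ.eventually (CVaR_pos (hL 0) (hL0 0) hLint hreg)
  have hCtop : Tendsto C atTop atTop :=
    tendsto_atTop_mono' _ (hCV.mono fun n h => h.2) ((tendsto_VaR (hL 0) hreg).comp hβ)
  have hβ01 : ∀ᶠ n in atTop, β n ∈ Set.Ioo (0 : ℝ) 1 := hβ.eventually (Ioo_mem_nhdsGT one_pos)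
  have hall : ∀ (t : ℝ) (n : ℕ), μ.real {ω | ∀ i : Fin n, L i ω ≤ t} = (1 - U t) ^ n := by
    intro t n
    have h1 := measureReal_forall_mem hindep hident (measurableSet_Iic (a := t)) n
    simp only [Set.mem_Iic] at h1
    rw [h1]
    congr 1
    rw [← probReal_compl_eq_one_sub (measurableSet_lt measurable_const (hL 0))]
    congr 1
    ext ω
    simp
  set B : ℕ → Set Ω := fun n => {ω | 1 / 2 * |C n| <
    |sampleCVaR (fun i : Fin n => L i ω) (β n) - C n|}
  have hB : Tendsto (fun n => μ.real (B n)) atTop (𝓝 0) :=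
    (ENNReal.tendsto_toReal_zero_iff fun n => measure_ne_top _ _).mpr (hSA (1 / 2) (by norm_num))
  -- If all observations are at most `C / 4`, so is the estimator, whose relative error then exceeds
  -- `1 / 2`.
  have hlow : Tendsto (fun n => (1 - U (C n * 4⁻¹)) ^ n) l (𝓝 0) := by
    refine squeeze_zero' (Eventually.of_forall fun n => ?_) ?_ (hB.mono_left hle)
    · rw [← hall]; exact measureReal_nonneg
    · filter_upwards [hle hCV, hle hβ01, hle (eventually_gt_atTop 0)] with n hn hb hn0
      rw [← hall]
      refine measureReal_mono fun ω hω => ?_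
      have h1 := sampleCVaR_le hn0 hb.1 hb.2 hω
      have hCn : 0 < C n := hn.1
      show 1 / 2 * |C n| < |_|
      rw [abs_of_pos hCn, lt_abs]
      right
      linarith
  -- Off `B n` the estimator is at most `3/2 * C`, so no observation exceeds `K` times this, hence
  -- none exceeds `2 K C`.
  have hhigh : Tendsto (fun n => (1 - U (C n * (2 * K))) ^ n) l (𝓝 1) := by
    have h1 : Tendsto (fun n => 1 - μ.real (B n)) l (𝓝 1) := by
      simpa using (tendsto_const_nhds (x := (1 : ℝ))).sub (hB.mono_left hle)
    refine tendsto_of_tendsto_of_tendsto_of_le_of_le' h1 tendsto_const_nhds ?_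
      (Eventually.of_forall fun n => by rw [← hall]; exact measureReal_le_one)
    filter_upwards [hle hCV, hle hβ01, hlK] with n hn hb hnK
    rw [← hall]
    have h2 : (Set.univ : Set Ω) ⊆ B n ∪ {ω | ∀ i : Fin n, L i ω ≤ C n * (2 * K)} := by
      intro ω _
      by_cases hω : ω ∈ B n
      · exact Or.inl hω
      · right
        intro i
        have hω : ¬ 1 / 2 * |C n| < |sampleCVaR (fun i : Fin n => L i ω) (β n) - C n| := hω
        have hCn : 0 < C n := hn.1
        rw [not_lt, abs_of_pos hCn] at hω
        have h3 := (abs_le.mp hω).2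
        have h4 := le_mul_sampleCVaR (x := fun i : Fin n => L i ω) (fun i => hL0 i ω) hb.1 hb.2
          hK1 (hnK.le.trans (le_max_right _ _)) i
        show L i ω ≤ C n * (2 * K)
        nlinarith
    have h3 := (measureReal_mono h2).trans (measureReal_union_le (μ := μ) _ _)
    rw [probReal_univ] at h3
    linarith
  have hratio : Tendsto (fun n => U (C n * 4⁻¹) / U (C n * (2 * K))) atTop
      (𝓝 ((4⁻¹ : ℝ) ^ (-α) / (2 * K) ^ (-α))) := by
    have h1 := ((hreg.ratio 4⁻¹ (by norm_num)).comp hCtop).div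
      ((hreg.ratio (2 * K) (by positivity)).comp hCtop) (by positivity)
    refine h1.congr fun n => ?_
    exact div_div_div_cancel_right₀ (hreg.pos (C n)).ne' _ _
  obtain ⟨M, hM⟩ := exists_nat_gt (2 * ((4⁻¹ : ℝ) ^ (-α) / (2 * K) ^ (-α)))
  have hq : Tendsto (fun n => U (C n * 4⁻¹)) atTop (𝓝 0) := by
    have h0 : Tendsto (fun n => U (VaR μ (L 0) (β n))) atTop (𝓝 0) := by
      refine squeeze_zero' (Eventually.of_forall fun n => measureReal_nonneg) ?_
        (hβ.mono_right nhdsWithin_le_nhds)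
      filter_upwards [hβ01] with n hb using (VaR_spec (hL 0) hb.1 hb.2).1
    have h1 := ((hreg.ratio 4⁻¹ (by norm_num)).comp hCtop).mul
      (squeeze_zero' (Eventually.of_forall fun n => measureReal_nonneg)
        (hCV.mono fun n hn => hreg.anti hn.2) h0)
    rw [mul_zero] at h1
    exact h1.congr fun n => div_mul_cancel₀ _ (hreg.pos (C n)).ne'
  -- Regular variation bounds the ratio of the two tails: `q ≤ M/2 * p`. Then `(1 - p) ^ M ≤ 1 / (1
  -- + 2 q) ≤ 1 - q` for `q ≤ 1/2`. In the limit this reads `1 ≤ 0`.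
  have hcmp : ∀ᶠ n in l, ((1 - U (C n * (2 * K))) ^ n) ^ M ≤ (1 - U (C n * 4⁻¹)) ^ n := by
    have hev : ∀ᶠ n in atTop, U (C n * 4⁻¹) / U (C n * (2 * K)) < M / 2 :=
      hratio.eventually_lt_const (by linarith)
    filter_upwards [hle hev, hle (hq.eventually_lt_const (show (0 : ℝ) < 1 / 2 by norm_num))]
      with n h1 h2
    set p := U (C n * (2 * K))
    set q := U (C n * 4⁻¹)
    have hp0 : 0 < p := hreg.pos _
    have hq0 : 0 < q := hreg.pos _
    have hp1 : p ≤ 1 := measureReal_le_one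
    rw [div_lt_iff₀ hp0] at h1
    rw [← pow_mul, mul_comm n M, pow_mul]
    refine pow_le_pow_left₀ (pow_nonneg (by linarith) _) ?_ n
    calc (1 - p) ^ M ≤ Real.exp (-p) ^ M :=
          pow_le_pow_left₀ (by linarith) (by linarith [Real.add_one_le_exp (-p)]) _
      _ = Real.exp (-(M * p)) := by rw [← Real.exp_nat_mul]; ring_nf
      _ ≤ (1 + M * p)⁻¹ := by
          rw [Real.exp_neg]
          exact inv_anti₀ (by positivity) (by linarith [Real.add_one_le_exp (M * p)])
      _ ≤ (1 + 2 * q)⁻¹ := inv_anti₀ (by positivity) (by linarith)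
      _ ≤ 1 - q := by
          rw [inv_le_iff_one_le_mul₀ (by positivity)]
          nlinarith
  have hfin := le_of_tendsto_of_tendsto (hhigh.pow M) hlow hcmp
  rw [one_pow] at hfin
  linarith

end

end TailCVaR

/-! ### The extrapolated estimator. -/

theorem corollary1 {Ω : Type*} [MeasurableSpace Ω] (μ : Measure Ω) [IsProbabilityMeasure μ]
    {d : ℕ} (hd : 0 < d)
    -- the data: i.i.d. random vectors with nonnegative entries and heavy tails
    (X : ℕ → Ω → Fin d → ℝ) (hXmeas : ∀ i, Measurable (X i)) (hXindep : iIndepFun X μ)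
    (hXident : ∀ i, IdentDistrib (X i) (X 0) μ μ) (hXnonneg : ∀ᵐ ω ∂μ, ∀ k, 0 ≤ X 0 ω k)
    (hXtail : TailCVaR.HeavyTailed μ X)
    -- the loss function, the parameter and the loss `L = ℓ(θᵀ X)`
    (ℓ : ℝ → ℝ) (hℓ : TailCVaR.RegularLoss ℓ)
    (θ : Fin d → ℝ) (hθ : ∀ k, 0 < θ k)
    (L : ℕ → Ω → ℝ) (hL : ∀ i ω, L i ω = ℓ (∑ k, θ k * X i ω k))
    (hLint : Integrable (L 0) μ)
    -- the levels
    (β β₀ : ℕ → ℝ) (hβ : Tendsto β atTop (𝓝[>] 0))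
    (c : ℝ) (hc : 1 < c) (hβ₀ : Tendsto (fun n => β₀ n / β n) atTop (𝓝 c))
    -- the sample-average estimators at level `β₀ n` have vanishing relative error
    (hSA : TailCVaR.IsLittleOP μ
      (fun n ω => TailCVaR.sampleCVaR (fun i : Fin n => L i ω) (β₀ n)
        - TailCVaR.CVaR μ (L 0) (β₀ n))
      (fun n => TailCVaR.CVaR μ (L 0) (β₀ n))) :
    TailCVaR.IsLittleOP μ
      (fun n ω => TailCVaR.extrapolatedCVaR (fun i : Fin n => L i ω) (β n) (β₀ n)
        - TailCVaR.CVaR μ (L 0) (β n))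
      (fun n => TailCVaR.CVaR μ (L 0) (β n)) := by
  have hg : Measurable fun z : Fin d → ℝ => ℓ (∑ k, θ k * z k) :=
    hℓ.measurable.comp (Finset.measurable_sum _ fun k _ => (measurable_pi_apply k).const_mul _)
  have hLX : ∀ i, L i = (fun z : Fin d → ℝ => ℓ (∑ k, θ k * z k)) ∘ X i := fun i =>
    funext fun ω => hL i ω
  have hLm : ∀ i, Measurable (L i) := fun i => by rw [hLX]; exact hg.comp (hXmeas i)
  have hLindep : iIndepFun L μ := by
    have := hXindep.comp (fun _ z => ℓ (∑ k, θ k * z k)) fun _ => hg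
    rwa [show L = fun i => (fun z : Fin d → ℝ => ℓ (∑ k, θ k * z k)) ∘ X i from funext hLX]
  have hLident : ∀ i, IdentDistrib (L i) (L 0) μ μ := fun i => by
    rw [hLX i, hLX 0]; exact (hXident i).comp hg
  have hL0 : ∀ i ω, 0 ≤ L i ω := fun i ω => by rw [hL]; exact hℓ.nonneg _
  obtain ⟨αY, hαY, hregY⟩ :=
    hXtail.regVar_linear_combination hd hXmeas hXindep hXident hXnonneg hθ
  obtain ⟨α, hα, hreg⟩ := hℓ.regVar (Y := fun ω => ∑ k, θ k * X 0 ω k)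
    (hXnonneg.mono fun ω hω => Finset.sum_nonneg fun k _ => mul_nonneg (hθ k).le (hω k)) hαY hregY
  simp only [← hL] at hreg
  have hc0 : 0 < c := by linarith
  have hβpos : ∀ᶠ n in atTop, 0 < β n := hβ.eventually self_mem_nhdsWithin
  have hβ₀lim : Tendsto β₀ atTop (𝓝[>] 0) := by
    rw [tendsto_nhdsWithin_iff]
    constructor
    · have h1 := hβ₀.mul (hβ.mono_right nhdsWithin_le_nhds)
      rw [mul_zero] at h1
      refine h1.congr' ?_
      filter_upwards [hβpos] with n hn using div_mul_cancel₀ _ hn.ne'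
    · filter_upwards [hβpos, hβ₀.eventually_const_lt hc0] with n h1 h2
      exact (div_pos_iff_of_pos_right h1).mp h2
  have hnβ := TailCVaR.tendsto_sample_level hLm hLindep hLident hL0 hLint hreg hβ₀lim hSA
  have hC := TailCVaR.tendsto_CVaR_div (hLm 0) (hL0 0) hLint hα hreg hβ hβ₀lim hc0 hβ₀
  have hCpos := hβ.eventually (TailCVaR.CVaR_pos (hLm 0) (hL0 0) hLint hreg)
  have hC₀pos := hβ₀lim.eventually (TailCVaR.CVaR_pos (hLm 0) (hL0 0) hLint hreg)
  intro ε hε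
  -- The relative value of the extrapolated estimator is this continuous function of the
  -- sample-average ratio, the ratio of the true values, the ratio of the levels and the Hill
  -- estimator. At the limit point it equals `1`.
  have hΦ : ContinuousAt (fun z : (ℝ × ℝ) × ℝ × ℝ => z.1.1 * z.1.2 * z.2.1 ^ z.2.2)
      ((1, c ^ (-α⁻¹)), c, α⁻¹) := by
    refine ContinuousAt.mul (by fun_prop) (ContinuousAt.rpow (by fun_prop) (by fun_prop) ?_)
    exact Or.inl hc0.ne'
  have hΦ1 : (1 : ℝ) * c ^ (-α⁻¹) * c ^ α⁻¹ = 1 := by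
    rw [one_mul, ← Real.rpow_add hc0, neg_add_cancel, Real.rpow_zero]
  obtain ⟨δ, hδ, hball⟩ := Metric.continuousAt_iff.mp hΦ ε hε
  have hH := TailCVaR.tendsto_measure_hill hLm hLindep hLident hreg hβ₀lim hnβ hL0 hLint hα hδ
  -- The level `δ / 2` is used because the complement of the bad event gives only a non-strict
  -- bound, while the ball of radius `δ` is open.
  refine TailCVaR.tendsto_measure_zero_of_subset_union ?_ (hSA (δ / 2) (half_pos hδ)) hH
  filter_upwards [hCpos, hC₀pos, Metric.tendsto_nhds.mp hC δ hδ, Metric.tendsto_nhds.mp hβ₀ δ hδ]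
    with n h1 h2 h3 h4 ω hω
  by_contra hcon
  rw [Set.mem_union, not_or] at hcon
  rw [Set.mem_ofPred_eq, Set.mem_ofPred_eq, not_lt, not_le] at hcon
  obtain ⟨e1, e2⟩ := hcon
  set C := TailCVaR.CVaR μ (L 0) (β n)
  set C₀ := TailCVaR.CVaR μ (L 0) (β₀ n)
  set S := TailCVaR.sampleCVaR (fun i : Fin n => L i ω) (β₀ n) with hS
  set h := TailCVaR.hill (fun i : Fin n => L i ω) (β₀ n) with hh
  have hCp : 0 < C := h1.1
  have hC₀p : 0 < C₀ := h2.1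
  have e3 : dist (S / C₀) 1 < δ := by
    rw [Real.dist_eq, div_sub_one hC₀p.ne', abs_div, div_lt_iff₀ (abs_pos.mpr hC₀p.ne')]
    have : 0 < δ / 2 * |C₀| := by positivity
    linarith
  have e4 := hball (x := ((S / C₀, C₀ / C), β₀ n / β n, h)) (by
    rw [Prod.dist_eq, Prod.dist_eq, Prod.dist_eq]
    exact max_lt (max_lt e3 h3) (max_lt h4 (by rw [Real.dist_eq]; exact e2)))
  simp only [hΦ1] at e4
  have e5 : S / C₀ * (C₀ / C) = S / C := div_mul_div_cancel₀ hC₀p.ne'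
  rw [e5, Real.dist_eq, div_mul_eq_mul_div, div_sub_one hCp.ne', abs_div,
    div_lt_iff₀ (abs_pos.mpr hCp.ne')] at e4
  have hω : ε * |C| < |S * (β₀ n / β n) ^ h - C| := hω
  linarith
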